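/- For a bounded domain $\mathscr D\subset\mathbb R^n$ ($n\ge 2$) and the Dirichlet or the Neumann boundary condition, let $\mathscr N_{\mathscr D}(\mu)=\#\{j : \lambda_j\le\mu\}$, where $\lambda_j^2$ ($\lambda_j\ge 0$) are the eigenvalues of the Laplacian $-\Delta$ on $\mathscr D$ with that boundary condition, counted with multiplicity. Define the Weyl remainder $\mathscr R_{\mathscr D}(\mu)$ by $$\mathscr N_{\mathscr D}(\mu)=\frac{\omega_n}{(2\pi)^n}\,|\mathscr D|\,\mu^n\mp\frac{\omega_{n-1}}{4(2\pi)^{n-1}}\,|\partial\mathscr D|\,\mu^{n-1}+\mathscr R_{\mathscr D}(\mu),$$ with the minus sign for Dirichlet and the plus sign for Neumann, where $\omega_k$ is the volume of the unit ball of $\mathbb R^k$, $|\mathscr D|$ is the volume of $\mathscr D$ and $|\partial\mathscr D|$ is the $(n-1)$-dimensional surface measure of its boundary. For $R,L>0$ let $\mathcal B_R^{n}\subset\mathbb R^{n}$ be the ball of radius $R$ centered at the origin, and let $\mathcal C_{R,L}^{d}=\mathcal B_R^{d-1}\times[0,L]\subset\mathbb R^d$ be the cylinder of radius $R$ and height $L$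 (its Laplacian being that of its interior). **Theorem.** Let $d\ge 3$ be an integer and $R,L>0$, and fix one of the two boundary conditions. If there is a constant $\alpha\in(0,1)$ such that, for every $\varepsilon>0$, $$\mathscr R_{\mathcal B_R^{d-1}}(\mu)=O_{\varepsilon}\left(\mu^{d-3+\alpha+\varepsilon}\right)\qquad(\mu\to\infty),$$ then, with the same $\alpha$, for every $\varepsilon>0$, $$\mathscr R_{\mathcal C_{R,L}^{d}}(\mu)=O_{\varepsilon}\left(\mu^{d-2+\alpha+\varepsilon}\right)\qquad(\mu\to\infty),$$ where the remainders are those for the fixed boundary condition. (The implied constants may depend on $\varepsilon$, and on $d$, $R$, $L$, $\alpha$.) -/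

import Mathlib

open MeasureTheory Asymptotics Filter TopologicalSpace
open scoped ENNReal ContDiff Distributions Gradient

noncomputable section

namespace WeylLaw

/-- The boundary conditions considered for the Laplacian. -/
inductive BoundaryCondition
  | dirichlet
  | neumann

/-- The sign of the second term of Weyl's law: minus for Dirichlet, plus for Neumann. -/
def BoundaryCondition.sign : BoundaryCondition → ℝ
  | dirichlet => -1
  | neumann => 1

/-- The real space `L²(Ω)`. -/
abbrev L2 {n : ℕ} (Ω : Opens (EuclideanSpace ℝ (Fin n))) : Type :=
  Lp ℝ 2 (volume.restrict (Ω : Set (EuclideanSpace ℝ (Fin n))))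

/-- The space `L²(Ω; ℝⁿ)` of square integrable vector fields. -/
abbrev L2Vec {n : ℕ} (Ω : Opens (EuclideanSpace ℝ (Fin n))) : Type :=
  Lp (EuclideanSpace ℝ (Fin n)) 2 (volume.restrict (Ω : Set (EuclideanSpace ℝ (Fin n))))

/-- `g` is the weak gradient of `u` on `Ω`: for all test functions `φ ∈ C_c^∞(Ω)` and all
directions `v`, `∫_Ω u ∂_v φ = - ∫_Ω ⟨g, v⟩ φ`. -/
def IsWeakGradient {n : ℕ} (Ω : Opens (EuclideanSpace ℝ (Fin n))) (u : L2 Ω) (g : L2Vec Ω) :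
    Prop :=
  ∀ (φ : 𝓓(Ω, ℝ)) (v : EuclideanSpace ℝ (Fin n)),
    ∫ x in (Ω : Set (EuclideanSpace ℝ (Fin n))), u x * fderiv ℝ φ x v =
      -∫ x in (Ω : Set (EuclideanSpace ℝ (Fin n))), inner ℝ (g x) v * φ x

theorem integrable_mul_fderiv {n : ℕ} {Ω : Opens (EuclideanSpace ℝ (Fin n))} (u : L2 Ω)
    (φ : 𝓓(Ω, ℝ)) (v : EuclideanSpace ℝ (Fin n)) :
    Integrable (fun x => u x * fderiv ℝ φ x v)
      (volume.restrict (Ω : Set (EuclideanSpace ℝ (Fin n)))) := by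
  have hc : Continuous (fun x => fderiv ℝ φ x v) :=
    (φ.contDiff.continuous_fderiv (by simp)).clm_apply continuous_const
  have hs : HasCompactSupport (fun x => fderiv ℝ φ x v) := φ.hasCompactSupport.fderiv_apply ℝ v
  exact MemLp.integrable_mul (p := 2) (q := 2) (Lp.memLp u) (hc.memLp_of_hasCompactSupport hs)

theorem integrable_inner_mul {n : ℕ} {Ω : Opens (EuclideanSpace ℝ (Fin n))} (g : L2Vec Ω)
    (φ : 𝓓(Ω, ℝ)) (v : EuclideanSpace ℝ (Fin n)) :
    Integrable (fun x => inner ℝ (g x) v * φ x)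
      (volume.restrict (Ω : Set (EuclideanSpace ℝ (Fin n)))) :=
  MemLp.integrable_mul (p := 2) (q := 2) ((Lp.memLp g).inner_const v)
    (φ.continuous.memLp_of_hasCompactSupport φ.hasCompactSupport)

/-- The Sobolev space `H¹(Ω)`, each function `u` being recorded together with its (unique)
weak gradient: the space of all pairs `(u, ∇u)` with `u ∈ L²(Ω)` and `∇u ∈ L²(Ω; ℝⁿ)`. -/
def sobolevH1 {n : ℕ} (Ω : Opens (EuclideanSpace ℝ (Fin n))) :
    Submodule ℝ (L2 Ω × L2Vec Ω) where
  carrier := {p | IsWeakGradient Ω p.1 p.2}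
  zero_mem' := by
    intro φ v
    have h1 : ∫ x in (Ω : Set (EuclideanSpace ℝ (Fin n))),
        ((0 : L2 Ω) : EuclideanSpace ℝ (Fin n) → ℝ) x * fderiv ℝ φ x v = 0 := by
      refine integral_eq_zero_of_ae ?_
      filter_upwards [Lp.coeFn_zero ℝ 2 (volume.restrict (Ω : Set (EuclideanSpace ℝ (Fin n))))]
        with x hx
      rw [hx, Pi.zero_apply, zero_mul]
    have h2 : ∫ x in (Ω : Set (EuclideanSpace ℝ (Fin n))),
        inner ℝ (((0 : L2Vec Ω) : EuclideanSpace ℝ (Fin n) → EuclideanSpace ℝ (Fin n)) x) v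
          * φ x = 0 := by
      refine integral_eq_zero_of_ae ?_
      filter_upwards [Lp.coeFn_zero (EuclideanSpace ℝ (Fin n)) 2
        (volume.restrict (Ω : Set (EuclideanSpace ℝ (Fin n))))] with x hx
      rw [hx, Pi.zero_apply, inner_zero_left, zero_mul, Pi.zero_apply]
    simp only [Prod.fst_zero, Prod.snd_zero]
    rw [h1, h2, neg_zero]
  add_mem' := by
    rintro ⟨u, g⟩ ⟨w, h⟩ hu hw φ v
    have h1 : ∫ x in (Ω : Set (EuclideanSpace ℝ (Fin n))), (u + w : L2 Ω) x * fderiv ℝ φ x v =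
        ∫ x in (Ω : Set (EuclideanSpace ℝ (Fin n))),
          (u x * fderiv ℝ φ x v + w x * fderiv ℝ φ x v) := by
      refine integral_congr_ae ?_
      filter_upwards [Lp.coeFn_add u w] with x hx
      rw [hx, Pi.add_apply, add_mul]
    have h2 : ∫ x in (Ω : Set (EuclideanSpace ℝ (Fin n))),
          inner ℝ ((g + h : L2Vec Ω) x) v * φ x =
        ∫ x in (Ω : Set (EuclideanSpace ℝ (Fin n))),
          (inner ℝ (g x) v * φ x + inner ℝ (h x) v * φ x) := by
      refine integral_congr_ae ?_
      filter_upwards [Lp.coeFn_add g h] with x hx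
      rw [hx, Pi.add_apply, inner_add_left, add_mul]
    have h3 := hu φ v
    have h4 := hw φ v
    simp only [Prod.mk_add_mk]
    rw [h1, h2, integral_add (integrable_mul_fderiv u φ v) (integrable_mul_fderiv w φ v),
      integral_add (integrable_inner_mul g φ v) (integrable_inner_mul h φ v), h3, h4]
    ring
  smul_mem' := by
    rintro c ⟨u, g⟩ hu φ v
    have h1 : ∫ x in (Ω : Set (EuclideanSpace ℝ (Fin n))), (c • u : L2 Ω) x * fderiv ℝ φ x v =
        ∫ x in (Ω : Set (EuclideanSpace ℝ (Fin n))), c * (u x * fderiv ℝ φ x v) := by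
      refine integral_congr_ae ?_
      filter_upwards [Lp.coeFn_smul c u] with x hx
      rw [hx, Pi.smul_apply, smul_eq_mul, mul_assoc]
    have h2 : ∫ x in (Ω : Set (EuclideanSpace ℝ (Fin n))),
          inner ℝ ((c • g : L2Vec Ω) x) v * φ x =
        ∫ x in (Ω : Set (EuclideanSpace ℝ (Fin n))), c * (inner ℝ (g x) v * φ x) := by
      refine integral_congr_ae ?_
      filter_upwards [Lp.coeFn_smul c g] with x hx
      rw [hx, Pi.smul_apply, real_inner_smul_left, mul_assoc]
    have h3 := hu φ v
    simp only [Prod.smul_mk]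
    rw [h1, h2, integral_const_mul, integral_const_mul, h3]
    ring

/-- The Sobolev space `H¹₀(Ω)`, each function being recorded together with its weak gradient:
the closure in `L²(Ω) × L²(Ω; ℝⁿ)` of the set of all `(φ, ∇φ)` with `φ ∈ C_c^∞(Ω)`. (That set is
already a linear subspace, so taking its linear span does not change it.) -/
def sobolevH10 {n : ℕ} (Ω : Opens (EuclideanSpace ℝ (Fin n))) :
    Submodule ℝ (L2 Ω × L2Vec Ω) :=
  (Submodule.span ℝ {p : L2 Ω × L2Vec Ω | ∃ φ : 𝓓(Ω, ℝ),
    p.1 =ᵐ[volume.restrict (Ω : Set (EuclideanSpace ℝ (Fin n)))] φ ∧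
    p.2 =ᵐ[volume.restrict (Ω : Set (EuclideanSpace ℝ (Fin n)))] ∇ φ}).topologicalClosure

/-- The form domain of the Laplacian on `Ω`: `H¹₀(Ω)` for the Dirichlet condition and `H¹(Ω)` for
the Neumann condition (functions recorded together with their weak gradients). -/
def formDomain (bc : BoundaryCondition) {n : ℕ} (Ω : Opens (EuclideanSpace ℝ (Fin n))) :
    Submodule ℝ (L2 Ω × L2Vec Ω) :=
  match bc with
  | .dirichlet => sobolevH10 Ω
  | .neumann => sobolevH1 Ω

/-- The eigenspace for the value `Λ` of the (Dirichlet or Neumann) Laplacian `-Δ` on `Ω`: all `u`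
in the form domain with `∫_Ω ⟨∇u, ∇w⟩ = Λ ∫_Ω u w` for all `w` in the form domain. -/
def eigenspace (bc : BoundaryCondition) {n : ℕ} (Ω : Opens (EuclideanSpace ℝ (Fin n))) (Λ : ℝ) :
    Submodule ℝ (L2 Ω) where
  carrier := {u | ∃ g : L2Vec Ω, (u, g) ∈ formDomain bc Ω ∧
    ∀ p ∈ formDomain bc Ω, inner ℝ g p.2 = Λ * inner ℝ u p.1}
  zero_mem' := ⟨0, (formDomain bc Ω).zero_mem, by simp⟩
  add_mem' := by
    rintro u w ⟨g, hg, hu⟩ ⟨h, hh, hw⟩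
    refine ⟨g + h, (formDomain bc Ω).add_mem hg hh, fun p hp => ?_⟩
    rw [inner_add_left, inner_add_left, hu p hp, hw p hp]
    ring
  smul_mem' := by
    rintro c u ⟨g, hg, hu⟩
    refine ⟨c • g, (formDomain bc Ω).smul_mem c hg, fun p hp => ?_⟩
    rw [real_inner_smul_left, real_inner_smul_left, hu p hp]
    ring

/-- The multiplicity of `Λ` as an eigenvalue of `-Δ` on `Ω`: the dimension of its eigenspace
(`0` if `Λ` is not an eigenvalue, `⊤` if the eigenspace is infinite-dimensional). -/
def multiplicity (bc : BoundaryCondition) {n : ℕ} (Ω : Opens (EuclideanSpace ℝ (Fin n)))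
    (Λ : ℝ) : ℕ∞ :=
  Cardinal.toENat (Module.rank ℝ (eigenspace bc Ω Λ))

/-- The eigenvalue counting function `N_Ω(μ)`: the number of eigenvalues `Λ` of `-Δ` on `Ω` with
`√Λ ≤ μ`, counted with multiplicity. -/
def counting (bc : BoundaryCondition) {n : ℕ} (Ω : Opens (EuclideanSpace ℝ (Fin n)))
    (μ : ℝ) : ℝ≥0∞ :=
  ∑' Λ : {Λ : ℝ // √Λ ≤ μ}, (multiplicity bc Ω Λ : ℝ≥0∞)

/-- The volume `ω_k` of the unit ball of `ℝᵏ`. -/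
def unitBallVolume (k : ℕ) : ℝ :=
  volume.real (Metric.ball (0 : EuclideanSpace ℝ (Fin k)) 1)

/-- The Weyl remainder
`R_Ω(μ) = N_Ω(μ) - (C_n |Ω| μⁿ ∓ C'_n |∂Ω| μⁿ⁻¹)`, with `C_n = ω_n / (2π)ⁿ` and
`C'_n = ω_{n-1} / (4 (2π)ⁿ⁻¹)`; the sign is minus for Dirichlet and plus for Neumann, and `|∂Ω|`
is the `(n-1)`-dimensional Hausdorff measure of the boundary, normalised so that it is the usual
surface area. -/
def weylRemainder (bc : BoundaryCondition) {n : ℕ} (Ω : Opens (EuclideanSpace ℝ (Fin n)))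
    (μ : ℝ) : ℝ :=
  (counting bc Ω μ).toReal -
    (unitBallVolume n / (2 * Real.pi) ^ n *
        volume.real (Ω : Set (EuclideanSpace ℝ (Fin n))) * μ ^ n +
      bc.sign * (unitBallVolume (n - 1) / (4 * (2 * Real.pi) ^ (n - 1)) *
        (μHE[n - 1] : Measure (EuclideanSpace ℝ (Fin n))).real
          (frontier (Ω : Set (EuclideanSpace ℝ (Fin n)))) * μ ^ (n - 1)))

/-- The open ball of radius `R` centred at the origin of `ℝⁿ`. -/
def ball (n : ℕ) (R : ℝ) : Opens (EuclideanSpace ℝ (Fin n)) :=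
  ⟨Metric.ball 0 R, Metric.isOpen_ball⟩

/-- The (open) cylinder over the `n`-dimensional ball of radius `R`, of height `L`: the points of
`ℝⁿ⁺¹` whose first `n` coordinates form a point of the ball and whose last one lies in `(0, L)`. -/
def cylinder (n : ℕ) (R L : ℝ) : Opens (EuclideanSpace ℝ (Fin (n + 1))) :=
  ⟨{x | (WithLp.toLp 2 fun i : Fin n => x i.castSucc) ∈ ball n R ∧
      x (Fin.last n) ∈ Set.Ioo 0 L},
    ((ball n R).isOpen.preimage (by fun_prop)).inter (isOpen_Ioo.preimage (by fun_prop))⟩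

end WeylLaw

end

/-! Put n = d - 1, h = π / L, and let B be the ball. Separation of variables says that the spectrum
of the cylinder consists of the sums λ² + (kh)², with λ² in the spectrum of B and k ≥ 1 (Dirichlet)
or k ≥ 0 (Neumann). Hence N_C(μ) = ∑ N_B(√(μ² - (kh)²)) over kh ≤ μ (`counting_cylinder`). Insert
Weyl's law for B with coefficients A μⁿ ± B' μⁿ⁻¹.

The A-terms form a Riemann sum of (μ² - t²)^(n/2) with step h. Halving the term k = 0 turns it into
a trapezoid sum up to its last node, with error O(μⁿ⁻¹). The half term left over, ± A μⁿ / 2, is the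
contribution of the two bases to the boundary term. For the B'-terms monotonicity alone gives the
error O(μⁿ⁻¹). The remainders of B are O(μ) in number and each is O(μ^(d-3+α+ε)); they are added up
without using any cancellation. As n - 1 = d - 2, the Riemann sum errors are absorbed because α > 0
(`abs_weylRemainder_cylinder_le`).

For the constants to match, ω_{n+1} = 2 ω_n ∫₀¹ (1 - t²)^(n/2) dt is needed (`unitBallVolume_succ`),
and |∂C| = 2|B| + L|∂B| for Hausdorff measure (`euclideanHausdorffMeasure_frontier_cylinder`). The
latter rests on a product formula for sphere × interval, obtained by cutting the sphere into pieces
that are almost isometric to their projections on a hyperplane.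

Separation of variables is carried out on weak formulations. Tensoring with a mode e_k of the
interval and its adjoint, integrating against e_k, both preserve the form domains. They move
eigenspaces between B and C with a shift of the eigenvalue by (kh)². Orthogonality and completeness
of the modes then make each eigenspace of C a finite direct sum of eigenspaces of B
(`multiplicity_cylinder`). No spectral theorem or compact embedding enters: even the finiteness of
N_B is drawn from the assumed remainder bound (`counting_ne_top_of_isBigO`). -/

noncomputable section

namespace WeylLaw

/-! ### Splitting off the last coordinate -/

/-- The splitting `ℝⁿ⁺¹ ≃ ℝⁿ × ℝ` that singles out the last coordinate. -/
def splitLast (n : ℕ) : EuclideanSpace ℝ (Fin (n + 1)) ≃L[ℝ] EuclideanSpace ℝ (Fin n) × ℝ :=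
  LinearEquiv.toContinuousLinearEquiv
    { toFun := fun x => (WithLp.toLp 2 fun i : Fin n => x i.castSucc, x (Fin.last n))
      invFun := fun p => WithLp.toLp 2 (Fin.snoc (α := fun _ => ℝ) (fun i => p.1 i) p.2)
      map_add' := fun x y => rfl
      map_smul' := fun c x => rfl
      left_inv := fun x => by
        ext i
        refine Fin.lastCases ?_ (fun j => ?_) i <;> simp
      right_inv := fun p => by
        ext1
        · ext i; simp
        · simp }

theorem splitLast_apply {n : ℕ} (x : EuclideanSpace ℝ (Fin (n + 1))) :
    splitLast n x = (WithLp.toLp 2 fun i : Fin n => x i.castSucc, x (Fin.last n)) := rfl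

theorem inner_eq_splitLast {n : ℕ} (x y : EuclideanSpace ℝ (Fin (n + 1))) :
    inner ℝ x y = inner ℝ (splitLast n x).1 (splitLast n y).1
      + (splitLast n x).2 * (splitLast n y).2 := by
  simp only [PiLp.inner_apply, splitLast_apply, Fin.sum_univ_castSucc]
  simp [mul_comm]

theorem norm_sq_eq_splitLast {n : ℕ} (x : EuclideanSpace ℝ (Fin (n + 1))) :
    ‖x‖ ^ 2 = ‖(splitLast n x).1‖ ^ 2 + (splitLast n x).2 ^ 2 := by
  rw [← real_inner_self_eq_norm_sq, inner_eq_splitLast, real_inner_self_eq_norm_sq]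
  ring

theorem measurePreserving_splitLast (n : ℕ) : MeasurePreserving (splitLast n) := by
  have h1 := PiLp.volume_preserving_ofLp (Fin (n + 1))
  have h2 := volume_preserving_piFinSuccAbove (fun _ : Fin (n + 1) => ℝ) (Fin.last n)
  have h3 : MeasurePreserving (Prod.swap : ℝ × (Fin n → ℝ) → _) volume volume :=
    Measure.measurePreserving_swap
  have h4 := (PiLp.volume_preserving_toLp (Fin n)).prod (MeasurePreserving.id (volume : Measure ℝ))
  have h5 := h4.comp (h3.comp (h2.comp h1))
  convert h5 using 1
  ext x : 1
  simp [splitLast_apply, MeasurableEquiv.piFinSuccAbove]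
  · rfl
  · rfl

/-- The first `n` coordinates. -/
def initL (n : ℕ) : EuclideanSpace ℝ (Fin (n + 1)) →L[ℝ] EuclideanSpace ℝ (Fin n) :=
  (ContinuousLinearMap.fst ℝ _ _).comp (splitLast n).toContinuousLinearMap

/-- The last coordinate. -/
def lastL (n : ℕ) : EuclideanSpace ℝ (Fin (n + 1)) →L[ℝ] ℝ :=
  (ContinuousLinearMap.snd ℝ _ _).comp (splitLast n).toContinuousLinearMap

/-- The inclusion `x ↦ (x, 0)`. -/
def horizL (n : ℕ) : EuclideanSpace ℝ (Fin n) →L[ℝ] EuclideanSpace ℝ (Fin (n + 1)) :=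
  (splitLast n).symm.toContinuousLinearMap.comp (ContinuousLinearMap.inl ℝ _ _)

/-- The inclusion `t ↦ (0, t)`. -/
def vertL (n : ℕ) : ℝ →L[ℝ] EuclideanSpace ℝ (Fin (n + 1)) :=
  (splitLast n).symm.toContinuousLinearMap.comp (ContinuousLinearMap.inr ℝ _ _)

theorem splitLast_eq {n : ℕ} (z : EuclideanSpace ℝ (Fin (n + 1))) :
    splitLast n z = (initL n z, lastL n z) := rfl

theorem initL_symm {n : ℕ} (p : EuclideanSpace ℝ (Fin n) × ℝ) :
    initL n ((splitLast n).symm p) = p.1 := by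
  simp [initL]

theorem lastL_symm {n : ℕ} (p : EuclideanSpace ℝ (Fin n) × ℝ) :
    lastL n ((splitLast n).symm p) = p.2 := by
  simp [lastL]

theorem inner_horizL {n : ℕ} (x : EuclideanSpace ℝ (Fin n)) (z : EuclideanSpace ℝ (Fin (n + 1))) :
    inner ℝ (horizL n x) z = inner ℝ x (initL n z) := by
  rw [inner_eq_splitLast]
  simp [horizL, splitLast_eq]

theorem inner_vertL {n : ℕ} (t : ℝ) (z : EuclideanSpace ℝ (Fin (n + 1))) :
    inner ℝ (vertL n t) z = t * lastL n z := by
  rw [inner_eq_splitLast]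
  simp [vertL, splitLast_eq]

theorem initL_horizL {n : ℕ} (x : EuclideanSpace ℝ (Fin n)) : initL n (horizL n x) = x :=
  initL_symm (x, 0)

theorem initL_vertL {n : ℕ} (t : ℝ) : initL n (vertL n t) = 0 :=
  initL_symm (0, t)

theorem lastL_horizL {n : ℕ} (x : EuclideanSpace ℝ (Fin n)) : lastL n (horizL n x) = 0 :=
  lastL_symm (x, 0)

theorem lastL_vertL {n : ℕ} (t : ℝ) : lastL n (vertL n t) = t :=
  lastL_symm (0, t)

theorem horizL_initL_add_vertL {n : ℕ} (z : EuclideanSpace ℝ (Fin (n + 1))) :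
    horizL n (initL n z) + vertL n (lastL n z) = z := by
  apply (splitLast n).injective
  simp [horizL, vertL, splitLast_eq z]

theorem mem_cylinder {n : ℕ} {R L : ℝ} {z : EuclideanSpace ℝ (Fin (n + 1))} :
    z ∈ cylinder n R L ↔ initL n z ∈ ball n R ∧ lastL n z ∈ Set.Ioo 0 L := Iff.rfl

theorem coe_cylinder (n : ℕ) (R L : ℝ) :
    (cylinder n R L : Set (EuclideanSpace ℝ (Fin (n + 1)))) =
      splitLast n ⁻¹' ((ball n R : Set (EuclideanSpace ℝ (Fin n))) ×ˢ Set.Ioo 0 L) := rfl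

/-! ### The cylinder as a product measure space -/

/-- The open interval `(0, L)`. -/
def segment (L : ℝ) : Opens ℝ := ⟨Set.Ioo 0 L, isOpen_Ioo⟩

/-- Lebesgue measure on the ball. -/
abbrev ballMeasure (n : ℕ) (R : ℝ) : Measure (EuclideanSpace ℝ (Fin n)) :=
  volume.restrict (ball n R : Set (EuclideanSpace ℝ (Fin n)))

/-- Lebesgue measure on the interval `(0, L)`. -/
abbrev segmentMeasure (L : ℝ) : Measure ℝ := volume.restrict (segment L : Set ℝ)

/-- Lebesgue measure on the cylinder. -/
abbrev cylinderMeasure (n : ℕ) (R L : ℝ) : Measure (EuclideanSpace ℝ (Fin (n + 1))) :=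
  volume.restrict (cylinder n R L : Set (EuclideanSpace ℝ (Fin (n + 1))))

instance (n : ℕ) (R : ℝ) : IsFiniteMeasure (ballMeasure n R) :=
  ⟨by simpa [ball] using Metric.isBounded_ball.measure_lt_top⟩

instance (L : ℝ) : IsFiniteMeasure (segmentMeasure L) :=
  ⟨by simp [segment]⟩

theorem measurePreserving_cylinder (n : ℕ) (R L : ℝ) :
    MeasurePreserving (splitLast n) (cylinderMeasure n R L)
      ((ballMeasure n R).prod (segmentMeasure L)) := by
  rw [Measure.prod_restrict]
  exact (measurePreserving_splitLast n).restrict_preimage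
    ((ball n R).isOpen.measurableSet.prod measurableSet_Ioo)

theorem measurableEmbedding_splitLast (n : ℕ) : MeasurableEmbedding (splitLast n) :=
  (splitLast n).toHomeomorph.measurableEmbedding

instance (n : ℕ) (R L : ℝ) : IsFiniteMeasure (cylinderMeasure n R L) :=
  ⟨by
    have h := (measurePreserving_cylinder n R L).measure_preimage
      MeasurableSet.univ.nullMeasurableSet
    rw [Set.preimage_univ] at h
    rw [h]
    exact measure_lt_top _ _⟩

theorem volume_cylinder (n : ℕ) (R : ℝ) {L : ℝ} (hL : 0 ≤ L) :
    volume.real (cylinder n R L : Set (EuclideanSpace ℝ (Fin (n + 1)))) =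
      volume.real (ball n R : Set (EuclideanSpace ℝ (Fin n))) * L := by
  rw [coe_cylinder, (measurePreserving_splitLast n).measureReal_preimage
    ((ball n R).isOpen.measurableSet.prod measurableSet_Ioo).nullMeasurableSet]
  rw [Measure.volume_eq_prod, measureReal_prod_prod]
  simp [hL]

theorem integral_cylinder {n : ℕ} {R L : ℝ} (f : EuclideanSpace ℝ (Fin (n + 1)) → ℝ)
    (hf : Integrable f (cylinderMeasure n R L)) :
    ∫ z, f z ∂(cylinderMeasure n R L) =
      ∫ x, ∫ t, f ((splitLast n).symm (x, t)) ∂(segmentMeasure L) ∂(ballMeasure n R) := by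
  have h := (measurePreserving_cylinder n R L).integral_comp (measurableEmbedding_splitLast n)
    (fun p => f ((splitLast n).symm p))
  have hi := (measurePreserving_cylinder n R L).integrable_comp_emb
    (measurableEmbedding_splitLast n) (g := fun p => f ((splitLast n).symm p))
  simp only [ContinuousLinearEquiv.symm_apply_apply, Function.comp_def] at h hi
  rw [h, integral_prod _ (hi.1 hf)]

theorem integral_cylinder_swap {n : ℕ} {R L : ℝ} (f : EuclideanSpace ℝ (Fin (n + 1)) → ℝ)
    (hf : Integrable f (cylinderMeasure n R L)) :
    ∫ z, f z ∂(cylinderMeasure n R L) =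
      ∫ t, ∫ x, f ((splitLast n).symm (x, t)) ∂(ballMeasure n R) ∂(segmentMeasure L) := by
  have h := (measurePreserving_cylinder n R L).integral_comp (measurableEmbedding_splitLast n)
    (fun p => f ((splitLast n).symm p))
  have hi := (measurePreserving_cylinder n R L).integrable_comp_emb
    (measurableEmbedding_splitLast n) (g := fun p => f ((splitLast n).symm p))
  simp only [ContinuousLinearEquiv.symm_apply_apply, Function.comp_def] at h hi
  rw [h, integral_prod_symm _ (hi.1 hf)]

/-! ### Elementary tensors in L² -/

section Tensor

variable {n : ℕ} {R L : ℝ} {F : Type*} [NormedAddCommGroup F]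

theorem quasiMeasurePreserving_initL (n : ℕ) (R L : ℝ) :
    Measure.QuasiMeasurePreserving (initL n) (cylinderMeasure n R L) (ballMeasure n R) :=
  Measure.quasiMeasurePreserving_fst.comp (measurePreserving_cylinder n R L).quasiMeasurePreserving

theorem quasiMeasurePreserving_lastL (n : ℕ) (R L : ℝ) :
    Measure.QuasiMeasurePreserving (lastL n) (cylinderMeasure n R L) (segmentMeasure L) :=
  Measure.quasiMeasurePreserving_snd.comp (measurePreserving_cylinder n R L).quasiMeasurePreserving

variable [NormedSpace ℝ F]

theorem aestronglyMeasurable_tensor {e : ℝ → ℝ} {u : EuclideanSpace ℝ (Fin n) → F}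
    (he : AEStronglyMeasurable e (segmentMeasure L))
    (hu : AEStronglyMeasurable u (ballMeasure n R)) :
    AEStronglyMeasurable (fun z => e (lastL n z) • u (initL n z)) (cylinderMeasure n R L) :=
  (he.comp_quasiMeasurePreserving (quasiMeasurePreserving_lastL n R L)).smul
    (hu.comp_quasiMeasurePreserving (quasiMeasurePreserving_initL n R L))

theorem eLpNorm_tensor {e : ℝ → ℝ} {u : EuclideanSpace ℝ (Fin n) → F}
    (he : AEStronglyMeasurable e (segmentMeasure L))
    (hu : AEStronglyMeasurable u (ballMeasure n R)) :
    eLpNorm (fun z => e (lastL n z) • u (initL n z)) 2 (cylinderMeasure n R L) =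
      eLpNorm e 2 (segmentMeasure L) * eLpNorm u 2 (ballMeasure n R) := by
  simp only [eLpNorm_eq_lintegral_rpow_enorm_toReal two_ne_zero ENNReal.ofNat_ne_top, enorm_smul]
  rw [← ENNReal.mul_rpow_of_nonneg _ _ (by positivity)]
  congr 1
  have h := (measurePreserving_cylinder n R L).lintegral_comp_emb
    (measurableEmbedding_splitLast n)
    (fun p => ‖u p.1‖ₑ ^ (ENNReal.toReal 2) * ‖e p.2‖ₑ ^ (ENNReal.toReal 2))
  rw [lintegral_prod_mul (hu.enorm.pow_const _) (he.enorm.pow_const _), mul_comm] at h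
  rw [← h]
  refine lintegral_congr fun z => ?_
  rw [ENNReal.mul_rpow_of_nonneg _ _ (by positivity), mul_comm]
  rfl

theorem memLp_tensor {e : ℝ → ℝ} {u : EuclideanSpace ℝ (Fin n) → F}
    (he : MemLp e 2 (segmentMeasure L)) (hu : MemLp u 2 (ballMeasure n R)) :
    MemLp (fun z => e (lastL n z) • u (initL n z)) 2 (cylinderMeasure n R L) :=
  ⟨aestronglyMeasurable_tensor he.1 hu.1, by
    rw [eLpNorm_tensor he.1 hu.1]
    exact ENNReal.mul_lt_top he.2 hu.2⟩

theorem tensor_congr {e e' : ℝ → ℝ} {u u' : EuclideanSpace ℝ (Fin n) → F}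
    (he : e =ᵐ[segmentMeasure L] e') (hu : u =ᵐ[ballMeasure n R] u') :
    (fun z => e (lastL n z) • u (initL n z)) =ᵐ[cylinderMeasure n R L]
      fun z => e' (lastL n z) • u' (initL n z) := by
  filter_upwards [(quasiMeasurePreserving_lastL n R L).ae_eq_comp he,
    (quasiMeasurePreserving_initL n R L).ae_eq_comp hu] with z h1 h2
  simp only [Function.comp_apply] at h1 h2
  rw [h1, h2]

variable (n R L F) in
/-- The bilinear map `(e, u) ↦ ((x, t) ↦ e(t) u(x))` on square integrable functions. -/
def tensorL : Lp ℝ 2 (segmentMeasure L) →L[ℝ] Lp F 2 (ballMeasure n R) →L[ℝ]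
    Lp F 2 (cylinderMeasure n R L) :=
  LinearMap.mkContinuous₂
    (LinearMap.mk₂ ℝ (fun e u => (memLp_tensor (Lp.memLp e) (Lp.memLp u)).toLp _)
      (fun e e' u => by
        rw [← MemLp.toLp_add, MemLp.toLp_eq_toLp_iff]
        refine (tensor_congr (Lp.coeFn_add e e') .rfl).trans (.of_forall fun z => ?_)
        simp [add_smul])
      (fun c e u => by
        rw [← MemLp.toLp_const_smul, MemLp.toLp_eq_toLp_iff]
        refine (tensor_congr (Lp.coeFn_smul c e) .rfl).trans (.of_forall fun z => ?_)
        simp [mul_smul])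
      (fun e u u' => by
        rw [← MemLp.toLp_add, MemLp.toLp_eq_toLp_iff]
        refine (tensor_congr .rfl (Lp.coeFn_add u u')).trans (.of_forall fun z => ?_)
        simp [smul_add])
      (fun c e u => by
        rw [← MemLp.toLp_const_smul, MemLp.toLp_eq_toLp_iff]
        refine (tensor_congr .rfl (Lp.coeFn_smul c u)).trans (.of_forall fun z => ?_)
        simp [smul_comm c])) 1
    (fun e u => by
      simp only [LinearMap.mk₂_apply, Lp.norm_toLp]
      rw [eLpNorm_tensor (Lp.aestronglyMeasurable e) (Lp.aestronglyMeasurable u),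
        ENNReal.toReal_mul, one_mul, Lp.norm_def, Lp.norm_def])

theorem coeFn_tensorL (e : Lp ℝ 2 (segmentMeasure L)) (u : Lp F 2 (ballMeasure n R)) :
    tensorL n R L F e u =ᵐ[cylinderMeasure n R L]
      fun z => e (lastL n z) • u (initL n z) :=
  MemLp.coeFn_toLp (memLp_tensor (Lp.memLp e) (Lp.memLp u))

theorem tensorL_toLp {e : ℝ → ℝ} {u : EuclideanSpace ℝ (Fin n) → F}
    (he : MemLp e 2 (segmentMeasure L)) (hu : MemLp u 2 (ballMeasure n R)) :
    tensorL n R L F (he.toLp e) (hu.toLp u) = (memLp_tensor he hu).toLp _ := by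
  refine Lp.ext ((coeFn_tensorL _ _).trans ?_)
  exact (tensor_congr he.coeFn_toLp hu.coeFn_toLp).trans (MemLp.coeFn_toLp _).symm

end Tensor

/-! ### Partial integrals as adjoints of tensoring -/

section Adjoint

variable {n : ℕ} {R L : ℝ} {F : Type*} [NormedAddCommGroup F] [InnerProductSpace ℝ F]

/-- By Fubini. This carries orthogonality of functions on the interval over to the cylinder. -/
theorem inner_tensorL (e e' : Lp ℝ 2 (segmentMeasure L)) (u u' : Lp F 2 (ballMeasure n R)) :
    inner ℝ (tensorL n R L F e u) (tensorL n R L F e' u') = inner ℝ e e' * inner ℝ u u' := by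
  have hae : (fun z => inner ℝ (tensorL n R L F e u z) (tensorL n R L F e' u' z))
      =ᵐ[cylinderMeasure n R L] fun z => inner ℝ (e (lastL n z) • u (initL n z))
        (e' (lastL n z) • u' (initL n z)) := by
    filter_upwards [coeFn_tensorL e u, coeFn_tensorL e' u'] with z h1 h2
    rw [h1, h2]
  have hi := (L2.integrable_inner (𝕜 := ℝ) (tensorL n R L F e u) (tensorL n R L F e' u')).congr hae
  rw [L2.inner_def]
  have h := integral_congr_ae hae
  rw [h, integral_cylinder _ hi, L2.inner_def, L2.inner_def, mul_comm, ← integral_mul_const]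
  refine integral_congr_ae (.of_forall fun x => ?_)
  simp only [lastL_symm, initL_symm, real_inner_smul_left, real_inner_smul_right]
  rw [← integral_const_mul]
  refine integral_congr_ae (.of_forall fun t => ?_)
  simp
  ring

variable [CompleteSpace F]

/-- The partial integral `v ↦ (x ↦ ∫ e(t) v(x, t) dt)`, as the adjoint of `u ↦ e ⊗ u`. -/
def sliceL (e : Lp ℝ 2 (segmentMeasure L)) :
    Lp F 2 (cylinderMeasure n R L) →L[ℝ] Lp F 2 (ballMeasure n R) :=
  ContinuousLinearMap.adjoint (tensorL n R L F e)

theorem inner_sliceL_left (e : Lp ℝ 2 (segmentMeasure L)) (v : Lp F 2 (cylinderMeasure n R L))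
    (u : Lp F 2 (ballMeasure n R)) :
    inner ℝ (sliceL e v) u = inner ℝ v (tensorL n R L F e u) :=
  ContinuousLinearMap.adjoint_inner_left _ _ _

theorem inner_sliceL_right (e : Lp ℝ 2 (segmentMeasure L)) (v : Lp F 2 (cylinderMeasure n R L))
    (u : Lp F 2 (ballMeasure n R)) :
    inner ℝ u (sliceL e v) = inner ℝ (tensorL n R L F e u) v :=
  ContinuousLinearMap.adjoint_inner_right _ _ _

theorem sliceL_tensorL (e e' : Lp ℝ 2 (segmentMeasure L)) (u : Lp F 2 (ballMeasure n R)) :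
    sliceL e (tensorL n R L F e' u) = (inner ℝ e' e : ℝ) • u := by
  refine ext_inner_right ℝ fun w => ?_
  rw [inner_sliceL_left, inner_tensorL, real_inner_smul_left]

end Adjoint

/-! ### Horizontal and vertical components of vector fields -/

section Components

variable {n : ℕ} {R L : ℝ}

/-- The inclusion of the horizontal directions is the pointwise adjoint of the projection, as the
splitting is orthogonal. -/
theorem inner_compLp_horizL (g : L2Vec (ball n R))
    (e : Lp ℝ 2 (segmentMeasure L)) (G : L2Vec (cylinder n R L)) :
    inner ℝ ((horizL n).compLp (tensorL n R L _ e g)) G =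
      inner ℝ (tensorL n R L _ e g) ((initL n).compLp G) := by
  rw [L2.inner_def, L2.inner_def]
  refine integral_congr_ae ?_
  filter_upwards [(horizL n).coeFn_compLp (tensorL n R L _ e g), (initL n).coeFn_compLp G]
    with z h1 h2
  rw [h1, h2, inner_horizL]

theorem inner_compLp_vertL (u : L2 (cylinder n R L)) (G : L2Vec (cylinder n R L)) :
    inner ℝ ((vertL n).compLp u) G = inner ℝ u ((lastL n).compLp G) := by
  rw [L2.inner_def, L2.inner_def]
  refine integral_congr_ae ?_
  filter_upwards [(vertL n).coeFn_compLp u, (lastL n).coeFn_compLp G]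
    with z h1 h2
  rw [h1, h2, inner_vertL]
  simp [mul_comm]

end Components

/-! ### A duality criterion for closed spans -/

/-- A point lies in the closed span of a set as soon as it is annihilated by every continuous
linear functional that annihilates the set. -/
theorem mem_span_closure_of_forall_inner {H₁ H₂ : Type*} [NormedAddCommGroup H₁]
    [InnerProductSpace ℝ H₁] [CompleteSpace H₁] [NormedAddCommGroup H₂] [InnerProductSpace ℝ H₂]
    [CompleteSpace H₂] (S : Set (H₁ × H₂)) (p : H₁ × H₂)
    (h : ∀ (f : H₁) (F : H₂), (∀ q ∈ S, inner ℝ f q.1 + inner ℝ F q.2 = (0 : ℝ)) →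
      inner ℝ f p.1 + inner ℝ F p.2 = (0 : ℝ)) :
    p ∈ (Submodule.span ℝ S).topologicalClosure := by
  by_contra hp
  set V := (Submodule.span ℝ S).topologicalClosure
  obtain ⟨l, u, hl, hu⟩ := geometric_hahn_banach_closed_point (s := (V : Set (H₁ × H₂)))
    V.convex (Submodule.isClosed_topologicalClosure _) hp
  -- A functional bounded above on a subspace vanishes there: otherwise a multiple of `a` attains
  -- the bound `u`.
  have hV : ∀ a ∈ V, l a = 0 := by
    intro a ha
    by_contra hne
    have := hl _ (V.smul_mem (u / l a) ha)
    rw [map_smul, smul_eq_mul, div_mul_cancel₀ _ hne] at this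
    exact lt_irrefl _ this
  have hu0 : 0 < u := by simpa using hl 0 V.zero_mem
  -- The product carries the sup norm and is not a Hilbert space, so Riesz is applied on each factor
  -- separately.
  have hdec : ∀ q : H₁ × H₂,
      inner ℝ ((InnerProductSpace.toDual ℝ H₁).symm (l.comp (.inl ℝ H₁ H₂))) q.1 +
      inner ℝ ((InnerProductSpace.toDual ℝ H₂).symm (l.comp (.inr ℝ H₁ H₂))) q.2 = l q := by
    intro q
    rw [InnerProductSpace.toDual_symm_apply, InnerProductSpace.toDual_symm_apply]
    simp [← map_add]
  have hlp := h _ _ fun q hq => (hdec q).trans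
    (hV q ((Submodule.le_topologicalClosure _) (Submodule.subset_span hq)))
  rw [hdec] at hlp
  linarith

/-! ### Test functions as L² vectors; Sobolev spaces in terms of inner products -/

section TestFunctions

variable {n : ℕ} {Ω : Opens (EuclideanSpace ℝ (Fin n))}

theorem memLp_testFunction {E : Type*} [NormedAddCommGroup E] [NormedSpace ℝ E]
    [MeasurableSpace E] [BorelSpace E] {Ω : Opens E} (φ : 𝓓(Ω, ℝ)) (μ : Measure E)
    [IsFiniteMeasureOnCompacts μ] : MemLp φ 2 μ :=
  φ.continuous.memLp_of_hasCompactSupport φ.hasCompactSupport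

theorem memLp_fderiv_testFunction {E : Type*} [NormedAddCommGroup E] [NormedSpace ℝ E]
    [MeasurableSpace E] [BorelSpace E] {Ω : Opens E} (φ : 𝓓(Ω, ℝ)) (v : E) (μ : Measure E)
    [IsFiniteMeasureOnCompacts μ] : MemLp (fun x => fderiv ℝ φ x v) 2 μ :=
  ((φ.contDiff.continuous_fderiv (by simp)).clm_apply continuous_const).memLp_of_hasCompactSupport
    (φ.hasCompactSupport.fderiv_apply ℝ v)

theorem memLp_gradient_testFunction (φ : 𝓓(Ω, ℝ)) :
    MemLp (∇ φ) 2 (volume.restrict (Ω : Set (EuclideanSpace ℝ (Fin n)))) := by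
  have hc : Continuous (∇ φ) :=
    (InnerProductSpace.toDual ℝ _).symm.continuous.comp (φ.contDiff.continuous_fderiv (by simp))
  refine hc.memLp_of_hasCompactSupport ((φ.hasCompactSupport.fderiv ℝ).mono fun x hx => ?_)
  contrapose! hx
  simp only [Function.mem_support, not_not] at hx ⊢
  simp [gradient, hx]

theorem memLp_testFunction_smul (φ : 𝓓(Ω, ℝ)) (v : EuclideanSpace ℝ (Fin n)) :
    MemLp (fun x => φ x • v) 2 (volume.restrict (Ω : Set (EuclideanSpace ℝ (Fin n)))) :=
  (φ.continuous.smul continuous_const).memLp_of_hasCompactSupport φ.hasCompactSupport.smul_right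

/-- A test function as an element of `L²`. -/
def testFn (φ : 𝓓(Ω, ℝ)) : L2 Ω := (memLp_testFunction φ _).toLp φ

/-- A directional derivative of a test function as an element of `L²`. -/
def testDeriv (φ : 𝓓(Ω, ℝ)) (v : EuclideanSpace ℝ (Fin n)) : L2 Ω :=
  (memLp_fderiv_testFunction φ v _).toLp _

/-- The gradient of a test function as an element of `L²`. -/
def testGrad (φ : 𝓓(Ω, ℝ)) : L2Vec Ω := (memLp_gradient_testFunction φ).toLp _

/-- A test function times a constant vector as an element of `L²`. -/
def testSMul (φ : 𝓓(Ω, ℝ)) (v : EuclideanSpace ℝ (Fin n)) : L2Vec Ω :=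
  (memLp_testFunction_smul φ v).toLp _

theorem inner_testFn (u : L2 Ω) (φ : 𝓓(Ω, ℝ)) :
    inner ℝ u (testFn φ) = ∫ x in (Ω : Set (EuclideanSpace ℝ (Fin n))), u x * φ x := by
  rw [L2.inner_def]
  refine integral_congr_ae ?_
  filter_upwards [(memLp_testFunction φ _).coeFn_toLp] with x hx
  rw [testFn, hx]
  simp [mul_comm]

theorem inner_testDeriv (u : L2 Ω) (φ : 𝓓(Ω, ℝ)) (v : EuclideanSpace ℝ (Fin n)) :
    inner ℝ u (testDeriv φ v) =
      ∫ x in (Ω : Set (EuclideanSpace ℝ (Fin n))), u x * fderiv ℝ φ x v := by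
  rw [L2.inner_def]
  refine integral_congr_ae ?_
  filter_upwards [(memLp_fderiv_testFunction φ v _).coeFn_toLp] with x hx
  rw [testDeriv, hx]
  simp [mul_comm]

theorem inner_testGrad (g : L2Vec Ω) (φ : 𝓓(Ω, ℝ)) :
    inner ℝ g (testGrad φ) =
      ∫ x in (Ω : Set (EuclideanSpace ℝ (Fin n))), fderiv ℝ φ x (g x) := by
  rw [L2.inner_def]
  refine integral_congr_ae ?_
  filter_upwards [(memLp_gradient_testFunction φ).coeFn_toLp] with x hx
  rw [testGrad, hx, inner_gradient_right]
  simp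

theorem inner_testSMul (g : L2Vec Ω) (φ : 𝓓(Ω, ℝ)) (v : EuclideanSpace ℝ (Fin n)) :
    inner ℝ g (testSMul φ v) =
      ∫ x in (Ω : Set (EuclideanSpace ℝ (Fin n))), inner ℝ (g x) v * φ x := by
  rw [L2.inner_def]
  refine integral_congr_ae ?_
  filter_upwards [(memLp_testFunction_smul φ v).coeFn_toLp] with x hx
  rw [testSMul, hx, real_inner_smul_right, mul_comm]

theorem isWeakGradient_iff {u : L2 Ω} {g : L2Vec Ω} :
    IsWeakGradient Ω u g ↔ ∀ (φ : 𝓓(Ω, ℝ)) (v : EuclideanSpace ℝ (Fin n)),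
      (inner ℝ u (testDeriv φ v) : ℝ) = -inner ℝ g (testSMul φ v) := by
  simp only [inner_testDeriv, inner_testSMul, IsWeakGradient]

theorem ae_iff_eq_test {φ : 𝓓(Ω, ℝ)} {p : L2 Ω × L2Vec Ω} :
    (p.1 =ᵐ[volume.restrict (Ω : Set (EuclideanSpace ℝ (Fin n)))] φ ∧
      p.2 =ᵐ[volume.restrict (Ω : Set (EuclideanSpace ℝ (Fin n)))] ∇ φ) ↔
      p = (testFn φ, testGrad φ) := by
  rw [Prod.ext_iff]
  refine and_congr ⟨fun h => ?_, fun h => ?_⟩ ⟨fun h => ?_, fun h => ?_⟩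
  · exact Lp.ext (h.trans (memLp_testFunction φ _).coeFn_toLp.symm)
  · rw [h]; exact (memLp_testFunction φ _).coeFn_toLp
  · exact Lp.ext (h.trans (memLp_gradient_testFunction φ).coeFn_toLp.symm)
  · rw [h]; exact (memLp_gradient_testFunction φ).coeFn_toLp

theorem sobolevH10_eq (Ω : Opens (EuclideanSpace ℝ (Fin n))) : sobolevH10 Ω =
    (Submodule.span ℝ (Set.range fun φ : 𝓓(Ω, ℝ) => (testFn φ, testGrad φ))).topologicalClosure :=
    by
  rw [sobolevH10]
  congr 2
  ext p
  simp only [Set.mem_ofPred_eq, Set.mem_range, ae_iff_eq_test, eq_comm]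

theorem test_mem_sobolevH10 (φ : 𝓓(Ω, ℝ)) : (testFn φ, testGrad φ) ∈ sobolevH10 Ω := by
  rw [sobolevH10_eq]
  exact Submodule.le_topologicalClosure _ (Submodule.subset_span ⟨φ, rfl⟩)

theorem sobolevH10_le {N : Submodule ℝ (L2 Ω × L2Vec Ω)}
    (hN : IsClosed (N : Set (L2 Ω × L2Vec Ω)))
    (h : ∀ φ : 𝓓(Ω, ℝ), (testFn φ, testGrad φ) ∈ N) : sobolevH10 Ω ≤ N := by
  rw [sobolevH10_eq]
  refine Submodule.topologicalClosure_minimal _ (Submodule.span_le.2 ?_) hN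
  rintro _ ⟨φ, rfl⟩
  exact h φ

/-- The dual description of the closure. It replaces the construction of approximating test
functions. -/
theorem mem_sobolevH10_of_forall_inner (p : L2 Ω × L2Vec Ω)
    (h : ∀ (f : L2 Ω) (F : L2Vec Ω),
      (∀ φ : 𝓓(Ω, ℝ), inner ℝ f (testFn φ) + inner ℝ F (testGrad φ) = (0 : ℝ)) →
      inner ℝ f p.1 + inner ℝ F p.2 = (0 : ℝ)) : p ∈ sobolevH10 Ω := by
  rw [sobolevH10_eq]
  exact mem_span_closure_of_forall_inner _ p fun f F hfF => h f F fun φ => hfF _ ⟨φ, rfl⟩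

theorem isClosed_sobolevH10 (Ω : Opens (EuclideanSpace ℝ (Fin n))) :
    IsClosed (sobolevH10 Ω : Set (L2 Ω × L2Vec Ω)) :=
  Submodule.isClosed_topologicalClosure _

/-- The fundamental lemma of the calculus of variations. -/
theorem eq_zero_of_forall_integral_test {E : Type*} [NormedAddCommGroup E] [NormedSpace ℝ E]
    [FiniteDimensional ℝ E] [MeasurableSpace E] [BorelSpace E] {μ : Measure E} {Ω : Opens E}
    {f : E → ℝ} (hf : LocallyIntegrableOn f Ω μ)
    (h : ∀ φ : 𝓓(Ω, ℝ), ∫ x in (Ω : Set E), f x * φ x ∂μ = 0) :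
    f =ᵐ[μ.restrict (Ω : Set E)] 0 := by
  rw [Filter.EventuallyEq, ae_restrict_iff' Ω.isOpen.measurableSet]
  refine Ω.isOpen.ae_eq_zero_of_integral_contDiff_smul_eq_zero hf fun g hg hgc hgs => ?_
  have := h ⟨g, hg, hgc, hgs⟩
  rw [← this, ← setIntegral_eq_integral_of_forall_compl_eq_zero (s := (Ω : Set E))]
  · simp [mul_comm]
  · intro x hx
    rw [image_eq_zero_of_notMem_tsupport fun h => hx (hgs h), zero_smul]

theorem eq_zero_of_forall_inner_testFn {u : L2 Ω}
    (h : ∀ φ : 𝓓(Ω, ℝ), inner ℝ u (testFn φ) = (0 : ℝ)) :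
    u = 0 := by
  refine Lp.ext (.trans ?_ (Lp.coeFn_zero _ _ _).symm)
  refine eq_zero_of_forall_integral_test (μ := volume) ?_ fun φ => by rw [← inner_testFn, h φ]
  exact (locallyIntegrableOn_of_locallyIntegrable_restrict
    ((Lp.memLp u).locallyIntegrable (by norm_num)))

end TestFunctions

/-! ### Functions on the interval -/

section Segment

variable {L : ℝ}

theorem memLp_segment {a : ℝ → ℝ} (ha : Continuous a) : MemLp a 2 (segmentMeasure L) := by
  obtain ⟨C, hC⟩ := (isCompact_Icc (a := 0) (b := L)).exists_bound_of_continuousOn ha.continuousOn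
  refine MemLp.of_bound ha.aestronglyMeasurable C ?_
  filter_upwards [ae_restrict_mem (segment L).isOpen.measurableSet] with t ht
  exact hC t (Set.Ioo_subset_Icc_self ht)

/-- A continuous function on the line as an element of `L²(0, L)`. -/
def seg (L : ℝ) (a : ℝ → ℝ) (ha : Continuous a) : Lp ℝ 2 (segmentMeasure L) :=
  (memLp_segment ha).toLp a

theorem coeFn_seg (a : ℝ → ℝ) (ha : Continuous a) : seg L a ha =ᵐ[segmentMeasure L] a :=
  (memLp_segment ha).coeFn_toLp

theorem inner_seg (f : Lp ℝ 2 (segmentMeasure L)) (a : ℝ → ℝ) (ha : Continuous a) :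
    inner ℝ f (seg L a ha) = ∫ t, f t * a t ∂(segmentMeasure L) := by
  rw [L2.inner_def]
  refine integral_congr_ae ?_
  filter_upwards [coeFn_seg (L := L) a ha] with x hx
  rw [hx]
  simp [mul_comm]

theorem inner_seg_seg (a b : ℝ → ℝ) (ha : Continuous a) (hb : Continuous b) :
    inner ℝ (seg L a ha) (seg L b hb) = ∫ t, a t * b t ∂(segmentMeasure L) := by
  rw [inner_seg]
  refine integral_congr_ae ?_
  filter_upwards [coeFn_seg (L := L) a ha] with x hx
  rw [hx]

theorem seg_const_mul (c : ℝ) (a : ℝ → ℝ) (ha : Continuous a)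
    (hc : Continuous fun t => c * a t) : seg L (fun t => c * a t) hc = c • seg L a ha := by
  rw [seg, seg, ← MemLp.toLp_const_smul]
  rfl

theorem continuous_deriv_test (ψ : 𝓓(segment L, ℝ)) : Continuous (deriv ψ) :=
  ψ.contDiff.continuous_deriv (by simp)

/-- Integration by parts; the support of `ψ` is compact inside the interval, so `a` is unrestricted
at the endpoints. -/
theorem integral_mul_deriv_test {a a' : ℝ → ℝ} (ha : ∀ t, HasDerivAt a (a' t) t)
    (ha' : Continuous a') (ψ : 𝓓(segment L, ℝ)) :
    ∫ t, a t * deriv ψ t ∂(segmentMeasure L) = -∫ t, a' t * ψ t ∂(segmentMeasure L) := by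
  have hac : Continuous a := continuous_iff_continuousAt.2 fun t => (ha t).continuousAt
  have hsub : tsupport (deriv ψ) ⊆ segment L :=
    (tsupport_deriv_subset (𝕜 := ℝ) (f := ψ)).trans ψ.tsupport_subset
  rw [setIntegral_eq_integral_of_forall_compl_eq_zero,
    setIntegral_eq_integral_of_forall_compl_eq_zero]
  · refine integral_mul_deriv_eq_deriv_mul_of_integrable (u := a) (v := ψ) (fun t _ => ha t)
      (fun t _ => (ψ.contDiff.differentiable (by simp) t).hasDerivAt) ?_ ?_ ?_
    · exact (hac.mul (continuous_deriv_test ψ)).integrable_of_hasCompactSupport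
        ψ.hasCompactSupport.deriv.mul_left
    · exact (ha'.mul ψ.continuous).integrable_of_hasCompactSupport ψ.hasCompactSupport.mul_left
    · exact (hac.mul ψ.continuous).integrable_of_hasCompactSupport ψ.hasCompactSupport.mul_left
  · intro t ht
    rw [image_eq_zero_of_notMem_tsupport fun h => ht (ψ.tsupport_subset h), mul_zero]
  · intro t ht
    rw [image_eq_zero_of_notMem_tsupport fun h => ht (hsub h), mul_zero]

theorem eq_zero_of_forall_inner_seg {f : Lp ℝ 2 (segmentMeasure L)}
    (h : ∀ ψ : 𝓓(segment L, ℝ), inner ℝ f (seg L ψ ψ.continuous) = (0 : ℝ)) : f = 0 := by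
  refine Lp.ext (.trans ?_ (Lp.coeFn_zero _ _ _).symm)
  refine eq_zero_of_forall_integral_test (μ := volume) ?_ fun φ => by rw [← h φ, inner_seg]
  exact (locallyIntegrableOn_of_locallyIntegrable_restrict
    ((Lp.memLp f).locallyIntegrable (by norm_num)))

end Segment

/-! ### Products of test functions and lifting of pairs (u, ∇u) -/

section Products

variable {n : ℕ} {R L : ℝ}

/-- The product of two test functions. -/
def tensorTest (φ : 𝓓(ball n R, ℝ)) (ψ : 𝓓(segment L, ℝ)) : 𝓓(cylinder n R L, ℝ) :=
  have hK : IsCompact (splitLast n ⁻¹' (tsupport φ ×ˢ tsupport ψ)) :=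
    (splitLast n).toHomeomorph.isCompact_preimage.2
      (φ.hasCompactSupport.isCompact.prod ψ.hasCompactSupport.isCompact)
  have hs : (Function.support fun z => ψ (lastL n z) * φ (initL n z)) ⊆
      splitLast n ⁻¹' (tsupport φ ×ˢ tsupport ψ) := fun _ hz =>
    ⟨subset_tsupport _ (right_ne_zero_of_mul hz), subset_tsupport _ (left_ne_zero_of_mul hz)⟩
  { toFun := fun z => ψ (lastL n z) * φ (initL n z)
    contDiff' := (ψ.contDiff.comp (lastL n).contDiff).mul (φ.contDiff.comp (initL n).contDiff)
    hasCompactSupport' := .of_support_subset_isCompact hK hs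
    tsupport_subset' := (closure_minimal hs hK.isClosed).trans fun _ hz =>
      ⟨φ.tsupport_subset hz.1, ψ.tsupport_subset hz.2⟩ }

theorem tensorTest_apply (φ : 𝓓(ball n R, ℝ)) (ψ : 𝓓(segment L, ℝ))
    (z : EuclideanSpace ℝ (Fin (n + 1))) :
    tensorTest φ ψ z = ψ (lastL n z) * φ (initL n z) := rfl

theorem fderiv_tensorTest (φ : 𝓓(ball n R, ℝ)) (ψ : 𝓓(segment L, ℝ))
    (z v : EuclideanSpace ℝ (Fin (n + 1))) :
    fderiv ℝ (tensorTest φ ψ) z v = ψ (lastL n z) * fderiv ℝ φ (initL n z) (initL n v) +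
      deriv ψ (lastL n z) * lastL n v * φ (initL n z) := by
  have h1 : HasFDerivAt (fun z => φ (initL n z)) ((fderiv ℝ φ (initL n z)).comp (initL n)) z :=
    ((φ.contDiff.differentiable (by simp) _).hasFDerivAt).comp z (initL n).hasFDerivAt
  have h2 : HasFDerivAt (fun z => ψ (lastL n z)) (deriv ψ (lastL n z) • (lastL n)) z :=
    ((ψ.contDiff.differentiable (by simp) _).hasDerivAt).comp_hasFDerivAt z (lastL n).hasFDerivAt
  have h3 := (h2.mul h1).fderiv
  have h4 : fderiv ℝ (tensorTest φ ψ) z = _ := h3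
  rw [h4]
  simp
  ring

theorem testFn_tensorTest (φ : 𝓓(ball n R, ℝ)) (ψ : 𝓓(segment L, ℝ)) :
    testFn (tensorTest φ ψ) = tensorL n R L ℝ (seg L ψ ψ.continuous) (testFn φ) := by
  rw [testFn, testFn, seg, tensorL_toLp]
  rfl

theorem testDeriv_tensorTest (φ : 𝓓(ball n R, ℝ)) (ψ : 𝓓(segment L, ℝ))
    (v : EuclideanSpace ℝ (Fin (n + 1))) :
    testDeriv (tensorTest φ ψ) v =
      tensorL n R L ℝ (seg L ψ ψ.continuous) (testDeriv φ (initL n v)) +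
      lastL n v • tensorL n R L ℝ (seg L (deriv ψ) (continuous_deriv_test ψ)) (testFn φ) := by
  rw [testDeriv, testDeriv, testFn, seg, seg, tensorL_toLp, tensorL_toLp, ← MemLp.toLp_const_smul,
    ← MemLp.toLp_add, MemLp.toLp_eq_toLp_iff]
  refine .of_forall fun z => ?_
  simp only [fderiv_tensorTest, Pi.add_apply, Pi.smul_apply, smul_eq_mul]
  ring

theorem initL_testSMul_tensorTest (φ : 𝓓(ball n R, ℝ)) (ψ : 𝓓(segment L, ℝ))
    (v : EuclideanSpace ℝ (Fin (n + 1))) :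
    (initL n).compLp (testSMul (tensorTest φ ψ) v) =
      tensorL n R L _ (seg L ψ ψ.continuous) (testSMul φ (initL n v)) := by
  rw [testSMul, testSMul, seg, tensorL_toLp]
  refine Lp.ext (((initL n).coeFn_compLp' _).trans ?_)
  filter_upwards [(memLp_testFunction_smul (tensorTest φ ψ) v).coeFn_toLp,
    (memLp_tensor (n := n) (R := R) (memLp_segment (L := L) ψ.continuous)
      (memLp_testFunction_smul φ (initL n v))).coeFn_toLp] with z h1 h2
  rw [h1, h2, map_smul, tensorTest_apply, mul_smul]

theorem lastL_testSMul (φ : 𝓓(cylinder n R L, ℝ)) (v : EuclideanSpace ℝ (Fin (n + 1))) :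
    (lastL n).compLp (testSMul φ v) = lastL n v • testFn φ := by
  refine Lp.ext (((lastL n).coeFn_compLp' _).trans ?_)
  filter_upwards [(memLp_testFunction_smul φ v).coeFn_toLp, Lp.coeFn_smul (lastL n v) (testFn φ),
    (memLp_testFunction φ (cylinderMeasure n R L)).coeFn_toLp] with z h1 h2 h3
  rw [testSMul, h1, h2, Pi.smul_apply, testFn, h3, map_smul, smul_eq_mul, smul_eq_mul, mul_comm]

theorem initL_gradient (φ : 𝓓(cylinder n R L, ℝ)) (z : EuclideanSpace ℝ (Fin (n + 1)))
    (a : EuclideanSpace ℝ (Fin n)) :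
    inner ℝ a (initL n (∇ φ z)) = fderiv ℝ φ z (horizL n a) := by
  rw [← inner_horizL, inner_gradient_right]
  simp

theorem lastL_gradient (φ : 𝓓(cylinder n R L, ℝ)) (z : EuclideanSpace ℝ (Fin (n + 1))) :
    lastL n (∇ φ z) = fderiv ℝ φ z (vertL n 1) := by
  rw [← one_mul (lastL n (∇ φ z)), ← inner_vertL, inner_gradient_right]
  simp

theorem lastL_testGrad (φ : 𝓓(cylinder n R L, ℝ)) :
    (lastL n).compLp (testGrad φ) = testDeriv φ (vertL n 1) := by
  refine Lp.ext (((lastL n).coeFn_compLp' _).trans ?_)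
  filter_upwards [(memLp_gradient_testFunction φ).coeFn_toLp,
    (memLp_fderiv_testFunction φ (vertL n 1) (cylinderMeasure n R L)).coeFn_toLp] with z h1 h2
  rw [testGrad, h1, testDeriv, h2, lastL_gradient]

variable (n R L) in
/-- The map `((e, e'), (u, g)) ↦ (e ⊗ u, (e ⊗ g, e' ⊗ u))`. -/
def lift (a : Lp ℝ 2 (segmentMeasure L) × Lp ℝ 2 (segmentMeasure L)) :
    (L2 (ball n R) × L2Vec (ball n R)) →L[ℝ] L2 (cylinder n R L) × L2Vec (cylinder n R L) :=
  ((tensorL n R L ℝ a.1).comp (.fst ℝ _ _)).prod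
    (((horizL n).compLpL 2 _).comp ((tensorL n R L _ a.1).comp (.snd ℝ _ _)) +
      ((vertL n).compLpL 2 _).comp ((tensorL n R L _ a.2).comp (.fst ℝ _ _)))

variable (n R L) in
/-- The map `lift` as a linear map in its first argument. -/
def liftFlip (p : L2 (ball n R) × L2Vec (ball n R)) :
    (Lp ℝ 2 (segmentMeasure L) × Lp ℝ 2 (segmentMeasure L)) →L[ℝ]
      L2 (cylinder n R L) × L2Vec (cylinder n R L) :=
  (((tensorL n R L ℝ).flip p.1).comp (.fst ℝ _ _)).prod
    (((horizL n).compLpL 2 _).comp (((tensorL n R L _).flip p.2).comp (.fst ℝ _ _)) +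
      ((vertL n).compLpL 2 _).comp (((tensorL n R L _).flip p.1).comp (.snd ℝ _ _)))

theorem liftFlip_apply (p : L2 (ball n R) × L2Vec (ball n R))
    (a : Lp ℝ 2 (segmentMeasure L) × Lp ℝ 2 (segmentMeasure L)) :
    liftFlip n R L p a = lift n R L a p := rfl

theorem lift_apply (a : Lp ℝ 2 (segmentMeasure L) × Lp ℝ 2 (segmentMeasure L))
    (u : L2 (ball n R)) (g : L2Vec (ball n R)) :
    lift n R L a (u, g) = (tensorL n R L ℝ a.1 u,
      (horizL n).compLp (tensorL n R L _ a.1 g) + (vertL n).compLp (tensorL n R L _ a.2 u)) := rfl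

theorem inner_lift_snd (a : Lp ℝ 2 (segmentMeasure L) × Lp ℝ 2 (segmentMeasure L))
    (p : L2 (ball n R) × L2Vec (ball n R)) (G : L2Vec (cylinder n R L)) :
    inner ℝ (lift n R L a p).2 G =
      (inner ℝ p.2 (sliceL a.1 ((initL n).compLp G)) +
        inner ℝ p.1 (sliceL a.2 ((lastL n).compLp G)) : ℝ) := by
  obtain ⟨u, g⟩ := p
  rw [lift_apply, inner_add_left, inner_compLp_horizL, inner_compLp_vertL, inner_sliceL_right,
    inner_sliceL_right]

/-- The Leibniz rule for ψ(t) φ(x), checked by pairing the gradients with an arbitrary field `G`. -/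
theorem lift_test (φ : 𝓓(ball n R, ℝ)) (ψ : 𝓓(segment L, ℝ)) :
    lift n R L (seg L ψ ψ.continuous, seg L (deriv ψ) (continuous_deriv_test ψ))
      (testFn φ, testGrad φ) = (testFn (tensorTest φ ψ), testGrad (tensorTest φ ψ)) := by
  rw [lift_apply, testFn_tensorTest]
  congr 1
  refine ext_inner_left ℝ fun G => ?_
  rw [inner_testGrad, real_inner_comm, inner_add_left, inner_compLp_horizL, inner_compLp_vertL,
    testGrad, testFn, seg, seg, tensorL_toLp, tensorL_toLp, L2.inner_def, L2.inner_def,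
    ← integral_add (L2.integrable_inner _ _) (L2.integrable_inner _ _)]
  refine integral_congr_ae ?_
  filter_upwards [(initL n).coeFn_compLp G, (lastL n).coeFn_compLp G,
    (memLp_tensor (n := n) (R := R) (memLp_segment (L := L) ψ.continuous)
      (memLp_gradient_testFunction φ)).coeFn_toLp,
    (memLp_tensor (n := n) (R := R) (memLp_segment (L := L) (continuous_deriv_test ψ))
      (memLp_testFunction φ _)).coeFn_toLp] with z h1 h2 h3 h4
  rw [h1, h2, h3, h4, fderiv_tensorTest, real_inner_smul_left, inner_gradient_left]
  simp
  ring

end Products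

/-! ### Slices of test functions -/

section Slices

variable {n : ℕ} {R L : ℝ}

theorem hasFDerivAt_horiz (t : ℝ) (x : EuclideanSpace ℝ (Fin n)) :
    HasFDerivAt (fun x => (splitLast n).symm (x, t)) (horizL n) x :=
  (splitLast n).symm.toContinuousLinearMap.hasFDerivAt.comp x (hasFDerivAt_prodMk_left x t)

theorem hasFDerivAt_vert (t : ℝ) (x : EuclideanSpace ℝ (Fin n)) :
    HasFDerivAt (fun t => (splitLast n).symm (x, t)) (vertL n) t :=
  (splitLast n).symm.toContinuousLinearMap.hasFDerivAt.comp t (hasFDerivAt_prodMk_right x t)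

/-- The horizontal slice `φ(·, t)` of a test function. -/
def horizSlice (φ : 𝓓(cylinder n R L, ℝ)) (t : ℝ) : 𝓓(ball n R, ℝ) where
  toFun x := φ ((splitLast n).symm (x, t))
  contDiff' :=
    φ.contDiff.comp ((splitLast n).symm.contDiff.comp (contDiff_id.prodMk contDiff_const))
  hasCompactSupport' := φ.hasCompactSupport.comp_isClosedEmbedding
    ((splitLast n).symm.toHomeomorph.isClosedEmbedding.comp
      (Topology.IsClosedEmbedding.of_continuous_injective_isClosedMap (by fun_prop)
        (fun x y h => (Prod.ext_iff.1 h).1) (isClosedMap_prodMk_right t)))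
  tsupport_subset' := by
    refine (tsupport_comp_subset_preimage φ (f := fun x => (splitLast n).symm (x, t))
      (by fun_prop)).trans fun x hx => ?_
    have := (mem_cylinder.1 (φ.tsupport_subset hx)).1
    rwa [initL_symm] at this

/-- The vertical slice `φ(x, ·)` of a test function. -/
def vertSlice (φ : 𝓓(cylinder n R L, ℝ)) (x : EuclideanSpace ℝ (Fin n)) : 𝓓(segment L, ℝ) where
  toFun t := φ ((splitLast n).symm (x, t))
  contDiff' :=
    φ.contDiff.comp ((splitLast n).symm.contDiff.comp (contDiff_const.prodMk contDiff_id))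
  hasCompactSupport' := φ.hasCompactSupport.comp_isClosedEmbedding
    ((splitLast n).symm.toHomeomorph.isClosedEmbedding.comp
      (Topology.IsClosedEmbedding.of_continuous_injective_isClosedMap (by fun_prop)
        (fun x y h => (Prod.ext_iff.1 h).2) (isClosedMap_prodMk_left x)))
  tsupport_subset' := by
    refine (tsupport_comp_subset_preimage φ (f := fun t => (splitLast n).symm (x, t))
      (by fun_prop)).trans fun t ht => ?_
    have := (mem_cylinder.1 (φ.tsupport_subset ht)).2
    rwa [lastL_symm] at this

theorem fderiv_horizSlice (φ : 𝓓(cylinder n R L, ℝ)) (t : ℝ) (x : EuclideanSpace ℝ (Fin n)) :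
    fderiv ℝ (horizSlice φ t) x = (fderiv ℝ φ ((splitLast n).symm (x, t))).comp (horizL n) :=
  ((φ.contDiff.differentiable (by simp) _).hasFDerivAt.comp x (hasFDerivAt_horiz t x)).fderiv

theorem deriv_vertSlice (φ : 𝓓(cylinder n R L, ℝ)) (t : ℝ) (x : EuclideanSpace ℝ (Fin n)) :
    deriv (vertSlice φ x) t = fderiv ℝ φ ((splitLast n).symm (x, t)) (vertL n 1) :=
  ((φ.contDiff.differentiable (by simp) _).hasFDerivAt.comp t
    (hasFDerivAt_vert t x)).hasDerivAt.deriv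

end Slices

/-! ### Slicewise integration by parts -/

section Fubini

variable {n : ℕ} {R L : ℝ}

/-- Integrate over x first: for each fixed t the slice φ(·, t) is a test function on the ball, so
the inner integral vanishes by hypothesis. -/
theorem inner_tensorL_test_eq_zero {f : L2 (ball n R)} {F : L2Vec (ball n R)}
    (h : ∀ χ : 𝓓(ball n R, ℝ), inner ℝ f (testFn χ) + inner ℝ F (testGrad χ) = (0 : ℝ))
    (e : Lp ℝ 2 (segmentMeasure L)) (φ : 𝓓(cylinder n R L, ℝ)) :
    inner ℝ (tensorL n R L ℝ e f) (testFn φ) +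
      inner ℝ (tensorL n R L _ e F) ((initL n).compLp (testGrad φ)) = (0 : ℝ) := by
  rw [L2.inner_def, L2.inner_def,
    ← integral_add (L2.integrable_inner _ _) (L2.integrable_inner _ _)]
  have hi := (L2.integrable_inner (𝕜 := ℝ) (tensorL n R L ℝ e f) (testFn φ)).add
    (L2.integrable_inner (𝕜 := ℝ) (tensorL n R L _ e F) ((initL n).compLp (testGrad φ)))
  have hae : (fun z => inner ℝ (tensorL n R L ℝ e f z) (testFn φ z) +
      inner ℝ (tensorL n R L _ e F z) ((initL n).compLp (testGrad φ) z)) =ᵐ[cylinderMeasure n R L]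
      fun z => e (lastL n z) * (f (initL n z) * φ z + fderiv ℝ φ z (horizL n (F (initL n z)))) := by
    filter_upwards [coeFn_tensorL e f, coeFn_tensorL e F, (initL n).coeFn_compLp (testGrad φ),
      (memLp_gradient_testFunction φ).coeFn_toLp,
      (memLp_testFunction φ (cylinderMeasure n R L)).coeFn_toLp] with z h1 h2 h3 h4 h5
    rw [h1, h2, h3, testGrad, h4, testFn, h5, real_inner_smul_left, initL_gradient]
    simp
    ring
  rw [integral_congr_ae hae, integral_cylinder_swap _ (hi.congr hae)]
  refine integral_eq_zero_of_ae (.of_forall fun t => ?_)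
  simp only [lastL_symm, initL_symm, Pi.zero_apply]
  rw [integral_const_mul]
  have h1 := h (horizSlice φ t)
  rw [inner_testFn, inner_testGrad, ← integral_add] at h1
  · simp only [fderiv_horizSlice] at h1
    rw [mul_eq_zero]
    exact .inr h1
  · exact MemLp.integrable_mul (p := 2) (q := 2) (Lp.memLp f) (memLp_testFunction _ _)
  · refine (L2.integrable_inner (𝕜 := ℝ) F (testGrad (horizSlice φ t))).congr ?_
    filter_upwards [(memLp_gradient_testFunction (horizSlice φ t)).coeFn_toLp] with x hx
    rw [testGrad, hx, inner_gradient_right]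
    simp

/-- The same slicing by t, with the weak gradient identity of the ball applied to φ(·, t). -/
theorem inner_tensorL_testDeriv_horizL {u : L2 (ball n R)} {g : L2Vec (ball n R)}
    (h : IsWeakGradient (ball n R) u g) (e : Lp ℝ 2 (segmentMeasure L))
    (φ : 𝓓(cylinder n R L, ℝ)) (a : EuclideanSpace ℝ (Fin n)) :
    (inner ℝ (tensorL n R L ℝ e u) (testDeriv φ (horizL n a)) : ℝ) =
      -inner ℝ (tensorL n R L _ e g) ((initL n).compLp (testSMul φ (horizL n a))) := by
  rw [eq_neg_iff_add_eq_zero, L2.inner_def, L2.inner_def,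
    ← integral_add (L2.integrable_inner _ _) (L2.integrable_inner _ _)]
  have hi := (L2.integrable_inner (𝕜 := ℝ) (tensorL n R L ℝ e u) (testDeriv φ (horizL n a))).add
    (L2.integrable_inner (𝕜 := ℝ) (tensorL n R L _ e g)
      ((initL n).compLp (testSMul φ (horizL n a))))
  have hae : (fun z => inner ℝ (tensorL n R L ℝ e u z) (testDeriv φ (horizL n a) z) +
      inner ℝ (tensorL n R L _ e g z) ((initL n).compLp (testSMul φ (horizL n a)) z))
      =ᵐ[cylinderMeasure n R L]
      fun z => e (lastL n z) * (u (initL n z) * fderiv ℝ φ z (horizL n a) +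
        inner ℝ (g (initL n z)) a * φ z) := by
    filter_upwards [coeFn_tensorL e u, coeFn_tensorL e g,
      (initL n).coeFn_compLp (testSMul φ (horizL n a)),
      (memLp_testFunction_smul φ (horizL n a)).coeFn_toLp,
      (memLp_fderiv_testFunction φ (horizL n a) (cylinderMeasure n R L)).coeFn_toLp]
      with z h1 h2 h3 h4 h5
    rw [h1, h2, h3, testSMul, h4, testDeriv, h5, map_smul, initL_horizL]
    simp only [real_inner_smul_left, real_inner_smul_right]
    simp
    ring
  rw [integral_congr_ae hae, integral_cylinder_swap _ (hi.congr hae)]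
  refine integral_eq_zero_of_ae (.of_forall fun t => ?_)
  simp only [lastL_symm, initL_symm, Pi.zero_apply]
  rw [integral_const_mul]
  have h1 := h (horizSlice φ t) a
  rw [eq_neg_iff_add_eq_zero, ← integral_add (integrable_mul_fderiv _ _ _)
    (integrable_inner_mul _ _ _)] at h1
  simp only [fderiv_horizSlice] at h1
  rw [mul_eq_zero]
  exact .inr h1

/-- Here t is integrated first: φ(x, ·) is a test function on the interval, so no boundary values of
`a` appear. -/
theorem inner_tensorL_testDeriv_vertL {a a' : ℝ → ℝ} (ha : ∀ t, HasDerivAt a (a' t) t)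
    (hac : Continuous a) (ha' : Continuous a') (w : L2 (ball n R)) (φ : 𝓓(cylinder n R L, ℝ)) :
    (inner ℝ (tensorL n R L ℝ (seg L a hac) w) (testDeriv φ (vertL n 1)) : ℝ) =
      -inner ℝ (tensorL n R L ℝ (seg L a' ha') w) (testFn φ) := by
  rw [L2.inner_def, L2.inner_def]
  have h1 : (fun z => inner ℝ (tensorL n R L ℝ (seg L a hac) w z) (testDeriv φ (vertL n 1) z))
      =ᵐ[cylinderMeasure n R L]
      fun z => w (initL n z) * (a (lastL n z) * fderiv ℝ φ z (vertL n 1)) := by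
    filter_upwards [coeFn_tensorL (seg L a hac) w,
      (quasiMeasurePreserving_lastL n R L).ae_eq_comp (coeFn_seg a hac),
      (memLp_fderiv_testFunction φ (vertL n 1) (cylinderMeasure n R L)).coeFn_toLp] with z h1 h2 h3
    simp only [Function.comp_apply] at h2
    rw [h1, h2, testDeriv, h3]
    simp
    ring
  have h2 : (fun z => inner ℝ (tensorL n R L ℝ (seg L a' ha') w z) (testFn φ z))
      =ᵐ[cylinderMeasure n R L]
      fun z => w (initL n z) * (a' (lastL n z) * φ z) := by
    filter_upwards [coeFn_tensorL (seg L a' ha') w,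
      (quasiMeasurePreserving_lastL n R L).ae_eq_comp (coeFn_seg a' ha'),
      (memLp_testFunction φ (cylinderMeasure n R L)).coeFn_toLp] with z h1 h2 h3
    simp only [Function.comp_apply] at h2
    rw [h1, h2, testFn, h3]
    simp
    ring
  rw [integral_congr_ae h1, integral_congr_ae h2,
    integral_cylinder _ ((L2.integrable_inner _ _).congr h1),
    integral_cylinder _ ((L2.integrable_inner _ _).congr h2), ← integral_neg]
  refine integral_congr_ae (.of_forall fun x => ?_)
  simp only [lastL_symm, initL_symm]
  rw [integral_const_mul, integral_const_mul, ← mul_neg]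
  congr 1
  have h3 := integral_mul_deriv_test ha ha' (vertSlice φ x)
  simp only [deriv_vertSlice] at h3
  exact h3

end Fubini

/-! ### The sines belong to H¹₀(0, L) -/

section Cutoff

variable {L : ℝ}

/-- The closed span of the pairs `(ψ, ψ')` with `ψ` a test function on `(0, L)`, that is, the
space `H¹₀(0, L)`. -/
def segmentH10 (L : ℝ) :
    Submodule ℝ (Lp ℝ 2 (segmentMeasure L) × Lp ℝ 2 (segmentMeasure L)) :=
  (Submodule.span ℝ (Set.range fun ψ : 𝓓(segment L, ℝ) =>
    (seg L ψ ψ.continuous, seg L (deriv ψ) (continuous_deriv_test ψ)))).topologicalClosure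

theorem segmentH10_le
    {N : Submodule ℝ (Lp ℝ 2 (segmentMeasure L) × Lp ℝ 2 (segmentMeasure L))}
    (hN : IsClosed (N : Set (Lp ℝ 2 (segmentMeasure L) × Lp ℝ 2 (segmentMeasure L))))
    (h : ∀ ψ : 𝓓(segment L, ℝ),
      (seg L ψ ψ.continuous, seg L (deriv ψ) (continuous_deriv_test ψ)) ∈ N) :
    segmentH10 L ≤ N := by
  refine Submodule.topologicalClosure_minimal _ (Submodule.span_le.2 ?_) hN
  rintro _ ⟨ψ, rfl⟩
  exact h ψ

/-- A smooth function that vanishes where `t (L - t) ≤ 1 / j` and is `1` where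
`t (L - t) ≥ 2 / j`. -/
def cutoff (L : ℝ) (j : ℕ) (t : ℝ) : ℝ := Real.smoothTransition (j * (t * (L - t)) - 1)

theorem contDiff_cutoff (L : ℝ) (j : ℕ) : ContDiff ℝ ∞ (cutoff L j) :=
  Real.smoothTransition.contDiff.comp (by fun_prop)

theorem hasDerivAt_cutoff (L : ℝ) (j : ℕ) (t : ℝ) : HasDerivAt (cutoff L j)
    (deriv Real.smoothTransition (j * (t * (L - t)) - 1) * (j * (L - 2 * t))) t := by
  have h1 : HasDerivAt (fun t : ℝ => j * (t * (L - t)) - 1) (j * (L - 2 * t)) t := by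
    refine ((((hasDerivAt_id' t).mul ((hasDerivAt_id' t).const_sub L)).const_mul
      (j : ℝ)).sub_const 1).congr_deriv ?_
    ring
  exact ((Real.smoothTransition.contDiff (n := 1)).differentiable (by simp) _).hasDerivAt.comp t h1

theorem deriv_smoothTransition_of_one_lt {s : ℝ} (hs : 1 < s) :
    deriv Real.smoothTransition s = 0 := by
  have : Real.smoothTransition =ᶠ[nhds s] fun _ => 1 := by
    filter_upwards [eventually_gt_nhds hs] with x hx
    exact Real.smoothTransition.one_of_one_le hx.le
  rw [this.deriv_eq]
  simp

/-- The product of a smooth function with the cutoff function, as a test function. -/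
def cutoffTest (hL : 0 < L) {a : ℝ → ℝ} (ha : ContDiff ℝ ∞ a) (j : ℕ) : 𝓓(segment L, ℝ) :=
  have hsub : {t : ℝ | 1 ≤ j * (t * (L - t))} ⊆ Set.Ioo 0 L := by
    intro t ht
    have h1 : 0 < t * (L - t) := by
      by_contra! h
      have := mul_nonneg (Nat.cast_nonneg (α := ℝ) j) (neg_nonneg.2 h)
      have := Set.mem_ofPred_eq ▸ ht
      linarith
    rcases pos_and_pos_or_neg_and_neg_of_mul_pos h1 with h | h
    · exact ⟨h.1, by linarith [h.2]⟩
    · linarith [h.1, h.2]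
  have hcl : IsClosed {t : ℝ | 1 ≤ j * (t * (L - t))} :=
    isClosed_le continuous_const (by fun_prop)
  have hK : IsCompact {t : ℝ | 1 ≤ j * (t * (L - t))} :=
    isCompact_Icc.of_isClosed_subset hcl (hsub.trans Set.Ioo_subset_Icc_self)
  have hs : (Function.support fun t => a t * cutoff L j t) ⊆ {t : ℝ | 1 ≤ j * (t * (L - t))} := by
    intro t ht
    by_contra h
    refine ht ?_
    simp only [Set.mem_ofPred_eq, not_le] at h
    simp only [cutoff]
    rw [Real.smoothTransition.zero_of_nonpos (by linarith), mul_zero]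
  { toFun := fun t => a t * cutoff L j t
    contDiff' := ha.mul (contDiff_cutoff L j)
    hasCompactSupport' := .of_support_subset_isCompact hK hs
    tsupport_subset' := (closure_minimal hs hcl).trans hsub }

theorem tendsto_cutoff (L : ℝ) {t : ℝ} (ht : t ∈ Set.Ioo 0 L) :
    ∀ᶠ j : ℕ in atTop, 1 < j * (t * (L - t)) - 1 := by
  have h0 : 0 < t * (L - t) := mul_pos ht.1 (by linarith [ht.2])
  have h1 : Tendsto (fun j : ℕ => j * (t * (L - t)) - 1) atTop atTop :=
    tendsto_atTop_add_const_right _ _ (tendsto_natCast_atTop_atTop.atTop_mul_const h0)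
  exact h1.eventually_gt_atTop 1

/-- The sine vanishes at both ends. Multiply the bound κt by L - t, the bound κ(L - t) by t, and
add. -/
theorem abs_sin_le_of_mem (hL : 0 < L) (k : ℕ) {t : ℝ} (ht : t ∈ Set.Ioo 0 L) :
    |Real.sin (k * Real.pi / L * t)| ≤ 2 * (k * Real.pi / L) / L * (t * (L - t)) := by
  have hκ : 0 ≤ k * Real.pi / L := by positivity
  have h1 : |Real.sin (k * Real.pi / L * t)| ≤ k * Real.pi / L * t := by
    refine Real.abs_sin_le_abs.trans (abs_of_nonneg (mul_nonneg hκ ht.1.le)).le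
  have h2 : |Real.sin (k * Real.pi / L * t)| ≤ k * Real.pi / L * (L - t) := by
    have h3 : k * Real.pi / L * t = k * Real.pi - k * Real.pi / L * (L - t) := by
      field_simp
      ring
    rw [h3, Real.sin_nat_mul_pi_sub, abs_neg, abs_mul, abs_pow, abs_neg, abs_one, one_pow, one_mul]
    exact Real.abs_sin_le_abs.trans (abs_of_nonneg (mul_nonneg hκ (by linarith [ht.2]))).le
  have h3 : 2 * (k * Real.pi / L) / L * (t * (L - t)) =
      2 * (k * Real.pi / L) * (t * (L - t)) / L := by ring
  rw [h3, le_div_iff₀ hL]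
  nlinarith [mul_le_mul_of_nonneg_right h1 (sub_nonneg.2 ht.2.le),
    mul_le_mul_of_nonneg_right h2 ht.1.le]

theorem exists_bound_deriv_smoothTransition :
    ∃ M : ℝ, 0 ≤ M ∧ ∀ s, -1 ≤ s → |deriv Real.smoothTransition s| ≤ M ∧
      (1 < s → deriv Real.smoothTransition s = 0) := by
  have hc : Continuous (deriv Real.smoothTransition) :=
    (Real.smoothTransition.contDiff (n := 1)).continuous_deriv (by simp)
  obtain ⟨M, hM⟩ := (isCompact_Icc (a := (-1 : ℝ)) (b := 1)).exists_bound_of_continuousOn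
    hc.continuousOn
  refine ⟨M, (norm_nonneg _).trans (hM 0 (by norm_num)), fun s hs =>
    ⟨?_, deriv_smoothTransition_of_one_lt⟩⟩
  rcases le_or_gt s 1 with h | h
  · exact hM s ⟨hs, h⟩
  · rw [deriv_smoothTransition_of_one_lt h, abs_zero]
    exact (norm_nonneg _).trans (hM 0 (by norm_num))

/-- The sine times the cutoff is a test function. Its derivative stays bounded uniformly in j: the
cutoff has slope O(j), but only where t(L - t) ≤ 2 / j, and there the sine is O(1 / j). Dominated
convergence gives weak convergence of the functions and of their derivatives, which suffices by the
duality criterion. -/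
theorem sin_mem_segmentH10 (hL : 0 < L) (k : ℕ)
    (h1 : Continuous fun t => Real.sin (k * Real.pi / L * t))
    (h2 : Continuous fun t => k * Real.pi / L * Real.cos (k * Real.pi / L * t)) :
    (seg L _ h1, seg L _ h2) ∈ segmentH10 L := by
  set κ := k * Real.pi / L with hκ
  have hκ0 : 0 ≤ κ := by positivity
  obtain ⟨M, hM0, hM⟩ := exists_bound_deriv_smoothTransition
  have hsin : ContDiff ℝ ∞ fun t => Real.sin (κ * t) := by fun_prop
  refine mem_span_closure_of_forall_inner _ _ fun f F hfF => ?_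
  have hder : ∀ j t, deriv (cutoffTest hL hsin j) t = κ * Real.cos (κ * t) * cutoff L j t +
      Real.sin (κ * t) *
        (deriv Real.smoothTransition (j * (t * (L - t)) - 1) * (j * (L - 2 * t))) := by
    intro j t
    have h3 : HasDerivAt (fun t => Real.sin (κ * t)) (κ * Real.cos (κ * t)) t := by
      refine ((Real.hasDerivAt_sin (κ * t)).comp t
        ((hasDerivAt_id' t).const_mul κ)).congr_deriv ?_
      ring
    exact (h3.mul (hasDerivAt_cutoff L j t)).deriv
  have hf : Integrable f (segmentMeasure L) := (Lp.memLp f).integrable (by norm_num)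
  have hF : Integrable F (segmentMeasure L) := (Lp.memLp F).integrable (by norm_num)
  have hcut : ∀ j t, |cutoff L j t| ≤ 1 := fun j t => by
    rw [cutoff, abs_of_nonneg (Real.smoothTransition.nonneg _)]
    exact Real.smoothTransition.le_one _
  have lim1 : Tendsto (fun j : ℕ => ∫ t, f t * cutoffTest hL hsin j t ∂(segmentMeasure L)) atTop
      (nhds (∫ t, f t * Real.sin (κ * t) ∂(segmentMeasure L))) := by
    refine tendsto_integral_of_dominated_convergence (fun t => |f t|) (fun j => ?_) hf.abs
      (fun j => .of_forall fun t => ?_) ?_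
    · exact hf.aestronglyMeasurable.mul (cutoffTest hL hsin j).continuous.aestronglyMeasurable
    · have : cutoffTest hL hsin j t = Real.sin (κ * t) * cutoff L j t := rfl
      rw [this, norm_mul, norm_mul, Real.norm_eq_abs, Real.norm_eq_abs, Real.norm_eq_abs]
      refine mul_le_of_le_one_right (abs_nonneg _) ?_
      exact mul_le_one₀ (Real.abs_sin_le_one _) (abs_nonneg _) (hcut j t)
    · filter_upwards [ae_restrict_mem (segment L).isOpen.measurableSet] with t ht
      refine tendsto_const_nhds.congr' ?_
      filter_upwards [tendsto_cutoff L ht] with j hj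
      have : cutoffTest hL hsin j t = Real.sin (κ * t) * cutoff L j t := rfl
      rw [this, cutoff, Real.smoothTransition.one_of_one_le hj.le, mul_one]
  have lim2 : Tendsto (fun j : ℕ => ∫ t, F t * deriv (cutoffTest hL hsin j) t ∂(segmentMeasure L))
      atTop (nhds (∫ t, F t * (κ * Real.cos (κ * t)) ∂(segmentMeasure L))) := by
    -- The term κ bounds the derivative of the sine times the cutoff. The other product is at most
    -- (2κ / L) t(L - t) · M j L, which is at most 4κM where j t(L - t) ≤ 2 and is 0 elsewhere.
    refine tendsto_integral_of_dominated_convergence (fun t => |F t| * (κ + 4 * κ * M))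
      (fun j => ?_) (hF.abs.mul_const _) (fun j => ?_) ?_
    · exact hF.aestronglyMeasurable.mul
        (continuous_deriv_test (cutoffTest hL hsin j)).aestronglyMeasurable
    · filter_upwards [ae_restrict_mem (segment L).isOpen.measurableSet] with t ht
      rw [norm_mul, Real.norm_eq_abs, Real.norm_eq_abs]
      refine mul_le_mul_of_nonneg_left ?_ (abs_nonneg _)
      rw [hder]
      refine (abs_add_le _ _).trans (add_le_add ?_ ?_)
      · rw [abs_mul, abs_mul, abs_of_nonneg hκ0]
        calc κ * |Real.cos (κ * t)| * |cutoff L j t| ≤ κ * 1 * 1 := by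
              gcongr
              · exact Real.abs_cos_le_one _
              · exact hcut j t
          _ = κ := by ring
      · have ht0 : 0 < t * (L - t) := mul_pos ht.1 (by linarith [ht.2])
        have hs0 : -1 ≤ j * (t * (L - t)) - 1 := by
          have : 0 ≤ j * (t * (L - t)) := by positivity
          linarith
        rcases le_or_gt (j * (t * (L - t)) - 1) 1 with h | h
        · have h5 : |L - 2 * t| ≤ L := by
            rw [abs_le]
            exact ⟨by linarith [ht.2], by linarith [ht.1]⟩
          rw [abs_mul, abs_mul, abs_mul, Nat.abs_cast]
          calc |Real.sin (κ * t)| * (|deriv Real.smoothTransition (j * (t * (L - t)) - 1)| *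
                (j * |L - 2 * t|)) ≤ (2 * κ / L * (t * (L - t))) * (M * (j * L)) := by
                gcongr
                · exact abs_sin_le_of_mem hL k ht
                · exact (hM _ hs0).1
            _ = 2 * κ * M * (j * (t * (L - t))) := by
                field_simp
            _ ≤ 2 * κ * M * 2 := by
                gcongr
                linarith
            _ = 4 * κ * M := by ring
        · rw [deriv_smoothTransition_of_one_lt h]
          simp only [zero_mul, mul_zero, abs_zero]
          positivity
    · filter_upwards [ae_restrict_mem (segment L).isOpen.measurableSet] with t ht
      refine tendsto_const_nhds.congr' ?_
      filter_upwards [tendsto_cutoff L ht] with j hj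
      rw [hder, cutoff, Real.smoothTransition.one_of_one_le hj.le,
        deriv_smoothTransition_of_one_lt hj]
      ring
  have hlim := lim1.add lim2
  rw [← inner_seg f _ h1, ← inner_seg F _ h2] at hlim
  refine tendsto_nhds_unique hlim (tendsto_const_nhds.congr fun j => ?_)
  rw [← hfF _ ⟨cutoffTest hL hsin j, rfl⟩, inner_seg, inner_seg]

end Cutoff

/-! ### Decomposition of inner products and directions -/

section Components

variable {n : ℕ} {R L : ℝ}

theorem inner_eq_add_components (G H : L2Vec (cylinder n R L)) :
    (inner ℝ G H : ℝ) = inner ℝ ((initL n).compLp G) ((initL n).compLp H) +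
      inner ℝ ((lastL n).compLp G) ((lastL n).compLp H) := by
  rw [L2.inner_def, L2.inner_def, L2.inner_def,
    ← integral_add (L2.integrable_inner _ _) (L2.integrable_inner _ _)]
  refine integral_congr_ae ?_
  filter_upwards [(initL n).coeFn_compLp G, (initL n).coeFn_compLp H, (lastL n).coeFn_compLp G,
    (lastL n).coeFn_compLp H] with z h1 h2 h3 h4
  rw [h1, h2, h3, h4, inner_eq_splitLast]
  simp [splitLast_eq, mul_comm]

theorem initL_testSMul (φ : 𝓓(cylinder n R L, ℝ)) (v : EuclideanSpace ℝ (Fin (n + 1))) :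
    (initL n).compLp (testSMul φ v) = (initL n).compLp (testSMul φ (horizL n (initL n v))) := by
  refine Lp.ext (((initL n).coeFn_compLp' _).trans
    (.trans ?_ ((initL n).coeFn_compLp' _).symm))
  filter_upwards [(memLp_testFunction_smul φ v).coeFn_toLp,
    (memLp_testFunction_smul φ (horizL n (initL n v))).coeFn_toLp] with z h1 h2
  rw [testSMul, testSMul, h1, h2, map_smul, map_smul, initL_horizL]

theorem testDeriv_add {m : ℕ} {Ω : Opens (EuclideanSpace ℝ (Fin m))} (φ : 𝓓(Ω, ℝ))
    (v w : EuclideanSpace ℝ (Fin m)) : testDeriv φ (v + w) = testDeriv φ v + testDeriv φ w := by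
  rw [testDeriv, testDeriv, testDeriv, ← MemLp.toLp_add, MemLp.toLp_eq_toLp_iff]
  exact .of_forall fun z => by simp

theorem testDeriv_smul {m : ℕ} {Ω : Opens (EuclideanSpace ℝ (Fin m))} (φ : 𝓓(Ω, ℝ))
    (c : ℝ) (v : EuclideanSpace ℝ (Fin m)) : testDeriv φ (c • v) = c • testDeriv φ v := by
  rw [testDeriv, testDeriv, ← MemLp.toLp_const_smul, MemLp.toLp_eq_toLp_iff]
  exact .of_forall fun z => by simp

theorem testDeriv_zero {m : ℕ} {Ω : Opens (EuclideanSpace ℝ (Fin m))} (φ : 𝓓(Ω, ℝ)) :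
    testDeriv φ 0 = 0 := by
  simpa using testDeriv_smul φ 0 0

theorem testSMul_zero {m : ℕ} {Ω : Opens (EuclideanSpace ℝ (Fin m))} (φ : 𝓓(Ω, ℝ)) :
    testSMul φ 0 = 0 := by
  refine Lp.ext ((memLp_testFunction_smul φ 0).coeFn_toLp.trans
    (.trans (.of_forall fun z => ?_) (Lp.coeFn_zero _ _ _).symm))
  simp

theorem testDeriv_eq (φ : 𝓓(cylinder n R L, ℝ)) (v : EuclideanSpace ℝ (Fin (n + 1))) :
    testDeriv φ v =
      testDeriv φ (horizL n (initL n v)) + lastL n v • testDeriv φ (vertL n 1) := by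
  rw [← testDeriv_smul, ← map_smul, smul_eq_mul, mul_one, ← testDeriv_add, horizL_initL_add_vertL]

end Components

/-! ### Transfer of form domains between ball and cylinder -/

section Transfer

variable {n : ℕ} {R L : ℝ}

/-- Two density arguments, one per factor: products of test functions are test functions, then `a`
is approximated with `φ` fixed, then `p` with `a` fixed. -/
theorem lift_mem_sobolevH10
    {a : Lp ℝ 2 (segmentMeasure L) × Lp ℝ 2 (segmentMeasure L)} (ha : a ∈ segmentH10 L)
    {p : L2 (ball n R) × L2Vec (ball n R)} (hp : p ∈ sobolevH10 (ball n R)) :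
    lift n R L a p ∈ sobolevH10 (cylinder n R L) := by
  have h1 : ∀ φ : 𝓓(ball n R, ℝ),
      lift n R L a (testFn φ, testGrad φ) ∈ sobolevH10 (cylinder n R L) := by
    intro φ
    have hle : segmentH10 L ≤ (sobolevH10 (cylinder n R L)).comap
        (liftFlip n R L (testFn φ, testGrad φ)).toLinearMap := by
      refine segmentH10_le ((isClosed_sobolevH10 _).preimage
        (liftFlip n R L (testFn φ, testGrad φ)).continuous) fun ψ => ?_
      rw [Submodule.mem_comap, ContinuousLinearMap.coe_coe, liftFlip_apply, lift_test]
      exact test_mem_sobolevH10 _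
    exact hle ha
  have hle : sobolevH10 (ball n R) ≤ (sobolevH10 (cylinder n R L)).comap
      (lift n R L a).toLinearMap :=
    sobolevH10_le ((isClosed_sobolevH10 _).preimage (lift n R L a).continuous) h1
  exact hle hp

/-- The test functions are compactly supported inside the cylinder, so no condition on `a` at the
endpoints is needed. -/
theorem lift_mem_sobolevH1 {a a' : ℝ → ℝ} (ha : ∀ t, HasDerivAt a (a' t) t)
    (hac : Continuous a) (ha' : Continuous a')
    {p : L2 (ball n R) × L2Vec (ball n R)} (hp : p ∈ sobolevH1 (ball n R)) :
    lift n R L (seg L a hac, seg L a' ha') p ∈ sobolevH1 (cylinder n R L) := by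
  obtain ⟨u, g⟩ := p
  refine isWeakGradient_iff.2 fun φ v => ?_
  rw [lift_apply, inner_add_left, inner_compLp_horizL, inner_compLp_vertL, lastL_testSMul,
    initL_testSMul, testDeriv_eq, inner_add_right, inner_tensorL_testDeriv_horizL hp,
    real_inner_smul_right, inner_tensorL_testDeriv_vertL ha hac ha', real_inner_smul_right]
  ring

variable (n R L) in
/-- The map `(v, G) ↦ (∫ e(t) v(·, t) dt, ∫ e(t) G'(·, t) dt)` with `G'` the horizontal component
of `G`. -/
def slicePair (e : Lp ℝ 2 (segmentMeasure L)) :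
    (L2 (cylinder n R L) × L2Vec (cylinder n R L)) →L[ℝ] L2 (ball n R) × L2Vec (ball n R) :=
  ((sliceL e).comp (.fst ℝ _ _)).prod
    (((sliceL e).comp ((initL n).compLpL 2 (cylinderMeasure n R L))).comp (.snd ℝ _ _))

theorem slicePair_apply (e : Lp ℝ 2 (segmentMeasure L))
    (v : L2 (cylinder n R L)) (G : L2Vec (cylinder n R L)) :
    slicePair n R L e (v, G) = (sliceL e v, sliceL e ((initL n).compLp G)) := rfl

/-- By density only test functions need be sliced. Their partial integrals are handled by duality,
so smoothness and support of the slices are never examined. -/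
theorem slicePair_mem_sobolevH10 (e : Lp ℝ 2 (segmentMeasure L))
    {p : L2 (cylinder n R L) × L2Vec (cylinder n R L)} (hp : p ∈ sobolevH10 (cylinder n R L)) :
    slicePair n R L e p ∈ sobolevH10 (ball n R) := by
  have hle : sobolevH10 (cylinder n R L) ≤ (sobolevH10 (ball n R)).comap
      (slicePair n R L e).toLinearMap := by
    refine sobolevH10_le ((isClosed_sobolevH10 _).preimage (slicePair n R L e).continuous)
      fun φ => mem_sobolevH10_of_forall_inner _ fun f F h => ?_
    rw [ContinuousLinearMap.coe_coe, slicePair_apply, inner_sliceL_right, inner_sliceL_right]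
    exact inner_tensorL_test_eq_zero h e φ
  exact hle hp

/-- The defect in the weak gradient identity is a continuous linear functional of `e`. For a test
function `e = ψ` it is the identity on the cylinder tested against φ ⊗ ψ, hence zero. Its Riesz
vector is thus orthogonal to all test functions and vanishes. -/
theorem slicePair_mem_sobolevH1 (e : Lp ℝ 2 (segmentMeasure L))
    {p : L2 (cylinder n R L) × L2Vec (cylinder n R L)} (hp : p ∈ sobolevH1 (cylinder n R L)) :
    slicePair n R L e p ∈ sobolevH1 (ball n R) := by
  obtain ⟨v, G⟩ := p
  refine isWeakGradient_iff.2 fun φ a => ?_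
  rw [slicePair_apply, inner_sliceL_left, inner_sliceL_left, eq_neg_iff_add_eq_zero]
  let l : Lp ℝ 2 (segmentMeasure L) →L[ℝ] ℝ :=
    (innerSL ℝ v).comp ((tensorL n R L ℝ).flip (testDeriv φ a)) +
    (innerSL ℝ ((initL n).compLp G)).comp ((tensorL n R L _).flip (testSMul φ a))
  have hl : ∀ e, l e = inner ℝ v (tensorL n R L ℝ e (testDeriv φ a)) +
      inner ℝ ((initL n).compLp G) (tensorL n R L _ e (testSMul φ a)) := fun e => rfl
  have h0 : (InnerProductSpace.toDual ℝ _).symm l = 0 := by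
    refine eq_zero_of_forall_inner_seg fun ψ => ?_
    rw [InnerProductSpace.toDual_symm_apply, hl]
    have h1 := isWeakGradient_iff.1 hp (tensorTest φ ψ) (horizL n a)
    rw [testDeriv_tensorTest, lastL_horizL, zero_smul, add_zero, initL_horizL,
      inner_eq_add_components, initL_testSMul_tensorTest, lastL_testSMul, lastL_horizL,
      zero_smul, inner_zero_right, add_zero, initL_horizL, eq_neg_iff_add_eq_zero] at h1
    exact h1
  rw [← hl, ← InnerProductSpace.toDual_symm_apply, h0, inner_zero_left]

/-- Integration by parts in t under the Dirichlet condition: the boundary term is killed by `p`, so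
`a` is any C¹ function. Closedness reduces to test functions. -/
theorem sliceL_lastL_of_mem_sobolevH10 {a a' : ℝ → ℝ} (ha : ∀ t, HasDerivAt a (a' t) t)
    (hac : Continuous a) (ha' : Continuous a')
    {p : L2 (cylinder n R L) × L2Vec (cylinder n R L)} (hp : p ∈ sobolevH10 (cylinder n R L)) :
    sliceL (seg L a hac) ((lastL n).compLp p.2) = -sliceL (seg L a' ha') p.1 := by
  let l : (L2 (cylinder n R L) × L2Vec (cylinder n R L)) →L[ℝ] L2 (ball n R) :=
    ((sliceL (seg L a hac)).comp ((lastL n).compLpL 2 (cylinderMeasure n R L))).comp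
      (.snd ℝ _ _) + (sliceL (seg L a' ha')).comp (.fst ℝ _ _)
  have hl : ∀ p, l p = sliceL (seg L a hac) ((lastL n).compLp p.2) +
      sliceL (seg L a' ha') p.1 := fun p => rfl
  have hle : sobolevH10 (cylinder n R L) ≤ l.toLinearMap.ker := by
    refine sobolevH10_le l.isClosed_ker fun φ => ?_
    rw [LinearMap.mem_ker, ContinuousLinearMap.coe_coe, hl]
    refine ext_inner_left ℝ fun w => ?_
    rw [inner_add_right, inner_sliceL_right, inner_sliceL_right, lastL_testGrad,
      inner_tensorL_testDeriv_vertL ha hac ha', inner_zero_right]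
    ring
  have h := hle hp
  rw [LinearMap.mem_ker, ContinuousLinearMap.coe_coe, hl] at h
  exact eq_neg_of_add_eq_zero_left h

/-- The counterpart for the Neumann condition, with the roles exchanged: `p` is free at the ends and
`a` vanishes there. -/
theorem sliceL_lastL_of_mem_sobolevH1
    {a : Lp ℝ 2 (segmentMeasure L) × Lp ℝ 2 (segmentMeasure L)} (ha : a ∈ segmentH10 L)
    {p : L2 (cylinder n R L) × L2Vec (cylinder n R L)} (hp : p ∈ sobolevH1 (cylinder n R L)) :
    sliceL a.1 ((lastL n).compLp p.2) = -sliceL a.2 p.1 := by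
  obtain ⟨v, G⟩ := p
  rw [eq_neg_iff_add_eq_zero]
  refine eq_zero_of_forall_inner_testFn fun φ => ?_
  rw [inner_add_left, inner_sliceL_left, inner_sliceL_left]
  let l : (Lp ℝ 2 (segmentMeasure L) × Lp ℝ 2 (segmentMeasure L)) →L[ℝ] ℝ :=
    ((innerSL ℝ ((lastL n).compLp G)).comp ((tensorL n R L ℝ).flip (testFn φ))).comp
      (.fst ℝ _ _) + ((innerSL ℝ v).comp ((tensorL n R L ℝ).flip (testFn φ))).comp (.snd ℝ _ _)
  have hl : ∀ a, l a = inner ℝ ((lastL n).compLp G) (tensorL n R L ℝ a.1 (testFn φ)) +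
      inner ℝ v (tensorL n R L ℝ a.2 (testFn φ)) := fun e => rfl
  have hle : segmentH10 L ≤ l.toLinearMap.ker := by
    refine segmentH10_le l.isClosed_ker fun ψ => ?_
    rw [LinearMap.mem_ker, ContinuousLinearMap.coe_coe, hl]
    have h1 := isWeakGradient_iff.1 hp (tensorTest φ ψ) (vertL n 1)
    rw [testDeriv_tensorTest, lastL_vertL, one_smul, initL_vertL, testDeriv_zero, map_zero,
      zero_add, inner_eq_add_components, initL_testSMul_tensorTest, initL_vertL, testSMul_zero,
      map_zero, inner_zero_right, zero_add, lastL_testSMul, lastL_vertL, one_smul,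
      testFn_tensorTest] at h1
    simp only at h1 ⊢
    rw [h1]
    ring
  have h := hle ha
  rwa [LinearMap.mem_ker, ContinuousLinearMap.coe_coe, hl] at h

end Transfer

/-! ### Completeness of cosines and sines on (0, L) -/

section Completeness

variable {L : ℝ}

theorem integrable_mul_of_continuous {h : ℝ → ℝ} (hh : Integrable h (segmentMeasure L))
    {a : ℝ → ℝ} (ha : Continuous a) : Integrable (fun t => h t * a t) (segmentMeasure L) := by
  obtain ⟨C, hC⟩ := (isCompact_Icc (a := 0) (b := L)).exists_bound_of_continuousOn ha.continuousOn
  refine hh.mul_bdd (c := C) ha.aestronglyMeasurable ?_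
  filter_upwards [ae_restrict_mem (segment L).isOpen.measurableSet] with t ht
  exact hC t (Set.Ioo_subset_Icc_self ht)

/-- The map t ↦ cos(πt / L) is injective on [0, L], so after the substitution s = cos(πt / L)
Weierstrass approximates every test function uniformly by polynomials in this cosine. -/
theorem ae_eq_zero_of_forall_integral_cos_pow (hL : 0 < L) {h : ℝ → ℝ}
    (hh : Integrable h (segmentMeasure L))
    (h0 : ∀ m : ℕ, ∫ t, h t * Real.cos (Real.pi / L * t) ^ m ∂(segmentMeasure L) = 0) :
    h =ᵐ[segmentMeasure L] 0 := by
  refine eq_zero_of_forall_integral_test (μ := volume)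
    (locallyIntegrableOn_of_locallyIntegrable_restrict hh.locallyIntegrable) fun ψ => ?_
  have hp : ∀ p : Polynomial ℝ,
      ∫ t, h t * p.eval (Real.cos (Real.pi / L * t)) ∂(segmentMeasure L) = 0 := by
    intro p
    simp only [Polynomial.eval_eq_sum_range, Finset.mul_sum]
    rw [integral_finsetSum]
    · refine Finset.sum_eq_zero fun i _ => ?_
      simp only [mul_left_comm (h _)]
      rw [integral_const_mul, h0, mul_zero]
    · intro i _
      exact integrable_mul_of_continuous hh (by fun_prop)
  by_contra hne
  have hpos : 0 < |∫ t in (segment L : Set ℝ), h t * ψ t| := abs_pos.2 hne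
  set A := ∫ t, |h t| ∂(segmentMeasure L)
  have hA : 0 ≤ A := integral_nonneg fun t => abs_nonneg _
  -- Dividing by A + 1 makes A ε strictly smaller than the integral and also covers A = 0.
  set ε := |∫ t in (segment L : Set ℝ), h t * ψ t| / (A + 1)
  have hε : 0 < ε := by positivity
  obtain ⟨p, hpε⟩ := exists_polynomial_near_of_continuousOn (-1) 1
    (fun s => ψ (Real.arccos s / (Real.pi / L))) (by fun_prop) ε hε
  have hb : |∫ t in (segment L : Set ℝ), h t * ψ t| ≤ A * ε := by
    have h1 : ∫ t in (segment L : Set ℝ), h t * ψ t = ∫ t in (segment L : Set ℝ),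
        (h t * ψ t - h t * p.eval (Real.cos (Real.pi / L * t))) := by
      rw [integral_sub (integrable_mul_of_continuous hh ψ.continuous)
        (integrable_mul_of_continuous hh (by fun_prop)), hp, sub_zero]
    rw [h1, ← Real.norm_eq_abs, ← integral_mul_const]
    refine norm_integral_le_of_norm_le (hh.abs.mul_const _) ?_
    filter_upwards [ae_restrict_mem (segment L).isOpen.measurableSet] with t ht
    have h2 := hpε (Real.cos (Real.pi / L * t)) ⟨Real.neg_one_le_cos _, Real.cos_le_one _⟩
    have h3 : 0 < Real.pi / L := by positivity
    rw [Real.arccos_cos (mul_nonneg h3.le ht.1.le) (by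
      rw [div_mul_eq_mul_div, div_le_iff₀ hL]
      exact mul_le_mul_of_nonneg_left ht.2.le Real.pi_pos.le),
      mul_div_cancel_left₀ _ h3.ne'] at h2
    rw [← mul_sub, norm_mul, Real.norm_eq_abs, Real.norm_eq_abs, abs_sub_comm]
    exact mul_le_mul_of_nonneg_left h2.le (abs_nonneg _)
  have h4 : |∫ t in (segment L : Set ℝ), h t * ψ t| = (A + 1) * ε := by
    simp only [ε]
    field_simp
  nlinarith

/-- By the recursion, multiplying by cos κt turns `T k` into the mean of its two neighbours, so
powers of the cosine can be added one at a time. Indices are integers so that k - 1 is always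
available. -/
theorem integral_mul_cos_pow_eq_zero {h : ℝ → ℝ} (hh : Integrable h (segmentMeasure L)) {κ : ℝ}
    {T : ℤ → ℝ → ℝ} (hT : ∀ k, Continuous (T k))
    (hrec : ∀ k t, 2 * (Real.cos (κ * t) * T k t) = T (k + 1) t + T (k - 1) t)
    (h0 : ∀ k, ∫ t, h t * T k t ∂(segmentMeasure L) = 0) (m : ℕ) (k : ℤ) :
    ∫ t, h t * (Real.cos (κ * t) ^ m * T k t) ∂(segmentMeasure L) = 0 := by
  induction m generalizing k with
  | zero => simpa using h0 k
  | succ m ih =>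
    have h1 : ∀ t, h t * (Real.cos (κ * t) ^ (m + 1) * T k t) =
        (h t * (Real.cos (κ * t) ^ m * T (k + 1) t) +
          h t * (Real.cos (κ * t) ^ m * T (k - 1) t)) / 2 := by
      intro t
      rw [← mul_add, ← mul_add, ← hrec]
      ring
    simp only [h1]
    rw [integral_div, integral_add, ih, ih]
    · simp
    · exact integrable_mul_of_continuous hh (by have := hT (k + 1); fun_prop)
    · exact integrable_mul_of_continuous hh (by have := hT (k - 1); fun_prop)

theorem ae_eq_zero_of_forall_integral_cos (hL : 0 < L) {h : ℝ → ℝ}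
    (hh : Integrable h (segmentMeasure L))
    (h0 : ∀ k : ℕ, ∫ t, h t * Real.cos (k * Real.pi / L * t) ∂(segmentMeasure L) = 0) :
    h =ᵐ[segmentMeasure L] 0 := by
  refine ae_eq_zero_of_forall_integral_cos_pow hL hh fun m => ?_
  have := integral_mul_cos_pow_eq_zero hh (κ := Real.pi / L)
    (T := fun k t => Real.cos (k * Real.pi / L * t)) (fun k => by fun_prop) (fun k t => ?_)
    (fun k => ?_) m 0
  · simpa using this
  · rw [← mul_assoc, Real.two_mul_cos_mul_cos, add_comm, ← Real.cos_neg (_ - _)]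
    push_cast
    congr 2 <;> ring
  · obtain ⟨j, rfl | rfl⟩ := k.eq_nat_or_neg
    · exact_mod_cast h0 j
    · rw [← h0 j]
      congr! 3 with t
      rw [← Real.cos_neg]
      push_cast
      congr 1
      ring

/-- Starting the recursion at k = 1 shows that h(t) sin(πt / L) is orthogonal to all powers of the
cosine, hence zero; and this sine is positive inside the interval. -/
theorem ae_eq_zero_of_forall_integral_sin (hL : 0 < L) {h : ℝ → ℝ}
    (hh : Integrable h (segmentMeasure L))
    (h0 : ∀ k : ℕ, ∫ t, h t * Real.sin (k * Real.pi / L * t) ∂(segmentMeasure L) = 0) :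
    h =ᵐ[segmentMeasure L] 0 := by
  have key : (fun t => h t * Real.sin (Real.pi / L * t)) =ᵐ[segmentMeasure L] 0 := by
    refine ae_eq_zero_of_forall_integral_cos_pow hL
      (integrable_mul_of_continuous hh (by fun_prop)) fun m => ?_
    have := integral_mul_cos_pow_eq_zero hh (κ := Real.pi / L)
      (T := fun k t => Real.sin (k * Real.pi / L * t)) (fun k => by fun_prop) (fun k t => ?_)
      (fun k => ?_) m 1
    · rw [← this]
      congr! 2 with t
      push_cast
      rw [one_mul]
      ring
    · have h1 : ((k + 1 : ℤ) : ℝ) * Real.pi / L * t =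
          k * Real.pi / L * t + Real.pi / L * t := by push_cast; ring
      have h2 : ((k - 1 : ℤ) : ℝ) * Real.pi / L * t =
          k * Real.pi / L * t - Real.pi / L * t := by push_cast; ring
      rw [h1, h2, Real.sin_add, Real.sin_sub]
      ring
    · obtain ⟨j, rfl | rfl⟩ := k.eq_nat_or_neg
      · exact_mod_cast h0 j
      · rw [← neg_zero, ← h0 j, ← integral_neg]
        congr! 2 with t
        rw [← mul_neg, ← Real.sin_neg]
        push_cast
        congr 2
        ring
  filter_upwards [key, ae_restrict_mem (segment L).isOpen.measurableSet] with t ht htL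
  have hpos : 0 < Real.sin (Real.pi / L * t) := by
    have h3 : 0 < Real.pi / L := by positivity
    refine Real.sin_pos_of_pos_of_lt_pi (mul_pos h3 htL.1) ?_
    rw [div_mul_eq_mul_div, div_lt_iff₀ hL]
    exact mul_lt_mul_of_pos_left htL.2 Real.pi_pos
  exact (mul_eq_zero.1 ht).resolve_right hpos.ne'

end Completeness

/-! ### The modes of the interval -/

/-- The position of the `k`-th eigenvalue of the interval among the multiples of `π / L`. -/
def BoundaryCondition.index : BoundaryCondition → ℕ → ℕ
  | dirichlet, k => k + 1
  | neumann, k => k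

/-- The `k`-th frequency of the interval `(0, L)`. -/
def freq (bc : BoundaryCondition) (L : ℝ) (k : ℕ) : ℝ := bc.index k * Real.pi / L

/-- The `k`-th eigenfunction of the interval `(0, L)`. -/
def modeFn (bc : BoundaryCondition) (L : ℝ) (k : ℕ) (t : ℝ) : ℝ :=
  match bc with
  | .dirichlet => Real.sin (freq .dirichlet L k * t)
  | .neumann => Real.cos (freq .neumann L k * t)

/-- The derivative of the `k`-th eigenfunction of the interval `(0, L)`. -/
def modeDeriv (bc : BoundaryCondition) (L : ℝ) (k : ℕ) (t : ℝ) : ℝ :=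
  match bc with
  | .dirichlet => freq .dirichlet L k * Real.cos (freq .dirichlet L k * t)
  | .neumann => -(freq .neumann L k * Real.sin (freq .neumann L k * t))

theorem continuous_modeFn (bc : BoundaryCondition) (L : ℝ) (k : ℕ) :
    Continuous (modeFn bc L k) := by
  cases bc <;> unfold modeFn <;> fun_prop

theorem continuous_modeDeriv (bc : BoundaryCondition) (L : ℝ) (k : ℕ) :
    Continuous (modeDeriv bc L k) := by
  cases bc <;> unfold modeDeriv <;> fun_prop

theorem hasDerivAt_sin_mul (c t : ℝ) :
    HasDerivAt (fun t => Real.sin (c * t)) (c * Real.cos (c * t)) t :=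
  ((Real.hasDerivAt_sin (c * t)).comp t ((hasDerivAt_id' t).const_mul c)).congr_deriv (by ring)

theorem hasDerivAt_cos_mul (c t : ℝ) :
    HasDerivAt (fun t => Real.cos (c * t)) (-(c * Real.sin (c * t))) t :=
  ((Real.hasDerivAt_cos (c * t)).comp t ((hasDerivAt_id' t).const_mul c)).congr_deriv (by ring)

theorem hasDerivAt_modeFn (bc : BoundaryCondition) (L : ℝ) (k : ℕ) (t : ℝ) :
    HasDerivAt (modeFn bc L k) (modeDeriv bc L k t) t := by
  cases bc
  · exact hasDerivAt_sin_mul _ t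
  · exact hasDerivAt_cos_mul _ t

theorem hasDerivAt_modeDeriv (bc : BoundaryCondition) (L : ℝ) (k : ℕ) (t : ℝ) :
    HasDerivAt (modeDeriv bc L k) (-freq bc L k ^ 2 * modeFn bc L k t) t := by
  cases bc
  · exact ((hasDerivAt_cos_mul _ t).const_mul _).congr_deriv (by simp only [modeFn]; ring)
  · exact ((hasDerivAt_sin_mul _ t).const_mul _).neg.congr_deriv (by simp only [modeFn]; ring)

/-- The `k`-th eigenfunction of the interval in `L²(0, L)`. -/
def mode (bc : BoundaryCondition) (L : ℝ) (k : ℕ) : Lp ℝ 2 (segmentMeasure L) :=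
  seg L (modeFn bc L k) (continuous_modeFn bc L k)

/-- The `k`-th eigenfunction of the interval in `L²(0, L)`, together with its derivative. -/
def modePair (bc : BoundaryCondition) (L : ℝ) (k : ℕ) :
    Lp ℝ 2 (segmentMeasure L) × Lp ℝ 2 (segmentMeasure L) :=
  (mode bc L k, seg L (modeDeriv bc L k) (continuous_modeDeriv bc L k))

/-! ### Orthogonality, completeness and nontriviality of the modes -/

section Orthogonality

variable {L : ℝ}

theorem integral_cos_mul_pi (hL : 0 < L) {m : ℤ} (hm : m ≠ 0) :
    ∫ t, Real.cos (m * Real.pi / L * t) ∂(segmentMeasure L) = 0 := by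
  have hc : (m * Real.pi / L : ℝ) ≠ 0 :=
    div_ne_zero (mul_ne_zero (Int.cast_ne_zero.2 hm) Real.pi_ne_zero) hL.ne'
  have h := intervalIntegral.integral_comp_mul_left (a := 0) (b := L) Real.cos hc
  rw [intervalIntegral.integral_of_le hL.le, integral_Ioc_eq_integral_Ioo] at h
  have h2 : (m * Real.pi / L : ℝ) * L = m * Real.pi := by field_simp
  refine h.trans ?_
  rw [integral_cos, h2, Real.sin_int_mul_pi]
  simp

theorem integrable_segment {a : ℝ → ℝ} (ha : Continuous a) :
    Integrable a (segmentMeasure L) :=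
  (memLp_segment ha).integrable (by norm_num)

theorem inner_mode_eq_zero (bc : BoundaryCondition) (hL : 0 < L) {i j : ℕ} (hij : i ≠ j) :
    inner ℝ (mode bc L i) (mode bc L j) = (0 : ℝ) := by
  rw [mode, mode, inner_seg_seg]
  have hne : ∀ a b : ℕ, a ≠ b → (a : ℤ) - b ≠ 0 ∧ (a : ℤ) + b ≠ 0 := by
    intro a b h
    omega
  cases bc
  · have h := hne (i + 1) (j + 1) (by omega)
    have h1 : ∀ t, modeFn .dirichlet L i t * modeFn .dirichlet L j t =
        (Real.cos (((i + 1 : ℕ) - (j + 1 : ℕ) : ℤ) * Real.pi / L * t) -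
          Real.cos (((i + 1 : ℕ) + (j + 1 : ℕ) : ℤ) * Real.pi / L * t)) / 2 := by
      intro t
      have h2 := Real.two_mul_sin_mul_sin (freq .dirichlet L i * t) (freq .dirichlet L j * t)
      have h3 : (((i + 1 : ℕ) - (j + 1 : ℕ) : ℤ) * Real.pi / L * t : ℝ) =
          freq .dirichlet L i * t - freq .dirichlet L j * t := by
        simp only [freq, BoundaryCondition.index]; push_cast; ring
      have h4 : (((i + 1 : ℕ) + (j + 1 : ℕ) : ℤ) * Real.pi / L * t : ℝ) =
          freq .dirichlet L i * t + freq .dirichlet L j * t := by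
        simp only [freq, BoundaryCondition.index]; push_cast; ring
      rw [h3, h4, ← h2]
      simp only [modeFn]
      ring
    simp only [h1]
    rw [integral_div, integral_sub (integrable_segment (by fun_prop))
      (integrable_segment (by fun_prop)), integral_cos_mul_pi hL h.1, integral_cos_mul_pi hL h.2]
    simp
  · have h := hne i j hij
    have h1 : ∀ t, modeFn .neumann L i t * modeFn .neumann L j t =
        (Real.cos ((i - j : ℤ) * Real.pi / L * t) +
          Real.cos ((i + j : ℤ) * Real.pi / L * t)) / 2 := by
      intro t
      have h2 := Real.two_mul_cos_mul_cos (freq .neumann L i * t) (freq .neumann L j * t)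
      have h3 : ((i - j : ℤ) * Real.pi / L * t : ℝ) =
          freq .neumann L i * t - freq .neumann L j * t := by
        simp only [freq, BoundaryCondition.index]; push_cast; ring
      have h4 : ((i + j : ℤ) * Real.pi / L * t : ℝ) =
          freq .neumann L i * t + freq .neumann L j * t := by
        simp only [freq, BoundaryCondition.index]; push_cast; ring
      rw [h3, h4, ← h2]
      simp only [modeFn]
      ring
    simp only [h1]
    rw [integral_div, integral_add (integrable_segment (by fun_prop))
      (integrable_segment (by fun_prop)), integral_cos_mul_pi hL h.1, integral_cos_mul_pi hL h.2]
    simp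

theorem ae_eq_zero_of_forall_integral_modeFn (bc : BoundaryCondition) (hL : 0 < L) {h : ℝ → ℝ}
    (hh : Integrable h (segmentMeasure L))
    (h0 : ∀ k : ℕ, ∫ t, h t * modeFn bc L k t ∂(segmentMeasure L) = 0) :
    h =ᵐ[segmentMeasure L] 0 := by
  cases bc
  · refine ae_eq_zero_of_forall_integral_sin hL hh fun k => ?_
    rcases k with _ | k
    · simp
    · exact h0 k
  · exact ae_eq_zero_of_forall_integral_cos hL hh h0

theorem mode_ne_zero (bc : BoundaryCondition) (hL : 0 < L) (k : ℕ) : mode bc L k ≠ 0 := by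
  intro h0
  have hpos : ∃ t ∈ Set.Ioo 0 L, modeFn bc L k t ≠ 0 := by
    -- At this point the phase is π/2 times index / (index + 1). It lies in [0, π/2), so the cosine
    -- is positive; for Dirichlet the index is positive and so is the sine.
    refine ⟨L / (2 * (bc.index k + 1)), ⟨by positivity, ?_⟩, ?_⟩
    · rw [div_lt_iff₀ (by positivity)]
      have : (0 : ℝ) ≤ bc.index k := Nat.cast_nonneg _
      nlinarith
    · have h1 : freq bc L k * (L / (2 * (bc.index k + 1))) =
          (bc.index k / (bc.index k + 1)) * (Real.pi / 2) := by
        simp only [freq]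
        field_simp
      have h2 : ((bc.index k : ℝ) / (bc.index k + 1)) < 1 := by
        rw [div_lt_one (by positivity)]; linarith
      have h3 : (0 : ℝ) ≤ (bc.index k : ℝ) / (bc.index k + 1) := by positivity
      have hp := Real.pi_pos
      cases bc
      · simp only [modeFn, h1]
        refine (Real.sin_pos_of_pos_of_lt_pi ?_ (by nlinarith)).ne'
        have : (0 : ℝ) < BoundaryCondition.dirichlet.index k := by
          simp only [BoundaryCondition.index]; positivity
        positivity
      · simp only [modeFn, h1]
        exact (Real.cos_pos_of_mem_Ioo ⟨by nlinarith, by nlinarith⟩).ne'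
  obtain ⟨t, ht, hne⟩ := hpos
  have h1 : modeFn bc L k =ᵐ[segmentMeasure L] fun _ => 0 :=
    (coeFn_seg _ (continuous_modeFn bc L k)).symm.trans (by
      rw [← mode, h0]; exact Lp.coeFn_zero _ _ _)
  exact hne (Measure.eqOn_open_of_ae_eq h1 isOpen_Ioo (continuous_modeFn bc L k).continuousOn
    continuousOn_const ht)

end Orthogonality

/-! ### Separation of variables on eigenspaces -/

section Eigenspaces

variable {n : ℕ} {R L : ℝ} {bc : BoundaryCondition}

theorem lift_modePair_mem (hL : 0 < L) (k : ℕ) {p : L2 (ball n R) × L2Vec (ball n R)}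
    (hp : p ∈ formDomain bc (ball n R)) :
    lift n R L (modePair bc L k) p ∈ formDomain bc (cylinder n R L) := by
  cases bc
  · exact lift_mem_sobolevH10 (sin_mem_segmentH10 hL (k + 1) (by fun_prop) (by fun_prop)) hp
  · exact lift_mem_sobolevH1 (hasDerivAt_modeFn _ _ _) _ _ hp

theorem slicePair_mode_mem (k : ℕ) {p : L2 (cylinder n R L) × L2Vec (cylinder n R L)}
    (hp : p ∈ formDomain bc (cylinder n R L)) :
    slicePair n R L (mode bc L k) p ∈ formDomain bc (ball n R) := by
  cases bc
  · exact slicePair_mem_sobolevH10 _ hp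
  · exact slicePair_mem_sobolevH1 _ hp

/-- The weak form of -e_k'' = freq² e_k. No boundary term arises: for Dirichlet `p` vanishes at the
ends, for Neumann e_k' is a multiple of a sine and so lies in H¹₀(0, L). -/
theorem sliceL_modePair_snd (hL : 0 < L) (k : ℕ)
    {p : L2 (cylinder n R L) × L2Vec (cylinder n R L)}
    (hp : p ∈ formDomain bc (cylinder n R L)) :
    sliceL (modePair bc L k).2 ((lastL n).compLp p.2) =
      freq bc L k ^ 2 • sliceL (F := ℝ) (mode bc L k) p.1 := by
  have hsmul : ∀ (c : ℝ) (e : Lp ℝ 2 (segmentMeasure L)) (v : L2 (cylinder n R L)),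
      sliceL (n := n) (R := R) (c • e) v = c • sliceL (n := n) (R := R) e v := by
    intro c e v
    refine ext_inner_right ℝ fun w => ?_
    rw [inner_sliceL_left, real_inner_smul_left, inner_sliceL_left, map_smul,
      smul_apply, real_inner_smul_right]
  cases bc
  · have h := sliceL_lastL_of_mem_sobolevH10 (hasDerivAt_modeDeriv .dirichlet L k)
      (continuous_modeDeriv _ _ _) ((continuous_modeFn _ _ _).const_mul _) hp
    rw [seg_const_mul _ _ (continuous_modeFn _ _ _), hsmul, neg_smul, neg_neg] at h
    exact h
  · have h := sliceL_lastL_of_mem_sobolevH1 (sin_mem_segmentH10 hL k (by fun_prop) (by fun_prop)) hp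
    have h1 : (modePair .neumann L k).2 = (-freq .neumann L k) •
        seg L (fun t => Real.sin (k * Real.pi / L * t)) (by fun_prop) := by
      rw [← seg_const_mul _ _ _ (by fun_prop)]
      simp only [modePair]
      congr 1
      ext t
      simp [modeDeriv, freq, BoundaryCondition.index]
    have h2 : seg L (fun t => k * Real.pi / L * Real.cos (k * Real.pi / L * t)) (by fun_prop) =
        freq .neumann L k • mode .neumann L k := by
      rw [seg_const_mul _ _ (by fun_prop)]
      rfl
    rw [h1, hsmul, h, h2, hsmul]
    module

/-- A test pair on the cylinder enters the form only through its slice against e_k, which is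
admissible on the ball. -/
theorem tensorL_mode_mem_eigenspace (hL : 0 < L) (k : ℕ) {Λ : ℝ} {u : L2 (ball n R)}
    (hu : u ∈ eigenspace bc (ball n R) Λ) :
    tensorL n R L ℝ (mode bc L k) u ∈ eigenspace bc (cylinder n R L) (Λ + freq bc L k ^ 2) := by
  obtain ⟨g, hg, h⟩ := hu
  refine ⟨(lift n R L (modePair bc L k) (u, g)).2, lift_modePair_mem hL k hg, fun p hp => ?_⟩
  rw [inner_lift_snd, sliceL_modePair_snd hL k hp, ← inner_sliceL_right, real_inner_smul_right]
  have h1 := h _ (slicePair_mode_mem k hp)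
  rw [slicePair_apply] at h1
  simp only [modePair] at h1 ⊢
  rw [h1]
  ring

/-- The adjoint argument: the equation on the cylinder is tested with lifts e_k ⊗ p. -/
theorem sliceL_mode_mem_eigenspace (hL : 0 < L) (k : ℕ) {Λ : ℝ} {v : L2 (cylinder n R L)}
    (hv : v ∈ eigenspace bc (cylinder n R L) Λ) :
    sliceL (mode bc L k) v ∈ eigenspace bc (ball n R) (Λ - freq bc L k ^ 2) := by
  obtain ⟨G, hG, h⟩ := hv
  have hm := slicePair_mode_mem k hG
  rw [slicePair_apply] at hm
  refine ⟨sliceL (mode bc L k) ((initL n).compLp G), hm, fun p hp => ?_⟩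
  have h1 : (inner ℝ G (lift n R L (modePair bc L k) p).2 : ℝ) =
      Λ * inner ℝ v (tensorL n R L ℝ (mode bc L k) p.1) := h _ (lift_modePair_mem hL k hp)
  have h2 : (inner ℝ G (lift n R L (modePair bc L k) p).2 : ℝ) =
      inner ℝ p.2 (sliceL (mode bc L k) ((initL n).compLp G)) +
        inner ℝ p.1 (sliceL (modePair bc L k).2 ((lastL n).compLp G)) :=
    (real_inner_comm _ _).trans (inner_lift_snd _ _ _)
  have h3 := sliceL_modePair_snd hL k hG
  simp only at h3
  rw [h3, real_inner_smul_right, real_inner_comm _ p.2, real_inner_comm _ p.1] at h2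
  rw [← inner_sliceL_left] at h1
  linarith

/-- Testing an eigenfunction with itself gives ‖g‖² = Λ‖u‖². -/
theorem eigenspace_eq_bot_of_neg {m : ℕ} (Ω : Opens (EuclideanSpace ℝ (Fin m))) {Λ : ℝ}
    (hΛ : Λ < 0) : eigenspace bc Ω Λ = ⊥ := by
  rw [eq_bot_iff]
  rintro u ⟨g, hg, h⟩
  have h1 := h _ hg
  simp only [real_inner_self_eq_norm_sq] at h1
  have h2 : ‖u‖ ^ 2 ≤ 0 := by
    by_contra! h3
    nlinarith [sq_nonneg ‖g‖]
  simpa using h2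

/-- For almost every x all of the countably many coefficients of v(x, ·) vanish, so v(x, ·) = 0 by
completeness on the interval; Fubini concludes. -/
theorem eq_zero_of_forall_sliceL_mode (hL : 0 < L) {v : L2 (cylinder n R L)}
    (h : ∀ k, sliceL (mode bc L k) v = 0) : v = 0 := by
  set μB := ballMeasure n R
  set μI := segmentMeasure L
  let w : EuclideanSpace ℝ (Fin n) × ℝ → ℝ := fun p => v ((splitLast n).symm p)
  have hvi : Integrable v (cylinderMeasure n R L) := (Lp.memLp v).integrable (by norm_num)
  have hwi : Integrable w (μB.prod μI) := by
    rw [← (measurePreserving_cylinder n R L).integrable_comp_emb (measurableEmbedding_splitLast n)]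
    simpa [w, Function.comp_def] using hvi
  have hslice : ∀ k, ∀ᵐ x ∂μB, ∫ t, w (x, t) * modeFn bc L k t ∂μI = 0 := by
    intro k
    obtain ⟨C, hC⟩ := (isCompact_Icc (a := 0) (b := L)).exists_bound_of_continuousOn
      (continuous_modeFn bc L k).continuousOn
    have hint : Integrable (fun p => w p * modeFn bc L k p.2) (μB.prod μI) := by
      refine hwi.mul_bdd (c := C)
        ((continuous_modeFn bc L k).comp continuous_snd).aestronglyMeasurable ?_
      have := Measure.quasiMeasurePreserving_snd (μ := μB) (ν := μI) |>.ae
        (ae_restrict_mem (segment L).isOpen.measurableSet)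
      filter_upwards [this] with p hp
      exact hC p.2 (Set.Ioo_subset_Icc_self hp)
    refine eq_zero_of_forall_integral_test (μ := volume) (Ω := ball n R)
      (locallyIntegrableOn_of_locallyIntegrable_restrict
        hint.integral_prod_left.locallyIntegrable) fun φ => ?_
    have h1 : (inner ℝ v (tensorL n R L ℝ (mode bc L k) (testFn φ)) : ℝ) = 0 := by
      rw [← inner_sliceL_left, h k, inner_zero_left]
    rw [L2.inner_def] at h1
    have hae : (fun z => inner ℝ (v z) (tensorL n R L ℝ (mode bc L k) (testFn φ) z))
        =ᵐ[cylinderMeasure n R L]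
        fun z => φ (initL n z) * (v z * modeFn bc L k (lastL n z)) := by
      filter_upwards [coeFn_tensorL (mode bc L k) (testFn φ),
        (quasiMeasurePreserving_lastL n R L).ae_eq_comp (coeFn_seg _ (continuous_modeFn bc L k)),
        (quasiMeasurePreserving_initL n R L).ae_eq_comp (memLp_testFunction φ _).coeFn_toLp]
        with z h1 h2 h3
      simp only [Function.comp_apply] at h2 h3
      rw [h1, mode, h2, testFn, h3]
      simp
      ring
    rw [integral_congr_ae hae, integral_cylinder _ ((L2.integrable_inner _ _).congr hae)] at h1
    rw [← h1]
    refine integral_congr_ae (.of_forall fun x => ?_)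
    simp only [lastL_symm, initL_symm]
    rw [integral_const_mul, mul_comm]
  have hw : ∀ᵐ x ∂μB, (fun t => w (x, t)) =ᵐ[μI] 0 := by
    filter_upwards [ae_all_iff.2 hslice, hwi.prod_right_ae] with x h1 h2
    exact ae_eq_zero_of_forall_integral_modeFn bc hL h2 h1
  have hw0 : w =ᵐ[μB.prod μI] 0 := by
    have h0 : ∫⁻ p, ‖w p‖ₑ ∂(μB.prod μI) = 0 := by
      rw [lintegral_prod _ hwi.aestronglyMeasurable.enorm]
      refine (lintegral_congr_ae ?_).trans lintegral_zero
      filter_upwards [hw] with x hx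
      refine (lintegral_congr_ae ?_).trans lintegral_zero
      filter_upwards [hx] with t ht
      simp [ht]
    filter_upwards [(lintegral_eq_zero_iff' hwi.aestronglyMeasurable.enorm).1 h0] with p hp
    simpa using hp
  refine Lp.ext (.trans ?_ (Lp.coeFn_zero _ _ _).symm)
  have := (measurePreserving_cylinder n R L).quasiMeasurePreserving.ae_eq_comp hw0
  filter_upwards [this] with z hz
  simpa [w] using hz

end Eigenspaces

/-- Stated for cardinal ranks, since the eigenspaces are not known to be finite-dimensional. -/
theorem rank_pi_fin (N : ℕ) (M : Fin N → Type) [∀ k, AddCommGroup (M k)]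
    [∀ k, Module ℝ (M k)] : Module.rank ℝ (∀ k, M k) = ∑ k, Module.rank ℝ (M k) := by
  induction N with
  | zero => simp
  | succ N ih =>
    rw [Fin.sum_univ_succ, ← ih, ← (Fin.consLinearEquiv ℝ M).rank_eq, rank_prod']

/-! ### Multiplicities and the counting function of the cylinder -/

section Multiplicity

variable {n : ℕ} {R L : ℝ} {bc : BoundaryCondition}

theorem freq_nonneg (bc : BoundaryCondition) (hL : 0 < L) (k : ℕ) : 0 ≤ freq bc L k := by
  unfold freq
  positivity

theorem le_freq (bc : BoundaryCondition) (hL : 0 < L) (k : ℕ) : k * Real.pi / L ≤ freq bc L k := by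
  unfold freq
  have : (k : ℝ) ≤ bc.index k := by
    cases bc <;> simp [BoundaryCondition.index]
  gcongr

theorem eventually_lt_freq_sq (bc : BoundaryCondition) (hL : 0 < L) (Λ : ℝ) :
    ∃ N, ∀ k, N ≤ k → Λ < freq bc L k ^ 2 := by
  obtain ⟨N, hN⟩ := exists_nat_gt ((|Λ| + 1) * L / Real.pi)
  refine ⟨N, fun k hk => ?_⟩
  have h1 : |Λ| + 1 < freq bc L k := by
    refine lt_of_lt_of_le ?_ (le_freq bc hL k)
    rw [div_lt_iff₀ Real.pi_pos] at hN
    rw [lt_div_iff₀ hL]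
    refine hN.trans_le ?_
    have : (N : ℝ) ≤ k := by exact_mod_cast hk
    gcongr
  have := le_abs_self Λ
  have := abs_nonneg Λ
  nlinarith

variable (n R bc) in
/-- The map `(u_k) ↦ ∑ e_k ⊗ u_k` from eigenspaces of the ball to an eigenspace of the cylinder. -/
def sumTensor (hL : 0 < L) (Λ : ℝ) (N : ℕ) :
    (∀ k : Fin N, eigenspace bc (ball n R) (Λ - freq bc L k ^ 2)) →ₗ[ℝ]
      eigenspace bc (cylinder n R L) Λ where
  toFun u := ⟨∑ k : Fin N, tensorL n R L ℝ (mode bc L k) (u k), Submodule.sum_mem _ fun k _ => by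
    simpa using tensorL_mode_mem_eigenspace hL k (u k).2⟩
  map_add' u w := by
    ext1
    simp [Finset.sum_add_distrib]
  map_smul' c u := by
    ext1
    simp [Finset.smul_sum]

theorem coe_sumTensor (hL : 0 < L) (Λ : ℝ) (N : ℕ)
    (u : ∀ k : Fin N, eigenspace bc (ball n R) (Λ - freq bc L k ^ 2)) :
    (sumTensor n R bc hL Λ N u : L2 (cylinder n R L)) =
      ∑ k : Fin N, tensorL n R L ℝ (mode bc L k) (u k : L2 (ball n R)) := rfl

theorem sliceL_sum_tensorL (hL : 0 < L) (N : ℕ) (u : Fin N → L2 (ball n R)) (j : ℕ) :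
    sliceL (mode bc L j) (∑ k : Fin N, tensorL n R L ℝ (mode bc L k) (u k)) =
      if h : j < N then ‖mode bc L j‖ ^ 2 • u ⟨j, h⟩ else 0 := by
  rw [map_sum]
  split_ifs with h
  · rw [Finset.sum_eq_single ⟨j, h⟩]
    · rw [sliceL_tensorL, real_inner_self_eq_norm_sq]
    · intro k _ hk
      rw [sliceL_tensorL, inner_mode_eq_zero bc hL, zero_smul]
      exact fun h' => hk (Fin.ext h')
    · simp
  · refine Finset.sum_eq_zero fun k _ => ?_
    rw [sliceL_tensorL, inner_mode_eq_zero bc hL, zero_smul]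
    have := k.2
    omega

theorem sumTensor_injective (hL : 0 < L) (Λ : ℝ) (N : ℕ) :
    Function.Injective (sumTensor n R bc hL Λ N) := by
  rw [injective_iff_map_eq_zero]
  intro u hu
  ext1 k
  have h1 : (sumTensor n R bc hL Λ N u : L2 (cylinder n R L)) = 0 := by rw [hu]; rfl
  have h2 := sliceL_sum_tensorL (bc := bc) hL N (fun k => (u k : L2 (ball n R))) k
  rw [← coe_sumTensor hL, h1, map_zero, dif_pos k.2] at h2
  have h3 : ‖mode bc L k‖ ^ 2 ≠ 0 := by
    simpa using mode_ne_zero bc hL k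
  exact Subtype.ext ((smul_eq_zero.1 h2.symm).resolve_left h3)

/-- The candidate preimage consists of the normalised slices of `v`. The difference has zero slices:
for j < N by orthogonality, and for j ≥ N because the slice of `v` solves an eigenvalue equation
with negative eigenvalue. -/
theorem sumTensor_surjective (hL : 0 < L) {Λ : ℝ} {N : ℕ}
    (hN : ∀ k, N ≤ k → Λ < freq bc L k ^ 2) :
    Function.Surjective (sumTensor n R bc hL Λ N) := by
  rintro ⟨v, hv⟩
  have hs : ∀ k, sliceL (mode bc L k) v ∈ eigenspace bc (ball n R) (Λ - freq bc L k ^ 2) :=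
    fun k => sliceL_mode_mem_eigenspace hL k hv
  refine ⟨fun k => ⟨(‖mode bc L k‖ ^ 2)⁻¹ • sliceL (mode bc L k) v,
    Submodule.smul_mem _ _ (hs k)⟩, Subtype.ext ?_⟩
  rw [coe_sumTensor, ← sub_eq_zero]
  refine eq_zero_of_forall_sliceL_mode (bc := bc) hL fun j => ?_
  rw [map_sub, sliceL_sum_tensorL hL]
  split_ifs with h
  · have h3 : ‖mode bc L j‖ ^ 2 ≠ 0 := by
      simpa using mode_ne_zero bc hL j
    rw [smul_smul, mul_inv_cancel₀ h3, one_smul, sub_self]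
  · have h4 := hs j
    rw [eigenspace_eq_bot_of_neg _ (sub_neg.2 (hN j (not_lt.1 h))), Submodule.mem_bot] at h4
    rw [h4, sub_zero]

theorem multiplicity_eq_zero_of_neg {m : ℕ} (Ω : Opens (EuclideanSpace ℝ (Fin m))) {Λ : ℝ}
    (hΛ : Λ < 0) : multiplicity bc Ω Λ = 0 := by
  rw [multiplicity, eigenspace_eq_bot_of_neg Ω hΛ]
  simp

theorem multiplicity_cylinder (hL : 0 < L) (Λ : ℝ) :
    (multiplicity bc (cylinder n R L) Λ : ℝ≥0∞) =
      ∑' k, (multiplicity bc (ball n R) (Λ - freq bc L k ^ 2) : ℝ≥0∞) := by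
  obtain ⟨N, hN⟩ := eventually_lt_freq_sq bc hL Λ
  rw [tsum_eq_sum (s := Finset.range N), Finset.sum_range]
  · have h1 := (LinearEquiv.ofBijective (sumTensor n R bc hL Λ N)
      ⟨sumTensor_injective hL Λ N, sumTensor_surjective hL hN⟩).rank_eq
    rw [rank_pi_fin N fun k => eigenspace bc (ball n R) (Λ - freq bc L k ^ 2)] at h1
    simp only [multiplicity]
    rw [← h1, map_sum]
    exact map_sum ENat.toENNRealRingHom _ _
  · intro k hk
    rw [multiplicity_eq_zero_of_neg _ (sub_neg.2 (hN k (by simpa using hk)))]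
    simp

/-- For Λ < 0 the root is 0 by convention, so these Λ are summed on both sides. A sum over all of ℝ
can be exchanged and translated freely. -/
theorem counting_eq_tsum_indicator {m : ℕ} (Ω : Opens (EuclideanSpace ℝ (Fin m))) {μ : ℝ}
    (hμ : 0 ≤ μ) : counting bc Ω μ =
      ∑' Λ : ℝ, (Set.Iic (μ ^ 2)).indicator (fun Λ => (multiplicity bc Ω Λ : ℝ≥0∞)) Λ := by
  have h : {Λ : ℝ | √Λ ≤ μ} = Set.Iic (μ ^ 2) := by
    ext Λ
    simp [Real.sqrt_le_iff, hμ]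
  rw [← h, ← tsum_subtype]
  rfl

/-- Exchange the sums over Λ and k, then translate Λ by freq². The case distinction matters: beyond
freq = μ the root would be 0, and the count at 0 may be nonzero, as constants show for Neumann. -/
theorem counting_cylinder (hL : 0 < L) {μ : ℝ} (hμ : 0 ≤ μ) :
    counting bc (cylinder n R L) μ =
      ∑' k, if freq bc L k ≤ μ then counting bc (ball n R) √(μ ^ 2 - freq bc L k ^ 2) else 0 := by
  rw [counting_eq_tsum_indicator _ hμ]
  have h1 : ∀ Λ : ℝ, (Set.Iic (μ ^ 2)).indicator
      (fun Λ => (multiplicity bc (cylinder n R L) Λ : ℝ≥0∞)) Λ =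
      ∑' k, (Set.Iic (μ ^ 2)).indicator
        (fun Λ => (multiplicity bc (ball n R) (Λ - freq bc L k ^ 2) : ℝ≥0∞)) Λ := by
    intro Λ
    by_cases h : Λ ∈ Set.Iic (μ ^ 2)
    · simp only [Set.indicator_of_mem h]
      exact multiplicity_cylinder hL Λ
    · simp [Set.indicator_of_notMem h]
  simp only [h1]
  rw [ENNReal.tsum_comm]
  refine tsum_congr fun k => ?_
  have hk := freq_nonneg bc hL k
  rw [← (Equiv.addRight (freq bc L k ^ 2)).tsum_eq]
  have h2 : ∀ Λ : ℝ, (Set.Iic (μ ^ 2)).indicator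
      (fun Λ => (multiplicity bc (ball n R) (Λ - freq bc L k ^ 2) : ℝ≥0∞))
        (Equiv.addRight (freq bc L k ^ 2) Λ) =
      (Set.Iic (μ ^ 2 - freq bc L k ^ 2)).indicator
        (fun Λ => (multiplicity bc (ball n R) Λ : ℝ≥0∞)) Λ := by
    intro Λ
    simp only [Set.indicator, Set.mem_Iic, Equiv.coe_addRight, le_sub_iff_add_le,
      add_sub_cancel_right]
  simp only [h2]
  split_ifs with h
  · have h3 : 0 ≤ μ ^ 2 - freq bc L k ^ 2 := sub_nonneg.2 (pow_le_pow_left₀ hk h 2)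
    rw [counting_eq_tsum_indicator _ (Real.sqrt_nonneg _), Real.sq_sqrt h3]
  · rw [ENNReal.tsum_eq_zero]
    intro Λ
    rw [Set.indicator_apply_eq_zero]
    intro hΛ
    have h4 : μ ^ 2 - freq bc L k ^ 2 < 0 :=
      sub_neg.2 (pow_lt_pow_left₀ (not_le.1 h) hμ two_ne_zero)
    rw [multiplicity_eq_zero_of_neg _ (lt_of_le_of_lt hΛ h4)]
    simp

theorem counting_mono {m : ℕ} (Ω : Opens (EuclideanSpace ℝ (Fin m))) {μ ν : ℝ} (hμ : 0 ≤ μ)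
    (h : μ ≤ ν) : counting bc Ω μ ≤ counting bc Ω ν := by
  rw [counting_eq_tsum_indicator _ hμ, counting_eq_tsum_indicator _ (hμ.trans h)]
  refine ENNReal.tsum_le_tsum fun Λ => Set.indicator_le_indicator_of_subset ?_ (by simp) Λ
  exact Set.Iic_subset_Iic.2 (pow_le_pow_left₀ hμ h 2)

end Multiplicity

/-! ### Hausdorff measure under Lipschitz and expanding maps -/

section Lipschitz

variable {X Y : Type*} [MetricSpace X] [MeasurableSpace X] [BorelSpace X]
  [MetricSpace Y] [MeasurableSpace Y] [BorelSpace Y]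

open scoped NNReal

theorem euclideanHausdorffMeasure_image_le {K : ℝ≥0} {f : X → Y} {s : Set X}
    (h : LipschitzOnWith K f s) (d : ℕ) : μHE[d] (f '' s) ≤ (K : ℝ≥0∞) ^ d * μHE[d] s := by
  simp only [Measure.euclideanHausdorffMeasure_def, Measure.smul_apply, ENNReal.smul_def,
    smul_eq_mul]
  rw [mul_left_comm]
  gcongr
  simpa using h.hausdorffMeasure_image_le (d := d) (Nat.cast_nonneg d)

theorem euclideanHausdorffMeasure_le_image {K : ℝ≥0} {f : X → Y} {s : Set X}
    (h : ∀ x ∈ s, ∀ y ∈ s, dist x y ≤ K * dist (f x) (f y)) (d : ℕ) :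
    μHE[d] s ≤ (K : ℝ≥0∞) ^ d * μHE[d] (f '' s) := by
  rcases isEmpty_or_nonempty X with hX | hX
  · simp [Set.eq_empty_of_isEmpty s]
  have hinj : Set.InjOn f s := fun x hx y hy hxy => by
    have := h x hx y hy
    rw [hxy, dist_self, mul_zero] at this
    exact dist_le_zero.1 this
  have hl := hinj.leftInvOn_invFunOn
  have hlip : LipschitzOnWith K (Function.invFunOn f s) (f '' s) := by
    refine LipschitzOnWith.of_dist_le_mul ?_
    rintro _ ⟨x, hx, rfl⟩ _ ⟨y, hy, rfl⟩
    rw [hl hx, hl hy]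
    exact h x hx y hy
  have h1 := euclideanHausdorffMeasure_image_le hlip d
  rwa [hl.image_image] at h1

end Lipschitz

/-! ### Hausdorff measure of sphere × interval -/

section Sphere

variable {m : ℕ} {R : ℝ}

/-- Orthogonal projection from `ℝᵐ⁺¹` to the hyperplane orthogonal to a vector, in coordinates. -/
theorem exists_projection {p : EuclideanSpace ℝ (Fin (m + 1))} (hp : p ≠ 0) :
    ∃ φ : EuclideanSpace ℝ (Fin (m + 1)) →L[ℝ] EuclideanSpace ℝ (Fin m),
      ∀ w, ‖φ w‖ ^ 2 = ‖w‖ ^ 2 - (inner ℝ p w / ‖p‖) ^ 2 := by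
  have : Fact (Module.finrank ℝ (EuclideanSpace ℝ (Fin (m + 1))) = m + 1) := ⟨by simp⟩
  let b := OrthonormalBasis.fromOrthogonalSpanSingleton (𝕜 := ℝ) m hp
  refine ⟨b.repr.toContinuousLinearEquiv.toContinuousLinearMap.comp
    (ℝ ∙ p)ᗮ.orthogonalProjectionOnto, fun w => ?_⟩
  have h1 := Submodule.norm_sq_eq_add_norm_sq_starProjection w (ℝ ∙ p)
  have h2 := Submodule.starProjection_singleton (𝕜 := ℝ) (v := p) w
  have h3 : ‖(ℝ ∙ p).starProjection w‖ ^ 2 = (inner ℝ p w / ‖p‖) ^ 2 := by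
    rw [h2, norm_smul, mul_pow]
    have : ‖p‖ ≠ 0 := norm_ne_zero_iff.2 hp
    simp only [RCLike.ofReal_real_eq_id, id, Real.norm_eq_abs, sq_abs]
    field_simp
  have h4 : ‖(b.repr.toContinuousLinearEquiv.toContinuousLinearMap.comp
      (ℝ ∙ p)ᗮ.orthogonalProjectionOnto) w‖ = ‖(ℝ ∙ p)ᗮ.starProjection w‖ := by
    exact (b.repr.norm_map _).trans (Submodule.norm_coe _).symm
  rw [h4, ← h3]
  linarith

/-- Project orthogonally to a point p of P. For x, y on the sphere x - y is orthogonal to x + y, so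
⟨p, x - y⟩ = ⟨p - (x + y)/2, x - y⟩, which is small against R‖x - y‖ when x and y are close to p.
The choice η = R√(1 - c²) yields exactly the constant c. -/
theorem exists_chart (hR : 0 < R) {c : ℝ} (hc0 : 0 < c) (hc : c < 1) : ∃ η > 0,
    ∀ P : Set (EuclideanSpace ℝ (Fin (m + 1))), P ⊆ Metric.sphere 0 R →
      (∀ x ∈ P, ∀ y ∈ P, dist x y ≤ η) →
      ∃ φ : EuclideanSpace ℝ (Fin (m + 1)) →L[ℝ] EuclideanSpace ℝ (Fin m),
        (∀ w, ‖φ w‖ ^ 2 ≤ ‖w‖ ^ 2) ∧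
        ∀ x ∈ P, ∀ y ∈ P, c ^ 2 * ‖x - y‖ ^ 2 ≤ ‖φ (x - y)‖ ^ 2 := by
  have hc2 : 0 < 1 - c ^ 2 := by nlinarith
  refine ⟨R * √(1 - c ^ 2), by positivity, fun P hP hη => ?_⟩
  rcases P.eq_empty_or_nonempty with rfl | ⟨p, hp⟩
  · exact ⟨0, fun w => by simp, by simp⟩
  have hnorm : ∀ x ∈ P, ‖x‖ = R := fun x hx => by simpa using hP hx
  have hp0 : p ≠ 0 := fun h => by
    have := hnorm p hp
    rw [h, norm_zero] at this
    exact hR.ne this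
  obtain ⟨φ, hφ⟩ := exists_projection hp0
  refine ⟨φ, fun w => by rw [hφ]; linarith [sq_nonneg (inner ℝ p w / ‖p‖)], fun x hx y hy => ?_⟩
  rw [hφ, hnorm p hp]
  have h0 : (inner ℝ p (x - y) : ℝ) = inner ℝ (p - (1 / 2 : ℝ) • (x + y)) (x - y) := by
    rw [inner_sub_left, real_inner_smul_left]
    have h1 := real_inner_add_sub_eq_zero_iff x y |>.2 (by rw [hnorm x hx, hnorm y hy])
    rw [h1]
    ring
  have h1 : ‖p - (1 / 2 : ℝ) • (x + y)‖ ≤ R * √(1 - c ^ 2) := by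
    have h2 : p - (1 / 2 : ℝ) • (x + y) = (1 / 2 : ℝ) • ((p - x) + (p - y)) := by module
    rw [h2, norm_smul]
    have h3 := norm_add_le (p - x) (p - y)
    have h4 := hη p hp x hx
    have h5 := hη p hp y hy
    rw [dist_eq_norm] at h4 h5
    norm_num
    linarith
  have h2 : |(inner ℝ p (x - y) : ℝ)| ≤ R * √(1 - c ^ 2) * ‖x - y‖ := by
    rw [h0]
    exact (abs_real_inner_le_norm _ _).trans (by gcongr)
  have h3 : (inner ℝ p (x - y) / R) ^ 2 ≤ (1 - c ^ 2) * ‖x - y‖ ^ 2 := by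
    rw [div_pow, div_le_iff₀ (by positivity), ← sq_abs]
    calc |(inner ℝ p (x - y) : ℝ)| ^ 2 ≤ (R * √(1 - c ^ 2) * ‖x - y‖) ^ 2 := by gcongr
      _ = _ := by rw [mul_pow, mul_pow, Real.sq_sqrt hc2.le]; ring
  linarith

open scoped NNReal

/-- The vertical prism over a subset of `ℝⁿ`. -/
def prism {n : ℕ} (P : Set (EuclideanSpace ℝ (Fin n))) (J : Set ℝ) :
    Set (EuclideanSpace ℝ (Fin (n + 1))) := splitLast n ⁻¹' (P ×ˢ J)

theorem volume_prism {n : ℕ} (P : Set (EuclideanSpace ℝ (Fin n))) (J : Set ℝ) :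
    volume (prism P J) = volume P * volume J := by
  rw [prism, (measurePreserving_splitLast n).measure_preimage_emb (measurableEmbedding_splitLast n),
    Measure.volume_eq_prod, Measure.prod_prod]

/-- Both φ on P and φ × id on the prism are 1-Lipschitz with K-Lipschitz inverse. Their images lie
in spaces of full dimension, where Hausdorff measure is Lebesgue measure and the product formula is
available; comparison costs only powers of K. -/
theorem measure_chart_bounds {P : Set (EuclideanSpace ℝ (Fin (m + 1)))}
    {φ : EuclideanSpace ℝ (Fin (m + 1)) →L[ℝ] EuclideanSpace ℝ (Fin m)}
    (h1 : ∀ w, ‖φ w‖ ^ 2 ≤ ‖w‖ ^ 2) {K : ℝ≥0} (hK : 1 ≤ K)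
    (h2 : ∀ x ∈ P, ∀ y ∈ P, ‖x - y‖ ^ 2 ≤ K ^ 2 * ‖φ (x - y)‖ ^ 2) (J : Set ℝ) :
    μHE[m] P ≤ (K : ℝ≥0∞) ^ m * volume (φ '' P) ∧
    μHE[m + 1] (prism P J) ≤ (K : ℝ≥0∞) ^ (m + 1) * (μHE[m] P * volume J) ∧
    μHE[m] P * volume J ≤ (K : ℝ≥0∞) ^ m * μHE[m + 1] (prism P J) := by
  let Φ : EuclideanSpace ℝ (Fin (m + 2)) → EuclideanSpace ℝ (Fin (m + 1)) :=
    fun z => (splitLast m).symm (φ (initL (m + 1) z), lastL (m + 1) z)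
  have hΦ : Φ '' prism P J = prism (φ '' P) J := by
    ext z
    simp only [prism, Φ, Set.mem_image, Set.mem_preimage, Set.mem_prod]
    constructor
    · rintro ⟨w, ⟨hw1, hw2⟩, rfl⟩
      rw [ContinuousLinearEquiv.apply_symm_apply]
      exact ⟨⟨_, hw1, rfl⟩, hw2⟩
    · rintro ⟨⟨x, hx, hxz⟩, hz⟩
      refine ⟨(splitLast (m + 1)).symm (x, (splitLast m z).2), ?_, ?_⟩
      · rw [ContinuousLinearEquiv.apply_symm_apply]
        exact ⟨hx, hz⟩
      · rw [initL_symm, lastL_symm, hxz, Prod.mk.eta, ContinuousLinearEquiv.symm_apply_apply]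
  have hΦd : ∀ z w, dist (Φ z) (Φ w) ^ 2 =
      ‖φ (initL (m + 1) z - initL (m + 1) w)‖ ^ 2 + (lastL (m + 1) z - lastL (m + 1) w) ^ 2 := by
    intro z w
    rw [dist_eq_norm, norm_sq_eq_splitLast, ← map_sub, ContinuousLinearEquiv.apply_symm_apply,
      Prod.mk_sub_mk, ← map_sub]
  have hd : ∀ z w : EuclideanSpace ℝ (Fin (m + 2)), dist z w ^ 2 =
      ‖initL (m + 1) z - initL (m + 1) w‖ ^ 2 + (lastL (m + 1) z - lastL (m + 1) w) ^ 2 := by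
    intro z w
    rw [dist_eq_norm, norm_sq_eq_splitLast, splitLast_eq, map_sub, map_sub]
  have hlip1 : LipschitzOnWith 1 φ P := by
    refine LipschitzOnWith.of_dist_le_mul fun x _ y _ => ?_
    rw [NNReal.coe_one, one_mul, dist_eq_norm, dist_eq_norm, ← map_sub]
    exact (sq_le_sq₀ (norm_nonneg _) (norm_nonneg _)).1 (h1 _)
  have hlip2 : LipschitzOnWith 1 Φ (prism P J) := by
    refine LipschitzOnWith.of_dist_le_mul fun z _ w _ => ?_
    rw [NNReal.coe_one, one_mul, ← sq_le_sq₀ dist_nonneg dist_nonneg, hΦd, hd]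
    linarith [h1 (initL (m + 1) z - initL (m + 1) w)]
  have hK2 : (1 : ℝ) ≤ K ^ 2 := by
    have : (1 : ℝ) ≤ K := by exact_mod_cast hK
    nlinarith
  have hanti1 : ∀ x ∈ P, ∀ y ∈ P, dist x y ≤ K * dist (φ x) (φ y) := by
    intro x hx y hy
    rw [← sq_le_sq₀ dist_nonneg (by positivity), mul_pow, dist_eq_norm, dist_eq_norm, ← map_sub]
    exact h2 x hx y hy
  have hanti2 : ∀ z ∈ prism P J, ∀ w ∈ prism P J, dist z w ≤ K * dist (Φ z) (Φ w) := by
    intro z hz w hw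
    rw [← sq_le_sq₀ dist_nonneg (by positivity), mul_pow, hd, hΦd, mul_add]
    have h3 := h2 _ hz.1 _ hw.1
    have h4 : (lastL (m + 1) z - lastL (m + 1) w) ^ 2 ≤
        K ^ 2 * (lastL (m + 1) z - lastL (m + 1) w) ^ 2 :=
      le_mul_of_one_le_left (sq_nonneg _) hK2
    exact add_le_add h3 h4
  have e1 := euclideanHausdorffMeasure_image_le hlip1 m
  have e2 := euclideanHausdorffMeasure_image_le hlip2 (m + 1)
  have e3 := euclideanHausdorffMeasure_le_image hanti1 m
  have e4 := euclideanHausdorffMeasure_le_image hanti2 (m + 1)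
  rw [EuclideanSpace.euclideanHausdorffMeasure_eq_volume] at e1 e2 e3 e4
  rw [hΦ, volume_prism] at e2 e4
  simp only [ENNReal.coe_one, one_pow, one_mul] at e1 e2
  refine ⟨e3, e4.trans (by gcongr), ?_⟩
  calc μHE[m] P * volume J ≤ (K : ℝ≥0∞) ^ m * volume (φ '' P) * volume J := by gcongr
    _ ≤ (K : ℝ≥0∞) ^ m * μHE[m + 1] (prism P J) := by
      rw [mul_assoc]
      gcongr

theorem exists_chart_bounds (hR : 0 < R) {K : ℝ≥0} (hK : 1 < K) : ∃ η > 0,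
    ∀ P : Set (EuclideanSpace ℝ (Fin (m + 1))), P ⊆ Metric.sphere 0 R →
      (∀ x ∈ P, ∀ y ∈ P, dist x y ≤ η) → ∀ J : Set ℝ,
      μHE[m] P < ⊤ ∧
      μHE[m + 1] (prism P J) ≤ (K : ℝ≥0∞) ^ (m + 1) * (μHE[m] P * volume J) ∧
      μHE[m] P * volume J ≤ (K : ℝ≥0∞) ^ m * μHE[m + 1] (prism P J) := by
  have hK1 : (1 : ℝ) < K := by exact_mod_cast hK
  obtain ⟨η, hη, h⟩ := exists_chart (m := m) hR (c := (K : ℝ)⁻¹) (by positivity)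
    (inv_lt_one_of_one_lt₀ hK1)
  refine ⟨η, hη, fun P hP hPη J => ?_⟩
  obtain ⟨φ, h1, h2⟩ := h P hP hPη
  have h3 := measure_chart_bounds h1 hK.le (P := P) (fun x hx y hy => ?_) J
  · refine ⟨h3.1.trans_lt (ENNReal.mul_lt_top (ENNReal.pow_lt_top ENNReal.coe_lt_top) ?_), h3.2⟩
    refine Bornology.IsBounded.measure_lt_top ?_
    have hb : Bornology.IsBounded P := Metric.isBounded_sphere.subset hP
    exact φ.lipschitz.isBounded_image hb
  · have h4 := h2 x hx y hy
    rwa [inv_pow, inv_mul_le_iff₀ (by positivity)] at h4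

/-- Compactness, since small pieces of the sphere have finite measure. -/
theorem euclideanHausdorffMeasure_sphere_lt_top (hR : 0 < R) :
    μHE[m] (Metric.sphere (0 : EuclideanSpace ℝ (Fin (m + 1))) R) < ⊤ := by
  obtain ⟨η, hη, h⟩ := exists_chart_bounds (m := m) hR (K := 2) (by norm_num)
  refine (isCompact_sphere _ _).measure_lt_top_of_nhdsWithin fun x _ => ?_
  refine ⟨Metric.sphere 0 R ∩ Metric.ball x (η / 2),
    inter_mem_nhdsWithin _ (Metric.ball_mem_nhds x (by positivity)), ?_⟩
  refine (h _ Set.inter_subset_left (fun y hy z hz => ?_) Set.univ).1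
  have h1 := Metric.mem_ball.1 hy.2
  have h2 := Metric.mem_ball'.1 hz.2
  linarith [dist_triangle y x z]

theorem measurableSet_prism {n : ℕ} {P : Set (EuclideanSpace ℝ (Fin n))} {J : Set ℝ}
    (hP : MeasurableSet P) (hJ : MeasurableSet J) : MeasurableSet (prism P J) :=
  (measurePreserving_splitLast n).measurable (hP.prod hJ)

/-- Sum the comparison over countably many small disjoint pieces, then let K decrease to 1. -/
theorem euclideanHausdorffMeasure_prism_sphere (hR : 0 < R) {J : Set ℝ} (hJ : MeasurableSet J) :
    μHE[m + 1] (prism (Metric.sphere (0 : EuclideanSpace ℝ (Fin (m + 1))) R) J) =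
      μHE[m] (Metric.sphere (0 : EuclideanSpace ℝ (Fin (m + 1))) R) * volume J := by
  set S := Metric.sphere (0 : EuclideanSpace ℝ (Fin (m + 1))) R
  have key : ∀ K : ℝ≥0, 1 < K →
      μHE[m + 1] (prism S J) ≤ (K : ℝ≥0∞) ^ (m + 1) * (μHE[m] S * volume J) ∧
      μHE[m] S * volume J ≤ (K : ℝ≥0∞) ^ m * μHE[m + 1] (prism S J) := by
    intro K hK
    obtain ⟨η, hη, h⟩ := exists_chart_bounds (m := m) hR hK
    -- Balls of radius η/2 around a dense sequence, made disjoint, form a countable measurable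
    -- partition into sets of diameter at most η.
    let q := denseSeq (EuclideanSpace ℝ (Fin (m + 1)))
    let D := disjointed fun i => Metric.ball (q i) (η / 2)
    have hDm : ∀ i, MeasurableSet (D i) := fun i =>
      MeasurableSet.disjointed (fun _ => measurableSet_ball) i
    have hDd : Pairwise (Function.onFun Disjoint D) := disjoint_disjointed _
    have hDu : ⋃ i, D i = Set.univ := by
      rw [iUnion_disjointed, Set.eq_univ_iff_forall]
      intro x
      obtain ⟨i, hi⟩ := (denseRange_denseSeq _).exists_dist_lt x (half_pos hη)
      exact Set.mem_iUnion.2 ⟨i, hi⟩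
    have hSm : MeasurableSet S := Metric.isClosed_sphere.measurableSet
    have hp : ∀ i, _ := fun i => h (S ∩ D i) Set.inter_subset_left (fun y hy z hz => by
      have h1 := Metric.mem_ball.1 (disjointed_subset (fun i => Metric.ball (q i) (η / 2)) i hy.2)
      have h2 := Metric.mem_ball'.1 (disjointed_subset (fun i => Metric.ball (q i) (η / 2)) i hz.2)
      linarith [dist_triangle y (q i) z]) J
    have h1 : μHE[m] S = ∑' i, μHE[m] (S ∩ D i) := by
      rw [← measure_iUnion (fun i j hij => (hDd hij).mono Set.inter_subset_right
        Set.inter_subset_right) (fun i => hSm.inter (hDm i)), ← Set.inter_iUnion, hDu,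
        Set.inter_univ]
    have h2 : μHE[m + 1] (prism S J) = ∑' i, μHE[m + 1] (prism (S ∩ D i) J) := by
      rw [← measure_iUnion _ fun i => measurableSet_prism (hSm.inter (hDm i)) hJ]
      · simp only [prism]
        rw [← Set.preimage_iUnion, ← Set.iUnion_prod_const, ← Set.inter_iUnion, hDu,
          Set.inter_univ]
      · intro i j hij
        refine Disjoint.preimage _ (Set.disjoint_prod.2 (.inl ?_))
        exact (hDd hij).mono Set.inter_subset_right Set.inter_subset_right
    rw [h1, h2, ← ENNReal.tsum_mul_right, ← ENNReal.tsum_mul_left, ← ENNReal.tsum_mul_left]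
    exact ⟨ENNReal.tsum_le_tsum fun i => (hp i).2.1, ENNReal.tsum_le_tsum fun i => (hp i).2.2⟩
  have lim : ∀ (a b : ℝ≥0∞) (k : ℕ), (∀ K : ℝ≥0, 1 < K → a ≤ (K : ℝ≥0∞) ^ k * b) → a ≤ b := by
    intro a b k h
    rcases eq_or_ne b ⊤ with rfl | hb
    · exact le_top
    have h1 : Tendsto (fun K : ℝ≥0 => (K : ℝ≥0∞) ^ k * b) (nhdsWithin 1 (Set.Ioi 1)) (nhds b) := by
      have h2 : Tendsto (fun K : ℝ≥0 => (K : ℝ≥0∞) ^ k) (nhds 1) (nhds 1) := by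
        have h3 : Continuous fun K : ℝ≥0 => (K : ℝ≥0∞) ^ k :=
          (ENNReal.continuous_pow k).comp ENNReal.continuous_coe
        simpa using h3.tendsto 1
      have h4 := ENNReal.Tendsto.mul_const (b := b) h2 (.inr hb)
      rw [one_mul] at h4
      exact h4.mono_left nhdsWithin_le_nhds
    exact ge_of_tendsto h1 (by filter_upwards [self_mem_nhdsWithin] with K hK using h K hK)
  exact le_antisymm (lim _ _ _ fun K hK => (key K hK).1) (lim _ _ _ fun K hK => (key K hK).2)

end Sphere

/-! ### The surface area of the cylinder -/

section Frontier

variable {R L : ℝ}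

theorem isometry_horizontal {n : ℕ} (t : ℝ) :
    Isometry fun x : EuclideanSpace ℝ (Fin n) => (splitLast n).symm (x, t) := by
  refine Isometry.of_dist_eq fun x y => ?_
  rw [← sq_eq_sq₀ dist_nonneg dist_nonneg, dist_eq_norm, norm_sq_eq_splitLast, map_sub,
    ContinuousLinearEquiv.apply_symm_apply, ContinuousLinearEquiv.apply_symm_apply, dist_eq_norm]
  simp

theorem euclideanHausdorffMeasure_prism_singleton {n : ℕ} (P : Set (EuclideanSpace ℝ (Fin n)))
    (t : ℝ) : μHE[n] (prism P {t}) = volume P := by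
  have h : prism P {t} = (fun x => (splitLast n).symm (x, t)) '' P := by
    ext z
    simp only [prism, Set.mem_preimage, Set.mem_prod, Set.mem_singleton_iff, Set.mem_image]
    constructor
    · rintro ⟨h1, h2⟩
      refine ⟨_, h1, ?_⟩
      rw [← h2, Prod.mk.eta, ContinuousLinearEquiv.symm_apply_apply]
    · rintro ⟨x, hx, rfl⟩
      rw [ContinuousLinearEquiv.apply_symm_apply]
      exact ⟨hx, rfl⟩
  rw [h, (isometry_horizontal t).euclideanHausdorffMeasure_image,
    EuclideanSpace.euclideanHausdorffMeasure_eq_volume]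

/-- The wall is taken over the open interval and the bases are closed balls, so that the three
pieces are disjoint and their measures add. -/
theorem frontier_cylinder (n : ℕ) (hR : 0 < R) (hL : 0 < L) :
    frontier (cylinder n R L : Set (EuclideanSpace ℝ (Fin (n + 1)))) =
      prism (Metric.sphere 0 R) (Set.Ioo 0 L) ∪
        (prism (Metric.closedBall 0 R) {0} ∪ prism (Metric.closedBall 0 R) {L}) := by
  have h1 : (cylinder n R L : Set (EuclideanSpace ℝ (Fin (n + 1)))) =
      (splitLast n).toHomeomorph ⁻¹' (Metric.ball 0 R ×ˢ Set.Ioo 0 L) := rfl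
  rw [h1, ← Homeomorph.preimage_frontier, frontier_prod_eq, closure_ball _ hR.ne',
    closure_Ioo hL.ne, frontier_ball _ hR.ne', frontier_Ioo hL]
  ext z
  have h2 : (splitLast n).toHomeomorph z = splitLast n z := rfl
  simp only [prism, Set.mem_preimage, Set.mem_union, Set.mem_prod, Set.mem_insert_iff,
    Set.mem_singleton_iff, h2, Set.mem_Icc, Set.mem_Ioo]
  constructor
  · rintro (⟨h3, h4 | h4⟩ | ⟨h3, h4, h5⟩)
    · exact .inr (.inl ⟨h3, h4⟩)
    · exact .inr (.inr ⟨h3, h4⟩)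
    · rcases h4.eq_or_lt with h6 | h6
      · exact .inr (.inl ⟨Metric.sphere_subset_closedBall h3, h6.symm⟩)
      · rcases h5.eq_or_lt with h7 | h7
        · exact .inr (.inr ⟨Metric.sphere_subset_closedBall h3, h7⟩)
        · exact .inl ⟨h3, h6, h7⟩
  · rintro (⟨h3, h4, h5⟩ | ⟨h3, h4⟩ | ⟨h3, h4⟩)
    · exact .inr ⟨h3, h4.le, h5.le⟩
    · exact .inl ⟨h3, .inl h4⟩
    · exact .inl ⟨h3, .inr h4⟩

theorem euclideanHausdorffMeasure_frontier_cylinder {n : ℕ} (hn : 1 ≤ n) (hR : 0 < R)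
    (hL : 0 < L) :
    (μHE[n] : Measure (EuclideanSpace ℝ (Fin (n + 1)))).real
        (frontier (cylinder n R L : Set (EuclideanSpace ℝ (Fin (n + 1))))) =
      2 * volume.real (ball n R : Set (EuclideanSpace ℝ (Fin n))) +
        L * (μHE[n - 1] : Measure (EuclideanSpace ℝ (Fin n))).real
          (frontier (ball n R : Set (EuclideanSpace ℝ (Fin n)))) := by
  obtain ⟨m, rfl⟩ : ∃ m, n = m + 1 := ⟨n - 1, by omega⟩
  have hfb : frontier (ball (m + 1) R : Set (EuclideanSpace ℝ (Fin (m + 1)))) =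
      Metric.sphere 0 R := frontier_ball _ hR.ne'
  have hvol : volume (Metric.closedBall (0 : EuclideanSpace ℝ (Fin (m + 1))) R) =
      volume (ball (m + 1) R : Set (EuclideanSpace ℝ (Fin (m + 1)))) :=
    Measure.addHaar_closedBall_eq_addHaar_ball _ _ _
  rw [frontier_cylinder _ hR hL, hfb, measureReal_def, measure_union, measure_union,
    euclideanHausdorffMeasure_prism_sphere hR measurableSet_Ioo,
    euclideanHausdorffMeasure_prism_singleton, euclideanHausdorffMeasure_prism_singleton, hvol,
    Real.volume_Ioo, sub_zero]
  · have hb : volume (ball (m + 1) R : Set (EuclideanSpace ℝ (Fin (m + 1)))) ≠ ⊤ :=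
      Metric.isBounded_ball.measure_lt_top.ne
    have hs := (euclideanHausdorffMeasure_sphere_lt_top (m := m) hR).ne
    rw [ENNReal.toReal_add (ENNReal.mul_ne_top hs ENNReal.ofReal_ne_top)
      (ENNReal.add_ne_top.2 ⟨hb, hb⟩), ENNReal.toReal_add hb hb, ENNReal.toReal_mul,
      ENNReal.toReal_ofReal hL.le, measureReal_def, measureReal_def, Nat.add_sub_cancel]
    ring
  · refine Disjoint.preimage _ (Set.disjoint_prod.2 (.inr ?_))
    simpa using hL.ne
  · exact measurableSet_prism measurableSet_closedBall (measurableSet_singleton _)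
  · refine Set.disjoint_union_right.2 ⟨?_, ?_⟩ <;>
      exact Disjoint.preimage _ (Set.disjoint_prod.2 (.inr (by simp)))
  · exact (measurableSet_prism measurableSet_closedBall (measurableSet_singleton _)).union
      (measurableSet_prism measurableSet_closedBall (measurableSet_singleton _))

end Frontier

/-! ### Recursion for the volume of the unit ball -/

section UnitBall

/-- The integral `∫₀¹ (1 - t²)^(n/2) dt`. -/
def semicircleIntegral (n : ℕ) : ℝ := ∫ t in (0 : ℝ)..1, √(1 - t ^ 2) ^ n

theorem continuous_sqrt_pow (c : ℝ) (n : ℕ) : Continuous fun t : ℝ => √(c - t ^ 2) ^ n := by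
  fun_prop

/-- In dimension 0 this fails for |t| ≥ 1: the section is empty while the zeroth power is 1. -/
theorem volume_ball_section {n : ℕ} (hn : 1 ≤ n) (t : ℝ) :
    volume ((fun x : EuclideanSpace ℝ (Fin n) => (x, t)) ⁻¹'
      {p : EuclideanSpace ℝ (Fin n) × ℝ | ‖p.1‖ ^ 2 + p.2 ^ 2 < 1}) =
      ENNReal.ofReal (√(1 - t ^ 2) ^ n) *
        volume (Metric.ball (0 : EuclideanSpace ℝ (Fin n)) 1) := by
  have : Nonempty (Fin n) := ⟨⟨0, hn⟩⟩
  have h : (fun x : EuclideanSpace ℝ (Fin n) => (x, t)) ⁻¹'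
      {p : EuclideanSpace ℝ (Fin n) × ℝ | ‖p.1‖ ^ 2 + p.2 ^ 2 < 1} =
      Metric.ball 0 √(1 - t ^ 2) := by
    ext x
    simp only [Set.mem_preimage, Set.mem_ofPred_eq, mem_ball_zero_iff,
      Real.lt_sqrt (norm_nonneg x)]
    exact lt_sub_iff_add_lt.symm
  rw [h, Measure.addHaar_ball _ _ (Real.sqrt_nonneg _)]
  simp

theorem integral_sqrt_pow {n : ℕ} (hn : 1 ≤ n) :
    ∫ t : ℝ, √(1 - t ^ 2) ^ n = 2 * semicircleIntegral n := by
  have h1 := integral_comp_abs (f := fun t : ℝ => √(1 - t ^ 2) ^ n)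
  simp only [sq_abs] at h1
  rw [h1, semicircleIntegral, intervalIntegral.integral_of_le zero_le_one]
  congr 1
  refine setIntegral_eq_of_subset_of_forall_sdiff_eq_zero measurableSet_Ioi
    (fun t ht => ht.1) fun t ht => ?_
  have h2 : 1 < t := by
    by_contra! h
    exact ht.2 ⟨ht.1, h⟩
  rw [Real.sqrt_eq_zero_of_nonpos (by nlinarith), zero_pow (by omega)]

/-- Slicing by the last coordinate. This identifies the integrals approximated by the Riemann sums
with the Weyl constants one dimension higher. -/
theorem unitBallVolume_succ {n : ℕ} (hn : 1 ≤ n) :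
    unitBallVolume (n + 1) = 2 * semicircleIntegral n * unitBallVolume n := by
  have h1 : Metric.ball (0 : EuclideanSpace ℝ (Fin (n + 1))) 1 = splitLast n ⁻¹'
      {p : EuclideanSpace ℝ (Fin n) × ℝ | ‖p.1‖ ^ 2 + p.2 ^ 2 < 1} := by
    ext z
    rw [mem_ball_zero_iff, Set.mem_preimage, Set.mem_ofPred_eq, ← norm_sq_eq_splitLast,
      sq_lt_one_iff₀ (norm_nonneg _)]
  have hm : MeasurableSet {p : EuclideanSpace ℝ (Fin n) × ℝ | ‖p.1‖ ^ 2 + p.2 ^ 2 < 1} :=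
    (isOpen_lt (by fun_prop) continuous_const).measurableSet
  rw [unitBallVolume, measureReal_def, h1,
    (measurePreserving_splitLast n).measure_preimage hm.nullMeasurableSet, Measure.volume_eq_prod,
    Measure.prod_apply_symm hm]
  simp only [volume_ball_section hn]
  rw [lintegral_mul_const _ (by fun_prop), ENNReal.toReal_mul, ← integral_sqrt_pow hn,
    integral_eq_lintegral_of_nonneg_ae (.of_forall fun t => by positivity)
      (continuous_sqrt_pow 1 n).aestronglyMeasurable]
  rfl

theorem integral_sqrt_sub_pow {μ : ℝ} (hμ : 0 ≤ μ) (n : ℕ) :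
    ∫ t in (0 : ℝ)..μ, √(μ ^ 2 - t ^ 2) ^ n = μ ^ (n + 1) * semicircleIntegral n := by
  have h := intervalIntegral.smul_integral_comp_mul_left (a := 0) (b := 1)
    (fun t => √(μ ^ 2 - t ^ 2) ^ n) μ
  have h2 : ∀ t, √(μ ^ 2 - (μ * t) ^ 2) ^ n = μ ^ n * √(1 ^ 2 - t ^ 2) ^ n := fun t => by
    rw [← mul_pow]
    congr 1
    rw [show μ ^ 2 - (μ * t) ^ 2 = μ ^ 2 * (1 ^ 2 - t ^ 2) by ring, Real.sqrt_mul (sq_nonneg _),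
      Real.sqrt_sq hμ]
  simp only [h2, intervalIntegral.integral_const_mul, mul_zero, mul_one, smul_eq_mul] at h
  rw [← h, semicircleIntegral, pow_succ' μ n, mul_assoc]
  simp only [one_pow]

end UnitBall

/-! ### Riemann and trapezoid sums of (μ² - t²)^(n/2) -/

section RiemannSums

/-- The graph lies between the lines through (a, f a) with slopes m and M, so trapezoid and integral
both lie between h f(a) + m h²/2 and h f(a) + M h²/2. -/
theorem abs_trapezoid_sub_integral_le {f : ℝ → ℝ} (hf : Continuous f) {a h m M : ℝ} (hh : 0 ≤ h)
    (hm : ∀ s ∈ Set.Icc a (a + h), m * (s - a) ≤ f s - f a)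
    (hM : ∀ s ∈ Set.Icc a (a + h), f s - f a ≤ M * (s - a)) :
    |h * ((f a + f (a + h)) / 2) - ∫ s in a..(a + h), f s| ≤ (M - m) * h ^ 2 / 2 := by
  have hab : a ≤ a + h := by linarith
  have hlin : ∀ c : ℝ, ∫ s in a..(a + h), (f a + c * (s - a)) = h * f a + c * h ^ 2 / 2 := by
    intro c
    rw [intervalIntegral.integral_add (by simp)
      (Continuous.intervalIntegrable (by fun_prop) _ _), intervalIntegral.integral_const_mul,
      intervalIntegral.integral_comp_sub_right (fun s => s)]
    simp
    ring
  have h1 : h * f a + m * h ^ 2 / 2 ≤ ∫ s in a..(a + h), f s := by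
    rw [← hlin]
    refine intervalIntegral.integral_mono_on hab (Continuous.intervalIntegrable (by fun_prop) _ _)
      (hf.intervalIntegrable _ _) fun s hs => ?_
    linarith [hm s hs]
  have h2 : ∫ s in a..(a + h), f s ≤ h * f a + M * h ^ 2 / 2 := by
    rw [← hlin]
    refine intervalIntegral.integral_mono_on hab (hf.intervalIntegrable _ _)
      (Continuous.intervalIntegrable (by fun_prop) _ _) fun s hs => ?_
    linarith [hM s hs]
  have h3 := hm (a + h) ⟨hab, le_rfl⟩
  have h4 := hM (a + h) ⟨hab, le_rfl⟩
  rw [add_sub_cancel_left] at h3 h4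
  have h5 := mul_le_mul_of_nonneg_left h3 hh
  have h6 := mul_le_mul_of_nonneg_left h4 hh
  rw [abs_le]
  constructor <;> nlinarith

theorem abs_sum_sub_integral_le {f : ℝ → ℝ} (hf : Continuous f) (h : ℝ) (K : ℕ) (c e : ℕ → ℝ)
    (hc : ∀ k < K, |c k - ∫ s in (k * h)..(k * h + h), f s| ≤ e k) :
    |∑ k ∈ Finset.range K, c k - ∫ s in 0..(K * h), f s| ≤ ∑ k ∈ Finset.range K, e k := by
  have h1 := intervalIntegral.sum_integral_adjacent_intervals (a := fun k : ℕ => k * h) (n := K)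
    (f := f) (μ := volume) fun k _ => hf.intervalIntegrable _ _
  have h2 : ∀ k : ℕ, ((k + 1 : ℕ) : ℝ) * h = k * h + h := fun k => by push_cast; ring
  simp only [h2, Nat.cast_zero, zero_mul] at h1
  rw [← h1, ← Finset.sum_sub_distrib]
  refine (Finset.abs_sum_le_sum_abs _ _).trans (Finset.sum_le_sum fun k hk => ?_)
  exact hc k (Finset.mem_range.1 hk)

variable {μ h : ℝ} {K : ℕ}

theorem sqrt_pow_anti (n : ℕ) {a b : ℝ} (ha : 0 ≤ a) (hab : a ≤ b) :
    √(μ ^ 2 - b ^ 2) ^ n ≤ √(μ ^ 2 - a ^ 2) ^ n := by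
  gcongr

theorem sqrt_pow_le (hμ : 0 ≤ μ) (n : ℕ) (a : ℝ) : √(μ ^ 2 - a ^ 2) ^ n ≤ μ ^ n := by
  refine pow_le_pow_left₀ (Real.sqrt_nonneg _) (Real.sqrt_le_iff.2 ⟨hμ, ?_⟩) n
  linarith [sq_nonneg a]

theorem hasDerivAt_sqrt_pow (n : ℕ) {t : ℝ} (ht : 0 < μ ^ 2 - t ^ 2) :
    HasDerivAt (fun t => √(μ ^ 2 - t ^ 2) ^ (n + 2))
      (-((n + 2) * (t * √(μ ^ 2 - t ^ 2) ^ n))) t := by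
  have h1 : HasDerivAt (fun t : ℝ => μ ^ 2 - t ^ 2) (-(2 * t)) t := by
    simpa using (hasDerivAt_pow 2 t).const_sub (μ ^ 2)
  have h2 := (h1.sqrt ht.ne').pow (n + 2)
  refine h2.congr_deriv ?_
  have h3 : √(μ ^ 2 - t ^ 2) ≠ 0 := (Real.sqrt_pos.2 ht).ne'
  simp only [Nat.cast_add, Nat.cast_ofNat, show n + 2 - 1 = n + 1 by omega, pow_succ]
  field_simp

/-- The derivative is -(n + 2) t (μ² - t²)^(n/2), with one factor increasing and one decreasing;
each bound therefore mixes the two endpoints. The exponent n + 2 keeps the derivative bounded up to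
t = μ. -/
theorem sqrt_pow_slope_bounds (n : ℕ) {a b s : ℝ} (ha : 0 ≤ a) (hb : b ≤ μ)
    (hs : s ∈ Set.Icc a b) :
    -((n + 2) * (b * √(μ ^ 2 - a ^ 2) ^ n)) * (s - a) ≤
        √(μ ^ 2 - s ^ 2) ^ (n + 2) - √(μ ^ 2 - a ^ 2) ^ (n + 2) ∧
      √(μ ^ 2 - s ^ 2) ^ (n + 2) - √(μ ^ 2 - a ^ 2) ^ (n + 2) ≤
        -((n + 2) * (a * √(μ ^ 2 - b ^ 2) ^ n)) * (s - a) := by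
  have hb0 : 0 ≤ b := ha.trans (hs.1.trans hs.2)
  have hc : ContinuousOn (fun t => √(μ ^ 2 - t ^ 2) ^ (n + 2)) (Set.Icc a b) :=
    (continuous_sqrt_pow _ _).continuousOn
  have hder : ∀ t ∈ interior (Set.Icc a b), HasDerivAt (fun t => √(μ ^ 2 - t ^ 2) ^ (n + 2))
      (-((n + 2) * (t * √(μ ^ 2 - t ^ 2) ^ n))) t := by
    intro t ht
    rw [interior_Icc] at ht
    refine hasDerivAt_sqrt_pow n ?_
    have h1 : 0 < t := ha.trans_lt ht.1
    have h2 : t < μ := ht.2.trans_le hb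
    nlinarith
  have hd : DifferentiableOn ℝ (fun t => √(μ ^ 2 - t ^ 2) ^ (n + 2)) (interior (Set.Icc a b)) :=
    fun t ht => (hder t ht).differentiableAt.differentiableWithinAt
  constructor
  · refine (convex_Icc a b).mul_sub_le_image_sub_of_le_deriv hc hd (fun t ht => ?_) a
      ⟨le_rfl, hs.1.trans hs.2⟩ s hs hs.1
    rw [(hder t ht).deriv, neg_le_neg_iff]
    rw [interior_Icc] at ht
    have h3 := sqrt_pow_anti (μ := μ) n ha ht.1.le
    have h4 := ht.2.le
    gcongr
  · refine (convex_Icc a b).image_sub_le_mul_sub_of_deriv_le hc hd (fun t ht => ?_) a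
      ⟨le_rfl, hs.1.trans hs.2⟩ s hs hs.1
    rw [(hder t ht).deriv, neg_le_neg_iff]
    rw [interior_Icc] at ht
    have h3 := sqrt_pow_anti (μ := μ) n (ha.trans ht.1.le) ht.2.le
    have h4 := ht.1.le
    have h5 : 0 ≤ t := ha.trans h4
    gcongr

theorem tail_integral_bounds (n : ℕ) (hh : 0 ≤ h) (hK : K * h ≤ μ) (hK' : μ ≤ K * h + h) :
    0 ≤ ∫ t in (K * h)..μ, √(μ ^ 2 - t ^ 2) ^ n ∧
      ∫ t in (K * h)..μ, √(μ ^ 2 - t ^ 2) ^ n ≤ h * √(μ ^ 2 - (K * h) ^ 2) ^ n := by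
  refine ⟨intervalIntegral.integral_nonneg hK fun t _ => by positivity, ?_⟩
  calc ∫ t in (K * h)..μ, √(μ ^ 2 - t ^ 2) ^ n
      ≤ ∫ t in (K * h)..μ, √(μ ^ 2 - (K * h) ^ 2) ^ n :=
        intervalIntegral.integral_mono_on hK ((continuous_sqrt_pow _ _).intervalIntegrable _ _)
          (by simp) fun t ht => sqrt_pow_anti n (by positivity) ht.1
    _ = (μ - K * h) * √(μ ^ 2 - (K * h) ^ 2) ^ n := by simp
    _ ≤ h * √(μ ^ 2 - (K * h) ^ 2) ^ n := by
        gcongr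
        linarith

/-- The integrand decreases, so the error on each step is at most h times its drop, and the drops
telescope. -/
theorem abs_sum_sqrt_pow_sub_integral_le (n : ℕ) (hμ : 0 ≤ μ) (hh : 0 ≤ h) (hK : K * h ≤ μ)
    (hK' : μ ≤ K * h + h) :
    |h * ∑ k ∈ Finset.range (K + 1), √(μ ^ 2 - (k * h) ^ 2) ^ n -
      ∫ t in (0 : ℝ)..μ, √(μ ^ 2 - t ^ 2) ^ n| ≤ 2 * h * μ ^ n := by
  set f : ℝ → ℝ := fun t => √(μ ^ 2 - t ^ 2) ^ n
  have hf : Continuous f := continuous_sqrt_pow _ _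
  have hstep : ∀ k : ℕ, ((k + 1 : ℕ) : ℝ) * h = k * h + h := fun k => by push_cast; ring
  have h1 := abs_sum_sub_integral_le hf h K (fun k => h * f (k * h))
    (fun k => h * f (k * h) - h * f ((k + 1 : ℕ) * h)) fun k _ => by
      have hk0 : 0 ≤ k * h := by positivity
      have hk1 : (k : ℝ) * h ≤ k * h + h := by linarith
      have e1 : ∫ s in (k * h)..(k * h + h), f s ≤ h * f (k * h) := by
        calc ∫ s in (k * h)..(k * h + h), f s ≤ ∫ s in (k * h)..(k * h + h), f (k * h) :=
              intervalIntegral.integral_mono_on hk1 (hf.intervalIntegrable _ _) (by simp)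
                fun t ht => sqrt_pow_anti n hk0 ht.1
          _ = h * f (k * h) := by simp
      have e2 : h * f (k * h + h) ≤ ∫ s in (k * h)..(k * h + h), f s := by
        calc h * f (k * h + h) = ∫ s in (k * h)..(k * h + h), f (k * h + h) := by simp
          _ ≤ ∫ s in (k * h)..(k * h + h), f s :=
              intervalIntegral.integral_mono_on hk1 (by simp) (hf.intervalIntegrable _ _)
                fun t ht => sqrt_pow_anti n (hk0.trans ht.1) ht.2
      rw [hstep, abs_le]
      constructor <;> linarith
  rw [Finset.sum_range_sub', ← Finset.mul_sum] at h1
  have h2 := tail_integral_bounds n hh hK hK'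
  have h3 := intervalIntegral.integral_add_adjacent_intervals
    (hf.intervalIntegrable (μ := volume) 0 (K * h)) (hf.intervalIntegrable (K * h) μ)
  have h4 : h * f ((0 : ℕ) * h) ≤ h * μ ^ n := mul_le_mul_of_nonneg_left (sqrt_pow_le hμ n _) hh
  have h5 : h * f (K * h) ≤ h * μ ^ n := mul_le_mul_of_nonneg_left (sqrt_pow_le hμ n _) hh
  have h6 : 0 ≤ h * f (K * h) := by positivity
  have h7 : 0 ≤ h * μ ^ n := by positivity
  rw [Finset.sum_range_succ, ← h3, mul_add]
  rw [abs_le] at h1 ⊢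
  constructor <;> linarith [h1.1, h1.2, h2.1, h2.2]

/-- No second derivative is used, as it may blow up at t = μ. Instead the gap M - m between the
slope bounds is at most (n + 2)(μ · drop of q + h μⁿ); the drops telescope, and there are K ≤ μ / h
steps. The last node and the tail contribute O(h²μⁿ⁺¹), because the function is already small there.
-/
theorem abs_trapezoid_sum_sqrt_pow_sub_integral_le (n : ℕ) (hμ : 0 ≤ μ) (hh : 0 ≤ h)
    (hK : K * h ≤ μ) (hK' : μ ≤ K * h + h) :
    |h * (∑ k ∈ Finset.range (K + 1), √(μ ^ 2 - (k * h) ^ 2) ^ (n + 2) - μ ^ (n + 2) / 2) -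
      ∫ t in (0 : ℝ)..μ, √(μ ^ 2 - t ^ 2) ^ (n + 2)| ≤ (n + 5) * h ^ 2 * μ ^ (n + 1) := by
  set f : ℝ → ℝ := fun t => √(μ ^ 2 - t ^ 2) ^ (n + 2)
  set q : ℝ → ℝ := fun t => √(μ ^ 2 - t ^ 2) ^ n
  have hf : Continuous f := continuous_sqrt_pow _ _
  have hstep : ∀ k : ℕ, ((k + 1 : ℕ) : ℝ) * h = k * h + h := fun k => by push_cast; ring
  have h1 := abs_sum_sub_integral_le hf h K (fun k => h * ((f (k * h) + f (k * h + h)) / 2))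
    (fun k => (n + 2) * h ^ 2 / 2 *
      (μ * (q (k * h) - q ((k + 1 : ℕ) * h)) + h * μ ^ n)) fun k hk => by
      have hk0 : 0 ≤ k * h := by positivity
      have hkK : k * h + h ≤ μ := by
        rw [← hstep]
        refine le_trans ?_ hK
        have : ((k + 1 : ℕ) : ℝ) ≤ K := by exact_mod_cast hk
        gcongr
      refine (abs_trapezoid_sub_integral_le hf hh
        (fun s hs => (sqrt_pow_slope_bounds n hk0 hkK hs).1)
        (fun s hs => (sqrt_pow_slope_bounds n hk0 hkK hs).2)).trans ?_
      have e1 : q (k * h + h) ≤ q (k * h) := sqrt_pow_anti n hk0 (by linarith)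
      have e2 : h * q (k * h) ≤ h * μ ^ n := mul_le_mul_of_nonneg_left (sqrt_pow_le hμ n _) hh
      have e3 : k * h * (q (k * h) - q (k * h + h)) ≤ μ * (q (k * h) - q (k * h + h)) :=
        mul_le_mul_of_nonneg_right (by linarith) (sub_nonneg.2 e1)
      rw [hstep]
      calc (-((n + 2) * (k * h * q (k * h + h))) - -((n + 2) * ((k * h + h) * q (k * h)))) *
            h ^ 2 / 2 = (n + 2) * h ^ 2 / 2 *
            (k * h * (q (k * h) - q (k * h + h)) + h * q (k * h)) := by ring
        _ ≤ _ := by gcongr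
  have herr : ∑ k ∈ Finset.range K, ((n + 2) * h ^ 2 / 2 *
      (μ * (q (k * h) - q ((k + 1 : ℕ) * h)) + h * μ ^ n)) ≤ (n + 2) * h ^ 2 * μ ^ (n + 1) := by
    rw [← Finset.mul_sum, Finset.sum_add_distrib, ← Finset.mul_sum,
      Finset.sum_range_sub' (fun k : ℕ => q (k * h)), Finset.sum_const, Finset.card_range,
      nsmul_eq_mul]
    have e1 : q ((0 : ℕ) * h) - q (K * h) ≤ μ ^ n := by
      have := sqrt_pow_le hμ n ((0 : ℕ) * h)
      have : 0 ≤ q (K * h) := by positivity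
      linarith
    calc (n + 2) * h ^ 2 / 2 * (μ * (q ((0 : ℕ) * h) - q (K * h)) + K * (h * μ ^ n))
        ≤ (n + 2) * h ^ 2 / 2 * (μ * μ ^ n + μ * μ ^ n) := by
          rw [← mul_assoc (K : ℝ)]
          gcongr
      _ = (n + 2) * h ^ 2 * μ ^ (n + 1) := by ring
  have h2 := tail_integral_bounds (n + 2) hh hK hK'
  have h3 := intervalIntegral.integral_add_adjacent_intervals
    (hf.intervalIntegrable (μ := volume) 0 (K * h)) (hf.intervalIntegrable (K * h) μ)
  have hsum : h * (∑ k ∈ Finset.range (K + 1), f (k * h) - μ ^ (n + 2) / 2) =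
      ∑ k ∈ Finset.range K, h * ((f (k * h) + f (k * h + h)) / 2) + h * f (K * h) / 2 := by
    have e0 : f ((0 : ℕ) * h) = μ ^ (n + 2) := by
      simp [f, Real.sqrt_sq hμ]
    have e1 := Finset.sum_range_succ' (fun k : ℕ => f (k * h)) K
    have e2 := Finset.sum_range_succ (fun k : ℕ => f (k * h)) K
    simp only [hstep] at e1
    rw [← Finset.mul_sum, ← Finset.sum_div, Finset.sum_add_distrib]
    rw [e0] at e1
    linear_combination (h / 2) * e1 + (h / 2) * e2
  -- From μ - Kh ≤ h and μ + Kh ≤ 2μ one gets μ² - (Kh)² ≤ 2hμ, one power of μ better than the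
  -- trivial bound.
  have hfK : f (K * h) ≤ 2 * h * μ ^ (n + 1) := by
    have hKh : 0 ≤ K * h := by positivity
    have e0 : 0 ≤ μ ^ 2 - (K * h) ^ 2 := by nlinarith
    have e1 : f (K * h) = (μ ^ 2 - (K * h) ^ 2) * q (K * h) := by
      simp only [f, q]
      rw [pow_add, Real.sq_sqrt e0, mul_comm]
    have e2 : μ ^ 2 - (K * h) ^ 2 ≤ 2 * h * μ := by nlinarith
    rw [e1]
    calc (μ ^ 2 - (K * h) ^ 2) * q (K * h) ≤ (2 * h * μ) * μ ^ n := by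
          gcongr
          exact sqrt_pow_le hμ n _
      _ = 2 * h * μ ^ (n + 1) := by ring
  have hfK' := mul_le_mul_of_nonneg_left hfK hh
  have h6 : 0 ≤ h * f (K * h) := by positivity
  have h7 := h1.trans herr
  have h8 : 0 ≤ h ^ 2 * μ ^ (n + 1) := by positivity
  rw [hsum, ← h3]
  rw [abs_le] at h7 ⊢
  constructor <;> nlinarith [h7.1, h7.2, h2.1, h2.2]

end RiemannSums

/-! ### Comparison of the Weyl remainders -/

section Asymptotics

variable {bc : BoundaryCondition} {R L : ℝ}

theorem abs_sign (bc : BoundaryCondition) : |bc.sign| = 1 := by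
  cases bc <;> simp [BoundaryCondition.sign]

theorem sign_mul_sign (bc : BoundaryCondition) : bc.sign * bc.sign = 1 := by
  cases bc <;> simp [BoundaryCondition.sign]

theorem unitBallVolume_pos (k : ℕ) : 0 < unitBallVolume k :=
  ENNReal.toReal_pos (Metric.measure_ball_pos _ _ one_pos).ne'
    Metric.isBounded_ball.measure_lt_top.ne

theorem volume_ball_pos (n : ℕ) (hR : 0 < R) :
    0 < volume.real (ball n R : Set (EuclideanSpace ℝ (Fin n))) :=
  ENNReal.toReal_pos (Metric.measure_ball_pos _ _ hR).ne' Metric.isBounded_ball.measure_lt_top.ne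

/-- The coefficient of `μⁿ` in Weyl's law. -/
def weylVolume {n : ℕ} (Ω : Opens (EuclideanSpace ℝ (Fin n))) : ℝ :=
  unitBallVolume n / (2 * Real.pi) ^ n * volume.real (Ω : Set (EuclideanSpace ℝ (Fin n)))

/-- The absolute value of the coefficient of `μⁿ⁻¹` in Weyl's law. -/
def weylSurface {n : ℕ} (Ω : Opens (EuclideanSpace ℝ (Fin n))) : ℝ :=
  unitBallVolume (n - 1) / (4 * (2 * Real.pi) ^ (n - 1)) *
    (μHE[n - 1] : Measure (EuclideanSpace ℝ (Fin n))).real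
      (frontier (Ω : Set (EuclideanSpace ℝ (Fin n))))

theorem weylRemainder_eq (bc : BoundaryCondition) {n : ℕ} (Ω : Opens (EuclideanSpace ℝ (Fin n)))
    (μ : ℝ) : weylRemainder bc Ω μ = (counting bc Ω μ).toReal -
      (weylVolume Ω * μ ^ n + bc.sign * (weylSurface Ω * μ ^ (n - 1))) := rfl

theorem weylVolume_ball_pos (n : ℕ) (hR : 0 < R) : 0 < weylVolume (ball n R) := by
  have := unitBallVolume_pos n
  have := volume_ball_pos n hR
  unfold weylVolume
  positivity

theorem weylVolume_cylinder {n : ℕ} (hn : 1 ≤ n) (hL : 0 < L) :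
    weylVolume (cylinder n R L) =
      weylVolume (ball n R) * semicircleIntegral n / (Real.pi / L) := by
  rw [weylVolume, weylVolume, volume_cylinder n R hL.le, unitBallVolume_succ hn, pow_succ]
  field_simp

/-- The two bases give ω_n / (4 (2π)ⁿ) · 2|B|, half the volume coefficient of the ball; the wall
gives the other term through the recursion for ω_n. -/
theorem weylSurface_cylinder {n : ℕ} (hn : 2 ≤ n) (hR : 0 < R) (hL : 0 < L) :
    weylSurface (cylinder n R L) = weylVolume (ball n R) / 2 +
      weylSurface (ball n R) * semicircleIntegral (n - 1) / (Real.pi / L) := by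
  have h := unitBallVolume_succ (n := n - 1) (by omega)
  rw [Nat.sub_add_cancel (by omega)] at h
  have h1 : (2 * Real.pi) ^ n = (2 * Real.pi) ^ (n - 1) * (2 * Real.pi) := by
    rw [← pow_succ, Nat.sub_add_cancel (by omega)]
  rw [weylSurface, weylSurface, weylVolume, Nat.add_sub_cancel,
    euclideanHausdorffMeasure_frontier_cylinder (by omega) hR hL, h1, h]
  field_simp
  ring

/-- An infinite count persists for larger μ by monotonicity, and its real value is 0 by convention.
The remainder would then be minus the Weyl terms, of exact order μⁿ, against p < n. -/
theorem counting_ne_top_of_isBigO {n : ℕ} (hn : 1 ≤ n) {Ω : Opens (EuclideanSpace ℝ (Fin n))}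
    (hΩ : weylVolume Ω ≠ 0) {p : ℝ} (hp : p < n)
    (h : (fun μ : ℝ => weylRemainder bc Ω μ) =O[atTop] fun μ : ℝ => μ ^ p) {ν : ℝ} (hν : 0 ≤ ν) :
    counting bc Ω ν ≠ ⊤ := by
  intro htop
  have h1 : (fun μ : ℝ => μ ^ p) =o[atTop] fun μ : ℝ => μ ^ n := by
    refine isLittleO_of_tendsto' ?_ ?_
    · filter_upwards [eventually_gt_atTop 0] with μ hμ h0
      exact absurd h0 (pow_pos hμ n).ne'
    · refine (tendsto_rpow_neg_atTop (sub_pos.2 hp)).congr' ?_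
      filter_upwards [eventually_gt_atTop 0] with μ hμ
      rw [neg_sub, Real.rpow_sub hμ, Real.rpow_natCast]
  have h2 : (fun μ : ℝ => μ ^ (n - 1)) =o[atTop] fun μ : ℝ => μ ^ n :=
    isLittleO_pow_pow_atTop_of_lt (by omega)
  have h3 := (h.trans_isLittleO h1).neg_left.sub (h2.const_mul_left (bc.sign * weylSurface Ω))
  have h4 : (fun μ : ℝ => weylVolume Ω * μ ^ n) =o[atTop] fun μ : ℝ => μ ^ n := by
    refine h3.congr' ?_ .rfl
    filter_upwards [eventually_ge_atTop ν] with μ hμ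
    have h5 : counting bc Ω μ = ⊤ := top_unique (htop ▸ counting_mono Ω hν hμ)
    rw [weylRemainder_eq, h5]
    simp
    ring
  have h6 : (fun μ : ℝ => μ ^ n) =o[atTop] fun μ : ℝ => μ ^ n :=
    (isLittleO_const_mul_left_iff hΩ).1 h4
  refine isLittleO_irrefl ?_ h6
  exact (eventually_gt_atTop 0).frequently.mono fun μ hμ => (pow_pos hμ n).ne'

/-- The arguments √(μ² - (kh)²) need not be large, so a bound uniform on [0, μ] is required. Below
the threshold `x₁` the remainder is bounded by finiteness and monotonicity of the count; p ≥ 0 lets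
μ^p dominate both ranges. -/
theorem exists_bound_weylRemainder {n : ℕ} {Ω : Opens (EuclideanSpace ℝ (Fin n))} {p : ℝ}
    (hp : 0 ≤ p) (h : (fun μ : ℝ => weylRemainder bc Ω μ) =O[atTop] fun μ : ℝ => μ ^ p)
    (hfin : ∀ ν, 0 ≤ ν → counting bc Ω ν ≠ ⊤) :
    ∃ C, 0 ≤ C ∧ ∀ μ, 1 ≤ μ → ∀ x, 0 ≤ x → x ≤ μ → |weylRemainder bc Ω x| ≤ C * μ ^ p := by
  obtain ⟨c, hc⟩ := h.bound
  obtain ⟨x₀, hx₀⟩ := eventually_atTop.1 hc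
  set x₁ := max x₀ 1
  set M := (counting bc Ω x₁).toReal + (|weylVolume Ω| * x₁ ^ n + |weylSurface Ω| * x₁ ^ (n - 1))
  have hx₁ : 0 ≤ x₁ := zero_le_one.trans (le_max_right _ _)
  refine ⟨max |c| M, (abs_nonneg c).trans (le_max_left _ _), fun μ hμ x hx hxμ => ?_⟩
  have hμp : 1 ≤ μ ^ p := Real.one_le_rpow hμ hp
  rcases le_total x₁ x with h1 | h1
  · have h2 := hx₀ x ((le_max_left _ _).trans h1)
    rw [Real.norm_eq_abs, Real.norm_eq_abs, abs_of_nonneg (Real.rpow_nonneg hx p)] at h2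
    refine h2.trans ?_
    calc c * x ^ p ≤ |c| * x ^ p := by gcongr; exact le_abs_self c
      _ ≤ max |c| M * μ ^ p := by
        gcongr
        exact le_max_left _ _
  · have h2 : |weylRemainder bc Ω x| ≤ M := by
      rw [weylRemainder_eq]
      refine (abs_sub _ _).trans (add_le_add ?_ ((abs_add_le _ _).trans (add_le_add ?_ ?_)))
      · rw [abs_of_nonneg ENNReal.toReal_nonneg]
        exact ENNReal.toReal_mono (hfin _ hx₁) (counting_mono Ω hx h1)
      · rw [abs_mul, abs_of_nonneg (pow_nonneg hx n)]
        gcongr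
      · rw [abs_mul, abs_mul, abs_sign, one_mul, abs_of_nonneg (pow_nonneg hx (n - 1))]
        gcongr
    calc |weylRemainder bc Ω x| ≤ max |c| M * 1 := by
          rw [mul_one]
          exact h2.trans (le_max_right _ _)
      _ ≤ max |c| M * μ ^ p := by
          have : 0 ≤ max |c| M := (abs_nonneg c).trans (le_max_left _ _)
          gcongr

/-- Both conditions are put in one formula: the sum starts at k = 0, and the factor (1 - sign)/2,
which is 1 for Dirichlet and 0 for Neumann, removes that term when it is absent. -/
theorem toReal_counting_cylinder {n : ℕ} (hL : 0 < L)
    (hfin : ∀ ν, 0 ≤ ν → counting bc (ball n R) ν ≠ ⊤) {μ : ℝ} (hμ : 0 ≤ μ) :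
    (counting bc (cylinder n R L) μ).toReal =
      ∑ k ∈ Finset.range (⌊μ / (Real.pi / L)⌋₊ + 1),
        (counting bc (ball n R) √(μ ^ 2 - (k * (Real.pi / L)) ^ 2)).toReal -
      (1 - bc.sign) / 2 * (counting bc (ball n R) μ).toReal := by
  have hh : 0 < Real.pi / L := div_pos Real.pi_pos hL
  have hfreq : ∀ k, freq bc L k = bc.index k * (Real.pi / L) := fun k => by
    rw [freq, mul_div_assoc]
  have hle : ∀ j : ℕ, j * (Real.pi / L) ≤ μ ↔ j ≤ ⌊μ / (Real.pi / L)⌋₊ := fun j => by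
    rw [Nat.le_floor_iff (by positivity), le_div_iff₀ hh]
  rw [counting_cylinder hL hμ]
  simp only [hfreq, hle]
  cases bc
  · rw [tsum_eq_sum (s := Finset.range ⌊μ / (Real.pi / L)⌋₊), Finset.sum_range_succ',
      ENNReal.toReal_sum]
    · have h0 : √(μ ^ 2 - (((0 : ℕ) : ℝ) * (Real.pi / L)) ^ 2) = μ := by simp [Real.sqrt_sq hμ]
      rw [h0]
      have h1 : ∀ k ∈ Finset.range ⌊μ / (Real.pi / L)⌋₊,
          BoundaryCondition.dirichlet.index k ≤ ⌊μ / (Real.pi / L)⌋₊ :=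
        fun k hk => Nat.succ_le_of_lt (Finset.mem_range.1 hk)
      rw [Finset.sum_congr rfl fun k hk => by rw [if_pos (h1 k hk)]]
      simp only [BoundaryCondition.sign, BoundaryCondition.index]
      ring
    · intro k _
      split_ifs
      · exact hfin _ (Real.sqrt_nonneg _)
      · simp
    · intro k hk
      refine if_neg fun h => hk ?_
      simp only [BoundaryCondition.index] at h
      exact Finset.mem_range.2 h
  · rw [tsum_eq_sum (s := Finset.range (⌊μ / (Real.pi / L)⌋₊ + 1)), ENNReal.toReal_sum]
    · have h1 : ∀ k ∈ Finset.range (⌊μ / (Real.pi / L)⌋₊ + 1),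
          BoundaryCondition.neumann.index k ≤ ⌊μ / (Real.pi / L)⌋₊ :=
        fun k hk => Nat.lt_succ_iff.1 (Finset.mem_range.1 hk)
      rw [Finset.sum_congr rfl fun k hk => by rw [if_pos (h1 k hk)]]
      simp only [BoundaryCondition.sign, BoundaryCondition.index]
      ring
    · intro k _
      split_ifs
      · exact hfin _ (Real.sqrt_nonneg _)
      · simp
    · intro k hk
      refine if_neg fun h => hk ?_
      simp only [BoundaryCondition.index] at h
      exact Finset.mem_range.2 (Nat.lt_succ_of_le h)

/-- The trapezoid sum leaves A μⁿ / 2 over; subtracting (1 - σ)/2 · A μⁿ turns it into σ A μⁿ / 2,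
which is the share of the bases. Of the factor 3, two come from the Riemann sum and one from the
corrected term k = 0. The factor μ / h + 2 counts the at most μ / h + 1 summands and that
correction. -/
theorem abs_weylRemainder_cylinder_le {n : ℕ} (hn : 2 ≤ n) (hR : 0 < R) (hL : 0 < L)
    (hfin : ∀ ν, 0 ≤ ν → counting bc (ball n R) ν ≠ ⊤) {μ D : ℝ} (hμ : 0 ≤ μ)
    (hD : ∀ x, 0 ≤ x → x ≤ μ → |weylRemainder bc (ball n R) x| ≤ D) :
    |weylRemainder bc (cylinder n R L) μ| ≤
      ((n + 3) * (Real.pi / L) * weylVolume (ball n R) + 3 * |weylSurface (ball n R)|) *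
        μ ^ (n - 1) + (μ / (Real.pi / L) + 2) * D := by
  obtain ⟨m, rfl⟩ : ∃ m, n = m + 2 := ⟨n - 2, by omega⟩
  have hm : m + 2 - 1 = m + 1 := by omega
  have hh : 0 < Real.pi / L := div_pos Real.pi_pos hL
  rw [weylRemainder_eq, toReal_counting_cylinder hL hfin hμ,
    weylVolume_cylinder (by omega) hL, weylSurface_cylinder (by omega) hR hL,
    Nat.add_sub_cancel, hm]
  have hA : 0 < weylVolume (ball (m + 2) R) := weylVolume_ball_pos _ hR
  set A := weylVolume (ball (m + 2) R)
  set B := weylSurface (ball (m + 2) R)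
  set h := Real.pi / L
  set K := ⌊μ / h⌋₊
  set σ := bc.sign
  have hσ2 : σ * σ = 1 := sign_mul_sign bc
  have hσ1 : |σ| = 1 := abs_sign bc
  have hK1 : (K : ℝ) ≤ μ / h := Nat.floor_le (by positivity)
  have hK : K * h ≤ μ := (le_div_iff₀ hh).1 hK1
  have hK' : μ ≤ K * h + h := by
    have := (Nat.lt_floor_add_one (μ / h)).le
    rw [div_le_iff₀ hh] at this
    linarith
  set r : ℝ → ℝ := weylRemainder bc (ball (m + 2) R)
  have hcount : ∀ x, (counting bc (ball (m + 2) R) x).toReal =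
      A * x ^ (m + 2) + σ * B * x ^ (m + 1) + r x := by
    intro x
    simp only [r]
    rw [weylRemainder_eq, hm]
    ring
  simp only [hcount]
  rw [Finset.sum_add_distrib, Finset.sum_add_distrib, ← Finset.mul_sum, ← Finset.mul_sum]
  have e1 := abs_trapezoid_sum_sqrt_pow_sub_integral_le m hμ hh.le hK hK'
  have e2 := abs_sum_sqrt_pow_sub_integral_le (m + 1) hμ hh.le hK hK'
  rw [integral_sqrt_sub_pow hμ] at e1 e2
  set S₁ := ∑ k ∈ Finset.range (K + 1), √(μ ^ 2 - (k * h) ^ 2) ^ (m + 2)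
  set S₂ := ∑ k ∈ Finset.range (K + 1), √(μ ^ 2 - (k * h) ^ 2) ^ (m + 1)
  set S₃ := ∑ k ∈ Finset.range (K + 1), r √(μ ^ 2 - (k * h) ^ 2)
  have hD0 : 0 ≤ D := (abs_nonneg _).trans (hD 0 le_rfl hμ)
  have e3 : |S₃| ≤ (μ / h + 1) * D := by
    refine (Finset.abs_sum_le_sum_abs _ _).trans ?_
    calc ∑ k ∈ Finset.range (K + 1), |r √(μ ^ 2 - (k * h) ^ 2)|
        ≤ ∑ _k ∈ Finset.range (K + 1), D := Finset.sum_le_sum fun k _ =>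
          hD _ (Real.sqrt_nonneg _) (by simpa using sqrt_pow_le hμ 1 (k * h))
      _ = (K + 1) * D := by simp
      _ ≤ (μ / h + 1) * D := by gcongr
  have f1 : |S₁ - μ ^ (m + 2) / 2 - μ ^ (m + 3) * semicircleIntegral (m + 2) / h| ≤
      (m + 5) * h * μ ^ (m + 1) := by
    have : S₁ - μ ^ (m + 2) / 2 - μ ^ (m + 3) * semicircleIntegral (m + 2) / h =
        (h * (S₁ - μ ^ (m + 2) / 2) - μ ^ (m + 3) * semicircleIntegral (m + 2)) / h := by
      field_simp
    rw [this, abs_div, abs_of_pos hh, div_le_iff₀ hh]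
    refine e1.trans (le_of_eq ?_)
    ring
  have f2 : |S₂ - μ ^ (m + 2) * semicircleIntegral (m + 1) / h| ≤ 2 * μ ^ (m + 1) := by
    have : S₂ - μ ^ (m + 2) * semicircleIntegral (m + 1) / h =
        (h * S₂ - μ ^ (m + 2) * semicircleIntegral (m + 1)) / h := by
      field_simp
    rw [this, abs_div, abs_of_pos hh, div_le_iff₀ hh]
    refine e2.trans (le_of_eq ?_)
    ring
  have hσ3 : |(1 - σ) / 2| ≤ 1 := by
    rw [abs_div, abs_two, div_le_one two_pos]
    refine (abs_sub _ _).trans ?_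
    rw [hσ1, abs_one]
    norm_num
  have hpow : 0 ≤ μ ^ (m + 1) := pow_nonneg hμ _
  have hdecomp : A * S₁ + σ * B * S₂ + S₃ -
      (1 - σ) / 2 * (A * μ ^ (m + 2) + σ * B * μ ^ (m + 1) + r μ) -
      (A * semicircleIntegral (m + 2) / h * μ ^ (m + 2 + 1) +
        σ * ((A / 2 + B * semicircleIntegral (m + 1) / h) * μ ^ (m + 2))) =
      A * (S₁ - μ ^ (m + 2) / 2 - μ ^ (m + 3) * semicircleIntegral (m + 2) / h) +
      σ * B * (S₂ - μ ^ (m + 2) * semicircleIntegral (m + 1) / h) +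
      (S₃ - (1 - σ) / 2 * (σ * B * μ ^ (m + 1) + r μ)) := by
    ring
  rw [hdecomp]
  have g1 : |A * (S₁ - μ ^ (m + 2) / 2 - μ ^ (m + 3) * semicircleIntegral (m + 2) / h)| ≤
      A * ((m + 5) * h * μ ^ (m + 1)) := by
    rw [abs_mul, abs_of_pos hA]
    gcongr
  have g2 : |σ * B * (S₂ - μ ^ (m + 2) * semicircleIntegral (m + 1) / h)| ≤
      |B| * (2 * μ ^ (m + 1)) := by
    rw [abs_mul, abs_mul, hσ1, one_mul]
    gcongr
  have g3 : |(1 - σ) / 2 * (σ * B * μ ^ (m + 1) + r μ)| ≤ |B| * μ ^ (m + 1) + D := by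
    rw [abs_mul]
    refine (mul_le_of_le_one_left (abs_nonneg _) hσ3).trans ((abs_add_le _ _).trans ?_)
    rw [abs_mul, abs_mul, hσ1, one_mul, abs_of_nonneg hpow]
    exact add_le_add le_rfl (hD μ hμ le_rfl)
  refine (abs_add_le _ _).trans ((add_le_add ((abs_add_le _ _).trans (add_le_add g1 g2))
    ((abs_sub _ _).trans (add_le_add e3 g3))).trans (le_of_eq ?_))
  push_cast
  ring

theorem weylRemainder_cylinder_isBigO {n : ℕ} (hn : 2 ≤ n) (hR : 0 < R) (hL : 0 < L)
    (hfin : ∀ ν, 0 ≤ ν → counting bc (ball n R) ν ≠ ⊤) {p : ℝ} (hp : (n : ℝ) - 2 ≤ p)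
    (h : (fun μ : ℝ => weylRemainder bc (ball n R) μ) =O[atTop] fun μ : ℝ => μ ^ p) :
    (fun μ : ℝ => weylRemainder bc (cylinder n R L) μ) =O[atTop] fun μ : ℝ => μ ^ (p + 1) := by
  have hn' : (2 : ℝ) ≤ n := by exact_mod_cast hn
  obtain ⟨C, hC, hbound⟩ := exists_bound_weylRemainder (by linarith) h hfin
  have hh : 0 < Real.pi / L := div_pos Real.pi_pos hL
  set A := (n + 3) * (Real.pi / L) * weylVolume (ball n R) + 3 * |weylSurface (ball n R)|
  have hA : 0 ≤ A := by
    have := (weylVolume_ball_pos n hR).le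
    positivity
  refine IsBigO.of_bound (A + (1 / (Real.pi / L) + 2) * C) ?_
  filter_upwards [eventually_ge_atTop 1] with μ hμ
  have hμ0 : 0 < μ := zero_lt_one.trans_le hμ
  have h1 := abs_weylRemainder_cylinder_le hn hR hL hfin hμ0.le (hbound μ hμ)
  rw [Real.norm_eq_abs, Real.norm_eq_abs, abs_of_nonneg (Real.rpow_nonneg hμ0.le _)]
  -- Here p ≥ n - 2 is used: the Riemann sum errors are no larger than the summed remainders.
  have h2 : μ ^ (n - 1) ≤ μ ^ (p + 1) := by
    rw [← Real.rpow_natCast, Nat.cast_sub (by omega)]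
    refine Real.rpow_le_rpow_of_exponent_le hμ ?_
    push_cast
    linarith
  have h3 : μ ^ (p + 1) = μ * μ ^ p := by
    rw [Real.rpow_add hμ0, Real.rpow_one, mul_comm]
  have h4 : μ / (Real.pi / L) + 2 ≤ (1 / (Real.pi / L) + 2) * μ := by
    have : μ / (Real.pi / L) = 1 / (Real.pi / L) * μ := by ring
    rw [this, add_mul]
    linarith
  calc |weylRemainder bc (cylinder n R L) μ|
      ≤ A * μ ^ (n - 1) + (μ / (Real.pi / L) + 2) * (C * μ ^ p) := h1
    _ ≤ A * μ ^ (p + 1) + (1 / (Real.pi / L) + 2) * μ * (C * μ ^ p) := by gcongr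
    _ = (A + (1 / (Real.pi / L) + 2) * C) * μ ^ (p + 1) := by rw [h3]; ring

end Asymptotics

end WeylLaw

end

theorem theorem1p1 (bc : WeylLaw.BoundaryCondition) (d : ℕ) (hd : 3 ≤ d) (R L : ℝ)
    (hR : 0 < R) (hL : 0 < L) (α : ℝ) (hα : α ∈ Set.Ioo (0 : ℝ) 1)
    (hball : ∀ ε : ℝ, 0 < ε →
      (fun μ : ℝ => WeylLaw.weylRemainder bc (WeylLaw.ball (d - 1) R) μ)
        =O[atTop] fun μ : ℝ => μ ^ ((d : ℝ) - 3 + α + ε)) :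
    ∀ ε : ℝ, 0 < ε →
      (fun μ : ℝ => WeylLaw.weylRemainder bc (WeylLaw.cylinder (d - 1) R L) μ)
        =O[atTop] fun μ : ℝ => μ ^ ((d : ℝ) - 2 + α + ε) := by
  intro ε hε
  have hcast : ((d - 1 : ℕ) : ℝ) = d - 1 := by
    rw [Nat.cast_sub (by omega), Nat.cast_one]
  -- Taking ε = 1 is enough for finiteness: the exponent d - 2 + α is below d - 1 because α < 1.
  have hfin : ∀ ν, 0 ≤ ν → WeylLaw.counting bc (WeylLaw.ball (d - 1) R) ν ≠ ⊤ := fun ν hν =>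
    WeylLaw.counting_ne_top_of_isBigO (by omega) (WeylLaw.weylVolume_ball_pos _ hR).ne'
      (by rw [hcast]; linarith [hα.2]) (hball 1 one_pos) hν
  have h := WeylLaw.weylRemainder_cylinder_isBigO (by omega) hR hL hfin
    (by rw [hcast]; linarith [hα.1]) (hball ε hε)
  have hexp : (d : ℝ) - 3 + α + ε + 1 = d - 2 + α + ε := by ring
  rwa [hexp] at h
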